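/- Conventions. A computable Polish space is a complete separable metric space $(X,d)$ with a dense sequence $(\alpha_n)_{n\in\omega}$ such that $(m,n)\mapsto d(\alpha_m,\alpha_n)$ is computable. A (Cauchy) name of $x\in X$ is a sequence $p\in\omega^\omega$ with $d(\alpha_{p(n)},\alpha_{p(m)})<2^{-n}$ for all $m\ge n$ and $\lim_n\alpha_{p(n)}=x$. A function $f:X\to Y$ between such spaces is computable if a partial computable function on $\omega^\omega$ sends every name of every $x\in X$ to a name of $f(x)$. A point $y\in Y$ is $tt$-reducible to a point $x\in X$ if there is a total computable function $\Phi:\omega^\omega\to\omega^\omega$ which maps every name of $x$ to a name of $y$; $x$ and $y$ are $tt$-equivalent if each is $tt$-reducible to the other. A set is $\Pi^0_1$ if its complement is the union of a computably enumerable family of rational open balls. The spaces $[0,1]$, $[0,1]^\omega$, $\mathbb R$, $2^\omega$ and $\mathbb R\times 2^\omega$ carry their standard structures of computable Polish spaces. Let $f:[0,1]\to[0,1]$. The orbit of $x\in[0,1]$ is $\{f^n(x):n\in\omega\}$. The point $x$ is effectively asymptotically periodic if the closure of its orbit $O$ is a $\Pi^0_1$ subset of $[0,1]$ and is the union of $O$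 and a finite orbit (the orbit of some point, which is finite as a set). **Theorem.** Let $f:[0,1]\to[0,1]$ be a computable function that is piecewise monotone ($[0,1]$ is a finite union of closed intervals on each of which $f$ is monotone) and finite-to-one (every $f^{-1}\{y\}$ is finite), and suppose that every local extremum $z$ of $f$ with $0<z<1$ (local maximum or minimum point) is effectively asymptotically periodic. Let $$K=\varprojlim([0,1],f)=\{x\in[0,1]^\omega:(\forall n\in\omega)\ f(x(n+1))=x(n)\}$$ be the inverse limit of arcs with the single bonding map $f$. Then every point of $K$ (as a point of $[0,1]^\omega$) is $tt$-equivalent to a point of $\mathbb R\times 2^\omega$. -/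

import Mathlib

/-- A double sequence of non-negative reals is uniformly computable: given `m`, `n`, `k` one can
compute a natural number `φ (m, n, k)` such that `φ (m, n, k) / 2 ^ k` is within `2 ^ (-k)` of
`d m n`. -/
def IsComputableDoubleSeq (d : ℕ → ℕ → ℝ) : Prop :=
  ∃ φ : ℕ × ℕ × ℕ → ℕ, Computable φ ∧
    ∀ m n k : ℕ, |d m n - (φ (m, n, k) : ℝ) / 2 ^ k| ≤ (1 / 2) ^ k

/-- A computable Polish space with underlying set `X`: a complete metric together with a dense
sequence `pt` such that `(m, n) ↦ d (pt m, pt n)` is computable. -/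
structure ComputablePolishSpace (X : Type*) where
  metric : MetricSpace X
  complete : @CompleteSpace X metric.toUniformSpace
  pt : ℕ → X
  dense : @DenseRange X metric.toUniformSpace.toTopologicalSpace ℕ pt
  computable_dist : IsComputableDoubleSeq fun m n => @dist X metric.toDist (pt m) (pt n)

namespace ComputablePolishSpace

variable {X Y : Type*}

/-- `p` is a Cauchy name of `x`: `d (pt (p n), pt (p m)) < 2 ^ (-n)` for all `m ≥ n`, and `x` is the
limit of the sequence `pt (p n)`. -/
def IsName (S : ComputablePolishSpace X) (p : ℕ → ℕ) (x : X) : Prop :=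
  letI := S.metric
  (∀ n m : ℕ, n ≤ m → dist (S.pt (p n)) (S.pt (p m)) < (1 / 2 : ℝ) ^ n) ∧
    Filter.Tendsto (fun n => S.pt (p n)) Filter.atTop (nhds x)

/-- `C` is a `Π⁰₁` (co-c.e. closed) subset: its complement is the union of a computably enumerable
family of rational open balls `B (pt n, a / (b + 1))`. -/
def IsPi01 (S : ComputablePolishSpace X) (C : Set X) : Prop :=
  letI := S.metric
  ∃ W : ℕ × ℕ × ℕ → Prop, REPred W ∧
    Cᶜ = ⋃ (n : ℕ) (a : ℕ) (b : ℕ) (_ : W (n, a, b)),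
      Metric.ball (S.pt n) ((a : ℝ) / ((b : ℝ) + 1))

end ComputablePolishSpace

/-- The initial segment of `p` of length `k`. -/
def initialSegment (p : ℕ → ℕ) (k : ℕ) : List ℕ := (List.range k).map p

/-- The oracle computation described by `φ` turns the oracle `p` into the total function `q`.
Here `φ σ n` is the value of the `n`-th output entry which the computation delivers from the
initial segment `σ` of the oracle, if there is any (within `σ.length` many steps). -/
def Tracks (φ : List ℕ → ℕ → Option ℕ) (p q : ℕ → ℕ) : Prop :=
  ∀ n : ℕ, (∃ k, φ (initialSegment p k) n = some (q n)) ∧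
    ∀ k m, φ (initialSegment p k) n = some m → m = q n

/-- `Φ : ω^ω → ω^ω` is a total computable function. -/
def IsComputableFunctional (Φ : (ℕ → ℕ) → (ℕ → ℕ)) : Prop :=
  ∃ φ : List ℕ → ℕ → Option ℕ, Computable₂ φ ∧ ∀ p, Tracks φ p (Φ p)

namespace ComputablePolishSpace

variable {X Y : Type*}

/-- `f : X → Y` is computable: there is a partial computable function on `ω^ω` which sends every
name of every `x` to a name of `f x`. -/
def IsComputableMap (S : ComputablePolishSpace X) (T : ComputablePolishSpace Y) (f : X → Y) :
    Prop :=
  ∃ φ : List ℕ → ℕ → Option ℕ, Computable₂ φ ∧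
    ∀ x p, S.IsName p x → ∃ q, Tracks φ p q ∧ T.IsName q (f x)

/-- The point `y` of `T` is `tt`-reducible to the point `x` of `S`: some total computable
`Φ : ω^ω → ω^ω` maps every name of `x` to a name of `y`. -/
def TTReducible (S : ComputablePolishSpace X) (T : ComputablePolishSpace Y) (y : Y) (x : X) :
    Prop :=
  ∃ Φ : (ℕ → ℕ) → (ℕ → ℕ), IsComputableFunctional Φ ∧ ∀ p, S.IsName p x → T.IsName (Φ p) y

/-- The point `x` of `S` and the point `y` of `T` are `tt`-equivalent. -/
def TTEquivalent (S : ComputablePolishSpace X) (T : ComputablePolishSpace Y) (x : X) (y : Y) :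
    Prop :=
  TTReducible S T y x ∧ TTReducible T S x y

end ComputablePolishSpace

section Constructions

/-- Rational approximations with computable numerators and denominators suffice. -/
theorem IsComputableDoubleSeq.of_rat {d : ℕ → ℕ → ℝ} (a b : ℕ × ℕ × ℕ → ℕ)
    (ha : Computable a) (hb : Computable b) (hb0 : ∀ t, 0 < b t)
    (h : ∀ m n k : ℕ, |d m n - (a (m, n, k) : ℝ) / (b (m, n, k) : ℝ)| ≤ (1 / 2) ^ (k + 1)) :
    IsComputableDoubleSeq d := by
  have hpow : Computable (fun t : ℕ × ℕ × ℕ => 2 ^ t.2.2) :=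
    ((Primrec₂.unpaired'.1 Nat.Primrec.pow).comp (Primrec.const 2)
      (Primrec.snd.comp Primrec.snd)).to_comp
  have hmul : Computable₂ ((· * ·) : ℕ → ℕ → ℕ) := Primrec.nat_mul.to_comp
  have hadd : Computable₂ ((· + ·) : ℕ → ℕ → ℕ) := Primrec.nat_add.to_comp
  have hdiv : Computable₂ ((· / ·) : ℕ → ℕ → ℕ) := Primrec.nat_div.to_comp
  refine ⟨fun t => (2 * (a t * 2 ^ t.2.2) + b t) / (2 * b t),
    hdiv.comp (hadd.comp (hmul.comp (Computable.const 2) (hmul.comp ha hpow)) hb)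
      (hmul.comp (Computable.const 2) hb), fun m n k => ?_⟩
  have h1 := h m n k
  have hb1 := hb0 (m, n, k)
  simp only
  generalize a (m, n, k) = p at *
  generalize b (m, n, k) = q at *
  set r := (2 * (p * 2 ^ k) + q) / (2 * q) with hr
  have e1 : 2 * q * r ≤ 2 * (p * 2 ^ k) + q := Nat.mul_div_le _ _
  have e2 : 2 * (p * 2 ^ k) + q < 2 * q * (r + 1) :=
    Nat.lt_mul_div_succ _ (by positivity)
  have e1' : (2 * q * r : ℝ) ≤ 2 * (p * 2 ^ k) + q := by exact_mod_cast e1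
  have e2' : (2 * (p * 2 ^ k) + q : ℝ) < 2 * q * (r + 1) := by exact_mod_cast e2
  have hq : (0 : ℝ) < q := by exact_mod_cast hb1
  have hk : (0 : ℝ) < 2 ^ k := by positivity
  have h2 : |(p : ℝ) / q - r / 2 ^ k| ≤ (1 / 2) ^ (k + 1) := by
    have : (p : ℝ) / q - r / 2 ^ k = (2 * (p * 2 ^ k) - 2 * q * r) / (2 * q * 2 ^ k) := by
      field_simp
    rw [this, abs_div, abs_of_pos (show (0 : ℝ) < 2 * q * 2 ^ k by positivity),
      div_le_iff₀ (by positivity)]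
    have : ((1 : ℝ) / 2) ^ (k + 1) * (2 * q * 2 ^ k) = q := by
      rw [one_div, inv_pow, pow_succ]; field_simp
    rw [this, abs_le]
    constructor <;> linarith
  calc |d m n - r / 2 ^ k| ≤ |d m n - p / q| + |(p : ℝ) / q - r / 2 ^ k| := abs_sub_le _ _ _
    _ ≤ (1 / 2) ^ (k + 1) + (1 / 2) ^ (k + 1) := add_le_add h1 h2
    _ = (1 / 2) ^ k := by rw [pow_succ]; ring

/-- The distance of two rationals `(a - b) / (c + 1)` and `(a' - b') / (c' + 1)` is computable from
the natural numbers involved. -/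
theorem isComputableDoubleSeq_rat (a b c : ℕ → ℕ) (ha : Primrec a) (hb : Primrec b)
    (hc : Primrec c) :
    IsComputableDoubleSeq fun m n =>
      |((a m : ℝ) - b m) / (c m + 1) - ((a n : ℝ) - b n) / (c n + 1)| := by
  have pm : ∀ {g : ℕ → ℕ}, Primrec g → Primrec (fun t : ℕ × ℕ × ℕ => g t.1) :=
    fun hg => hg.comp Primrec.fst
  have pn : ∀ {g : ℕ → ℕ}, Primrec g → Primrec (fun t : ℕ × ℕ × ℕ => g t.2.1) :=
    fun hg => hg.comp (Primrec.fst.comp Primrec.snd)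
  have hu : Primrec (fun t : ℕ × ℕ × ℕ => a t.1 * (c t.2.1 + 1) + b t.2.1 * (c t.1 + 1)) :=
    Primrec.nat_add.comp (Primrec.nat_mul.comp (pm ha) (Primrec.succ.comp (pn hc)))
      (Primrec.nat_mul.comp (pn hb) (Primrec.succ.comp (pm hc)))
  have hv : Primrec (fun t : ℕ × ℕ × ℕ => a t.2.1 * (c t.1 + 1) + b t.1 * (c t.2.1 + 1)) :=
    Primrec.nat_add.comp (Primrec.nat_mul.comp (pn ha) (Primrec.succ.comp (pm hc)))
      (Primrec.nat_mul.comp (pm hb) (Primrec.succ.comp (pn hc)))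
  refine IsComputableDoubleSeq.of_rat
    (fun t => (a t.1 * (c t.2.1 + 1) + b t.2.1 * (c t.1 + 1) -
        (a t.2.1 * (c t.1 + 1) + b t.1 * (c t.2.1 + 1))) +
      (a t.2.1 * (c t.1 + 1) + b t.1 * (c t.2.1 + 1) -
        (a t.1 * (c t.2.1 + 1) + b t.2.1 * (c t.1 + 1))))
    (fun t => (c t.1 + 1) * (c t.2.1 + 1))
    (Primrec.nat_add.comp (Primrec.nat_sub.comp hu hv) (Primrec.nat_sub.comp hv hu)).to_comp
    (Primrec.nat_mul.comp (Primrec.succ.comp (pm hc)) (Primrec.succ.comp (pn hc))).to_comp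
    (fun t => by positivity) (fun m n k => ?_)
  have key : ∀ u v : ℕ, (((u - v + (v - u) : ℕ)) : ℝ) = |(u : ℝ) - v| := by
    intro u v
    rcases le_total u v with h | h
    · rw [Nat.sub_eq_zero_of_le h, zero_add, Nat.cast_sub h, abs_sub_comm,
        abs_of_nonneg (sub_nonneg.2 (by exact_mod_cast h))]
    · rw [Nat.sub_eq_zero_of_le h, add_zero, Nat.cast_sub h,
        abs_of_nonneg (sub_nonneg.2 (by exact_mod_cast h))]
  simp only
  rw [key]
  push_cast
  have e : |((a m : ℝ) - b m) / (c m + 1) - ((a n : ℝ) - b n) / (c n + 1)| =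
      |(a m * (c n + 1) + b n * (c m + 1) - (a n * (c m + 1) + b m * (c n + 1)) : ℝ)| /
        ((c m + 1) * (c n + 1)) := by
    have hpos : (0 : ℝ) < (c m + 1) * (c n + 1) := by positivity
    conv_rhs => rw [← abs_of_pos hpos, ← abs_div]
    congr 1
    field_simp
    ring
  rw [e, sub_self, abs_zero]
  positivity

/-- The real line, with the rationals `(a - b) / (c + 1)` as dense sequence. -/
noncomputable def realSpace : ComputablePolishSpace ℝ where
  metric := inferInstance
  complete := inferInstance
  pt n := ((n.unpair.1 : ℝ) - n.unpair.2.unpair.1) / (n.unpair.2.unpair.2 + 1)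
  dense := by
    have : Set.range ((↑) : ℚ → ℝ) ⊆ Set.range (fun n : ℕ =>
        ((n.unpair.1 : ℝ) - n.unpair.2.unpair.1) / (n.unpair.2.unpair.2 + 1)) := by
      rintro _ ⟨q, rfl⟩
      refine ⟨Nat.pair q.num.toNat (Nat.pair (-q.num).toNat (q.den - 1)), ?_⟩
      simp only [Nat.unpair_pair]
      have h1 : ((q.num.toNat : ℝ) - (-q.num).toNat) = q.num := by
        have := Int.toNat_sub_toNat_neg q.num
        exact_mod_cast this
      have h2 : ((q.den - 1 : ℕ) : ℝ) + 1 = q.den := by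
        have : q.den - 1 + 1 = q.den := Nat.succ_pred_eq_of_pos q.den_pos
        exact_mod_cast this
      rw [h1, h2, Rat.cast_def]
    exact (Rat.denseRange_cast (𝕜 := ℝ)).mono this
  computable_dist := by
    have h2 := Primrec.unpair.comp (Primrec.snd.comp Primrec.unpair)
    exact isComputableDoubleSeq_rat (fun n => n.unpair.1) (fun n => n.unpair.2.unpair.1)
      (fun n => n.unpair.2.unpair.2) (Primrec.fst.comp Primrec.unpair) (Primrec.fst.comp h2)
      (Primrec.snd.comp h2)

/-- The unit interval with its usual metric, and the rationals `min (a / (c + 1)) 1` as dense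
sequence. -/
noncomputable def unitIntervalSpace : ComputablePolishSpace unitInterval where
  metric := inferInstance
  complete := inferInstance
  pt n := ⟨((min n.unpair.1 (n.unpair.2 + 1) : ℕ) : ℝ) / (n.unpair.2 + 1), by positivity, by
    rw [div_le_one (by positivity)]
    exact_mod_cast min_le_right _ _⟩
  dense := by
    rw [Metric.denseRange_iff]
    rintro ⟨x, hx0, hx1⟩ r hr
    obtain ⟨c, hc⟩ := exists_nat_one_div_lt hr
    have hc0 : (0 : ℝ) < c + 1 := by positivity
    have hle : ⌊x * (c + 1)⌋₊ ≤ c + 1 := by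
      refine Nat.floor_le_of_le ?_
      push_cast
      nlinarith
    refine ⟨Nat.pair ⌊x * (c + 1)⌋₊ c, lt_of_le_of_lt ?_ hc⟩
    rw [Subtype.dist_eq, Real.dist_eq]
    simp only [Nat.unpair_pair, min_eq_left hle]
    have e1 := Nat.floor_le (show 0 ≤ x * (c + 1) by positivity)
    have e2 := Nat.lt_floor_add_one (x * ((c : ℝ) + 1))
    have : x - (⌊x * ((c : ℝ) + 1)⌋₊ : ℝ) / (c + 1)
        = (x * (c + 1) - ⌊x * ((c : ℝ) + 1)⌋₊) / (c + 1) := by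
      field_simp
    rw [this, abs_div, abs_of_pos hc0, abs_of_nonneg (by linarith)]
    gcongr
    linarith
  computable_dist := by
    have h := isComputableDoubleSeq_rat (fun n => min n.unpair.1 (n.unpair.2 + 1)) (fun _ => 0)
      (fun n => n.unpair.2)
      (Primrec.nat_min.comp (Primrec.fst.comp Primrec.unpair)
        (Primrec.succ.comp (Primrec.snd.comp Primrec.unpair)))
      (Primrec.const 0) (Primrec.snd.comp Primrec.unpair)
    simpa only [Subtype.dist_eq, Real.dist_eq, Nat.cast_zero, sub_zero] using h

/-- The discrete metric on `2 = {0, 1}`, with distance `1` between the two points. -/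
@[reducible] noncomputable def boolMetric : MetricSpace Bool :=
  MetricSpace.induced (fun b : Bool => (b.toNat : ℝ))
    (fun a b h => by revert h; cases a <;> cases b <;> simp) inferInstance

/-- The two-point discrete space `2 = {0, 1}`. -/
noncomputable def boolSpace : ComputablePolishSpace Bool where
  metric := boolMetric
  complete := @complete_of_compact Bool boolMetric.toUniformSpace
    (@Finite.compactSpace Bool boolMetric.toUniformSpace.toTopologicalSpace inferInstance)
  pt n := n.bodd
  dense := by
    have h : Function.Surjective fun n : ℕ => n.bodd := by
      intro b
      cases b
      · exact ⟨0, rfl⟩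
      · exact ⟨1, rfl⟩
    intro b
    obtain ⟨n, hn⟩ := h b
    exact @subset_closure Bool boolMetric.toUniformSpace.toTopologicalSpace _ _ ⟨n, hn⟩
  computable_dist := by
    have h := isComputableDoubleSeq_rat (fun n => n.bodd.toNat) (fun _ => 0) (fun _ => 0)
      (((Primrec.dom_bool Bool.toNat).comp Primrec.nat_bodd)) (Primrec.const 0) (Primrec.const 0)
    have e : ∀ m n : ℕ, |(((m.bodd.toNat : ℕ) : ℝ) - ((0 : ℕ) : ℝ)) / (((0 : ℕ) : ℝ) + 1) -
        (((n.bodd.toNat : ℕ) : ℝ) - ((0 : ℕ) : ℝ)) / (((0 : ℕ) : ℝ) + 1)| =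
        dist ((m.bodd.toNat : ℕ) : ℝ) ((n.bodd.toNat : ℕ) : ℝ) := by
      intro m n
      rw [Real.dist_eq]
      simp
    simp only [e] at h
    exact h

namespace ComputablePolishSpace

variable {X Y : Type*}

/-- The product of two computable Polish spaces, with the maximum metric. -/
noncomputable def prod (S : ComputablePolishSpace X) (T : ComputablePolishSpace Y) :
    ComputablePolishSpace (X × Y) where
  metric := letI := S.metric; letI := T.metric; inferInstance
  complete := by
    let _ := S.metric; let _ := T.metric
    have _ := S.complete; have _ := T.complete
    exact (inferInstance : CompleteSpace (X × Y))
  pt n := (S.pt n.unpair.1, T.pt n.unpair.2)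
  dense := by
    let _ := S.metric; let _ := T.metric
    have h : DenseRange (fun z : ℕ × ℕ => (S.pt z.1, T.pt z.2)) := S.dense.prodMap T.dense
    refine h.mono ?_
    rintro _ ⟨⟨i, j⟩, rfl⟩
    exact ⟨Nat.pair i j, by simp⟩
  computable_dist := by
    obtain ⟨φ, hφ, hφd⟩ := S.computable_dist
    obtain ⟨ψ, hψ, hψd⟩ := T.computable_dist
    have hmax : Computable₂ (@max ℕ _) := Primrec.nat_max.to_comp
    have h1 := Primrec.unpair.comp (Primrec.fst (α := ℕ) (β := ℕ × ℕ))
    have h2 := Primrec.unpair.comp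
      (Primrec.fst.comp (Primrec.snd (α := ℕ) (β := ℕ × ℕ)))
    have h3 := Primrec.snd.comp (Primrec.snd (α := ℕ) (β := ℕ × ℕ))
    refine ⟨fun t => max (φ (t.1.unpair.1, t.2.1.unpair.1, t.2.2))
      (ψ (t.1.unpair.2, t.2.1.unpair.2, t.2.2)), hmax.comp
        (hφ.comp ((Primrec.fst.comp h1).pair ((Primrec.fst.comp h2).pair h3)).to_comp)
        (hψ.comp ((Primrec.snd.comp h1).pair ((Primrec.snd.comp h2).pair h3)).to_comp),
      fun m n k => ?_⟩
    let _ := S.metric; let _ := T.metric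
    have e : ∀ u v : ℕ, ((max u v : ℕ) : ℝ) / 2 ^ k = max ((u : ℝ) / 2 ^ k) ((v : ℝ) / 2 ^ k) := by
      intro u v
      rw [Nat.cast_max, max_div_div_right (by positivity)]
    simp only
    rw [e]
    exact (abs_max_sub_max_le_max _ _ _ _).trans (max_le (hφd _ _ _) (hψd _ _ _))

/-- The countable power `X^ω`, with the product metric `∑ i, min (2 ^ (-i)) (d (x i, y i))`, and the
eventually constant sequences `pt (l 0), …, pt (l (j - 1)), pt 0, pt 0, …` (for finite lists `l` of
natural numbers) as dense sequence. -/
noncomputable def omegaPower (S : ComputablePolishSpace X) : ComputablePolishSpace (ℕ → X) where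
  metric := letI := S.metric; PiCountable.metricSpace
  complete := by
    let _ := S.metric
    have _ := S.complete
    exact (inferInstance : CompleteSpace (ℕ → X))
  pt n := fun i => S.pt ((Denumerable.ofNat (List ℕ) n).getD i 0)
  dense := by
    let _ := S.metric
    change DenseRange (fun (n : ℕ) (i : ℕ) => S.pt ((Denumerable.ofNat (List ℕ) n).getD i 0))
    intro x
    rw [mem_closure_iff]
    intro o ho hxo
    obtain ⟨I, u, hu, hsub⟩ := isOpen_pi_iff.1 ho x hxo
    have hex : ∀ i, ∃ j, i ∈ I → S.pt j ∈ u i := by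
      intro i
      by_cases hi : i ∈ I
      · obtain ⟨j, hj⟩ := S.dense.exists_mem_open (hu i hi).1 ⟨x i, (hu i hi).2⟩
        exact ⟨j, fun _ => hj⟩
      · exact ⟨0, fun h => absurd h hi⟩
    choose g hg using hex
    refine ⟨_, hsub ?_, ⟨Encodable.encode ((List.range (I.sup id + 1)).map g), rfl⟩⟩
    intro i hi
    have hlt : i < I.sup id + 1 := Nat.lt_succ_of_le (Finset.le_sup (f := id) hi)
    have : ((List.range (I.sup id + 1)).map g).getD i 0 = g i := by
      simp [List.getD_eq_getElem?_getD, List.getElem?_map, List.getElem?_range hlt]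
    simp only [Denumerable.ofNat_encode]
    rw [this]
    exact hg i hi
  computable_dist := by
    obtain ⟨φ, hφ, hφd⟩ := S.computable_dist
    let _ := S.metric
    have hpow : Primrec₂ ((· ^ ·) : ℕ → ℕ → ℕ) := Primrec₂.unpaired'.1 Nat.Primrec.pow
    have hadd : Computable₂ ((· + ·) : ℕ → ℕ → ℕ) := Primrec.nat_add.to_comp
    have hmin : Computable₂ (@min ℕ _) := Primrec.nat_min.to_comp
    have hN : Primrec (fun t : ℕ × ℕ × ℕ => 2 * t.2.2 + 6) :=
      Primrec.nat_add.comp (Primrec.nat_mul.comp (Primrec.const 2)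
        (Primrec.snd.comp Primrec.snd)) (Primrec.const 6)
    let L : ℕ → ℕ → ℕ := fun n i => (Denumerable.ofNat (List ℕ) n).getD i 0
    have hL : Primrec₂ L :=
      (Primrec.list_getD 0).comp ((Primrec.ofNat (List ℕ)).comp Primrec.fst) Primrec.snd
    let term : ℕ × ℕ × ℕ → ℕ → ℕ := fun t i =>
      min (2 ^ (2 * t.2.2 + 6 - i)) (φ (L t.1 i, L t.2.1 i, 2 * t.2.2 + 6))
    let s : ℕ × ℕ × ℕ → ℕ := fun t => Nat.rec 0 (fun i acc => acc + term t i) (t.2.2 + 4)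
    have hterm : Computable₂ term := by
      have p1 : Primrec (fun z : (ℕ × ℕ × ℕ) × ℕ => 2 ^ (2 * z.1.2.2 + 6 - z.2)) :=
        hpow.comp (Primrec.const 2) (Primrec.nat_sub.comp (hN.comp Primrec.fst) Primrec.snd)
      have p2 : Primrec (fun z : (ℕ × ℕ × ℕ) × ℕ =>
          (L z.1.1 z.2, L z.1.2.1 z.2, 2 * z.1.2.2 + 6)) :=
        (hL.comp (Primrec.fst.comp Primrec.fst) Primrec.snd).pair
          ((hL.comp (Primrec.fst.comp (Primrec.snd.comp Primrec.fst)) Primrec.snd).pair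
            (hN.comp Primrec.fst))
      exact hmin.comp p1.to_comp (hφ.comp p2.to_comp)
    have hs : Computable s := by
      refine Computable.nat_rec (f := fun t : ℕ × ℕ × ℕ => t.2.2 + 4) (g := fun _ => 0)
        (h := fun t z => z.2 + term t z.1) ?_ (Computable.const 0) ?_
      · exact (Primrec.nat_add.comp (Primrec.snd.comp Primrec.snd) (Primrec.const 4)).to_comp
      · exact hadd.comp (Computable.snd.comp Computable.snd)
          (hterm.comp Computable.fst (Computable.fst.comp Computable.snd))
    have hs' : ∀ t, s t = ∑ i ∈ Finset.range (t.2.2 + 4), term t i := by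
      intro t
      have : ∀ K : ℕ, (Nat.rec (motive := fun _ => ℕ) 0 (fun i acc => acc + term t i) K : ℕ) =
          ∑ i ∈ Finset.range K, term t i := by
        intro K
        induction K with
        | zero => rfl
        | succ K ih => rw [Finset.sum_range_succ, ← ih]
      exact this (t.2.2 + 4)
    refine IsComputableDoubleSeq.of_rat s (fun t => 2 ^ (2 * t.2.2 + 6)) hs
      (hpow.comp (Primrec.const 2) hN).to_comp (fun t => by positivity) (fun m n k => ?_)
    set x : ℕ → X := fun i => S.pt (L m i) with hx
    set y : ℕ → X := fun i => S.pt (L n i) with hy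
    have hsum := PiCountable.dist_summable x y
    have hdist : (∑' i : ℕ, min ((2 : ℝ)⁻¹ ^ Encodable.encode i) (dist (x i) (y i))) =
        ∑ i ∈ Finset.range (k + 4), min ((2 : ℝ)⁻¹ ^ i) (dist (x i) (y i)) +
          ∑' i : ℕ, min ((2 : ℝ)⁻¹ ^ (i + (k + 4))) (dist (x (i + (k + 4))) (y (i + (k + 4)))) :=
      (hsum.sum_add_tsum_nat_add (k + 4)).symm
    have htail0 : 0 ≤ ∑' i : ℕ,
        min ((2 : ℝ)⁻¹ ^ (i + (k + 4))) (dist (x (i + (k + 4))) (y (i + (k + 4)))) :=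
      tsum_nonneg fun i => le_min (by positivity) dist_nonneg
    have htail : ∑' i : ℕ,
        min ((2 : ℝ)⁻¹ ^ (i + (k + 4))) (dist (x (i + (k + 4))) (y (i + (k + 4)))) ≤
          (1 / 2) ^ (k + 3) := by
      have hg : HasSum (fun i : ℕ => (2 : ℝ)⁻¹ ^ (i + (k + 4))) ((1 / 2) ^ (k + 3)) := by
        have := hasSum_geometric_two.mul_right (((1 : ℝ) / 2) ^ (k + 4))
        have e1 : (fun i : ℕ => (2 : ℝ)⁻¹ ^ (i + (k + 4))) =
            fun i : ℕ => ((1 : ℝ) / 2) ^ i * (1 / 2) ^ (k + 4) := by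
          funext i
          rw [pow_add, one_div]
        have e2 : ((1 : ℝ) / 2) ^ (k + 3) = 2 * (1 / 2) ^ (k + 4) := by
          rw [pow_succ _ (k + 3)]; ring
        rw [e1, e2]
        exact this
      rw [← hg.tsum_eq]
      refine Summable.tsum_le_tsum (fun i => min_le_left _ _) ?_ hg.summable
      exact Summable.of_nonneg_of_le (fun i => le_min (by positivity) dist_nonneg)
        (fun i => min_le_left _ _) hg.summable
    have hfin : |∑ i ∈ Finset.range (k + 4), min ((2 : ℝ)⁻¹ ^ i) (dist (x i) (y i)) -
        (s (m, n, k) : ℝ) / 2 ^ (2 * k + 6)| ≤ (1 / 2) ^ (k + 2) := by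
      rw [hs', Nat.cast_sum, Finset.sum_div, ← Finset.sum_sub_distrib]
      refine (Finset.abs_sum_le_sum_abs _ _).trans ?_
      have hb : ∀ i ∈ Finset.range (k + 4),
          |min ((2 : ℝ)⁻¹ ^ i) (dist (x i) (y i)) -
            (term (m, n, k) i : ℝ) / 2 ^ (2 * k + 6)| ≤ (1 / 2) ^ (2 * k + 6) := by
        intro i hi
        have hi' : i < k + 4 := Finset.mem_range.1 hi
        have e : (term (m, n, k) i : ℝ) / 2 ^ (2 * k + 6) =
            min ((2 : ℝ)⁻¹ ^ i) ((φ (L m i, L n i, 2 * k + 6) : ℝ) / 2 ^ (2 * k + 6)) := by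
          simp only [term]
          rw [Nat.cast_min, ← min_div_div_right (by positivity)]
          congr 1
          push_cast
          rw [div_eq_iff (by positivity), inv_pow, inv_mul_eq_div, eq_div_iff (by positivity),
            ← pow_add]
          congr 1
          omega
        rw [e]
        refine (abs_min_sub_min_le_max _ _ _ _).trans (max_le ?_ (hφd _ _ _))
        rw [sub_self, abs_zero]
        positivity
      refine (Finset.sum_le_card_nsmul _ _ _ hb).trans ?_
      rw [Finset.card_range, nsmul_eq_mul]
      have hlt : ((k + 4 : ℕ) : ℝ) ≤ 2 ^ (k + 4) := by
        exact_mod_cast (Nat.lt_two_pow_self (n := k + 4)).le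
      have e2 : ((1 : ℝ) / 2) ^ (k + 2) = 2 ^ (k + 4) * (1 / 2) ^ (2 * k + 6) := by
        have : 2 * k + 6 = (k + 4) + (k + 2) := by ring
        rw [this, pow_add (1 / 2 : ℝ) (k + 4), ← mul_assoc, ← mul_pow]
        norm_num
      rw [e2]
      gcongr
    change |(∑' i : ℕ, min ((2 : ℝ)⁻¹ ^ Encodable.encode i) (dist (x i) (y i))) - _| ≤ _
    rw [hdist]
    push_cast
    have e3 : ((1 : ℝ) / 2) ^ (k + 1) = (1 / 2) ^ (k + 2) + (1 / 2) ^ (k + 3) + (1 / 2) ^ (k + 3) := by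
      rw [pow_succ _ (k + 2), pow_succ _ (k + 1)]; ring
    have hpos : (0 : ℝ) < (1 / 2) ^ (k + 3) := by positivity
    rw [abs_le] at hfin ⊢
    constructor <;> linarith [hfin.1, hfin.2]

end ComputablePolishSpace

end Constructions

/-- The Hilbert cube `[0, 1]^ω`. -/
noncomputable def hilbertCube : ComputablePolishSpace (ℕ → unitInterval) :=
  unitIntervalSpace.omegaPower

/-- The space `ℝ × 2^ω`. -/
noncomputable def realTimesCantor : ComputablePolishSpace (ℝ × (ℕ → Bool)) :=
  realSpace.prod boolSpace.omegaPower

/-- `f` is piecewise monotone: `[0, 1]` is divided by points `0 = t 0 ≤ t 1 ≤ … ≤ t m = 1` into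
finitely many closed subintervals on each of which `f` is monotone. -/
def PiecewiseMonotone (f : unitInterval → unitInterval) : Prop :=
  ∃ (m : ℕ) (t : ℕ → unitInterval), Monotone t ∧ t 0 = 0 ∧ t m = 1 ∧
    ∀ i < m, MonotoneOn f (Set.Icc (t i) (t (i + 1))) ∨ AntitoneOn f (Set.Icc (t i) (t (i + 1)))

/-- `f` is finite-to-one. -/
def FiniteToOne (f : unitInterval → unitInterval) : Prop :=
  ∀ y, (f ⁻¹' {y}).Finite

/-- The set of local extrema (local maximum and minimum points) of `f` other than the end points
of `[0, 1]`. -/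
def localExtrema (f : unitInterval → unitInterval) : Set unitInterval :=
  {z | z ≠ 0 ∧ z ≠ 1 ∧ IsLocalExtr f z}

/-- The forward orbit `{x, f x, f (f x), …}`. -/
def forwardOrbit (f : unitInterval → unitInterval) (x : unitInterval) : Set unitInterval :=
  Set.range fun n : ℕ => f^[n] x

/-- `x` is effectively asymptotically periodic: the closure of its orbit is `Π⁰₁`, and is the union
of the orbit and a finite orbit. -/
def EffectivelyAsymptoticallyPeriodic (f : unitInterval → unitInterval) (x : unitInterval) : Prop :=
  unitIntervalSpace.IsPi01 (closure (forwardOrbit f x)) ∧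
    ∃ y, (forwardOrbit f y).Finite ∧
      closure (forwardOrbit f x) = forwardOrbit f x ∪ forwardOrbit f y

/-- The inverse limit of `[0, 1] ← [0, 1] ← ⋯` with the single bonding map `f`. -/
def inverseLimit (f : unitInterval → unitInterval) : Set (ℕ → unitInterval) :=
  {x | ∀ n, f (x (n + 1)) = x n}

/-! A `tt`-reduction has to answer on every oracle, so the work lies in making searches terminate on
inputs that are irrelevant for the given point. A sequence that names no point betrays itself at a
finite stage, because the space is complete and a failure of the Cauchy estimates is observable.
Hence it suffices to describe the approximations of the target by effectively open conditions that
are sound at the given point and satisfiable at every point of the source space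
(`Approximable.ttReducible`).

Piecewise monotonicity and finite-to-oneness leave only finitely many interior local extrema, and
each is a computable real. Let `A` be the union of the closures of their orbits. It is a countable
`Π⁰₁` set, and `f` maps it into itself. So along a point `x` of the inverse limit, once a coordinate
lies outside `A`, all later coordinates do too, and there are two cases.

If all coordinates of `x` lie in `A`, code `x` by bits telling on which side of the coordinate `x n`
a rational outside `A` lies (`IsRealPi01.exists_ttEquivalent`). The comparison is decided by
waiting, for either the coordinate is seen to leave `A` or it differs from that rational.
Conversely, the complement of a countable set is dense, so the bits locate each coordinate to any
precision, and on arbitrary bits the search still finds a change from "below" to "above".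

If `x n₀ ∉ A`, choose a closed rational interval around `x n₀` that misses `A`. For every point of
the inverse limit whose coordinate `n₀` is in this interval, the later coordinates avoid the local
extrema, so it is decidable between which neighbouring extrema they lie. The code is the real `x n₀`
together with these bits (`approximable_itinerary`). The coordinates up to `n₀` are recovered by
iterating `f`, the later ones by the strictly monotone inverse branches that the bits select
(`approximable_of_itinerary`). The branches are extended to all of `ℝ` by clamping, so that wrong
bits do not block the search. -/

open Set Filter Topology

/-! ### Closure properties of computable functions -/

section ComputableFunProp

attribute [fun_prop] Computable
attribute [fun_prop] Computable.id Computable.const Computable.comp Computable.pair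

variable {α β γ : Type*} [Primcodable α] [Primcodable β] [Primcodable γ]

namespace Computable

@[fun_prop]
theorem fst_comp {f : α → β × γ} (hf : Computable f) : Computable fun a => (f a).1 :=
  Computable.fst.comp hf

@[fun_prop]
theorem snd_comp {f : α → β × γ} (hf : Computable f) : Computable fun a => (f a).2 :=
  Computable.snd.comp hf

@[fun_prop]
theorem nat_add_comp {f g : α → ℕ} (hf : Computable f) (hg : Computable g) :
    Computable fun a => f a + g a :=
  Primrec.nat_add.to_comp.comp hf hg

@[fun_prop]
theorem nat_sub_comp {f g : α → ℕ} (hf : Computable f) (hg : Computable g) :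
    Computable fun a => f a - g a :=
  Primrec.nat_sub.to_comp.comp hf hg

@[fun_prop]
theorem nat_mul_comp {f g : α → ℕ} (hf : Computable f) (hg : Computable g) :
    Computable fun a => f a * g a :=
  Primrec.nat_mul.to_comp.comp hf hg

@[fun_prop]
theorem nat_pow_comp {f g : α → ℕ} (hf : Computable f) (hg : Computable g) :
    Computable fun a => f a ^ g a :=
  (Primrec₂.unpaired'.1 Nat.Primrec.pow).to_comp.comp hf hg

@[fun_prop]
theorem nat_min_comp {f g : α → ℕ} (hf : Computable f) (hg : Computable g) :
    Computable fun a => min (f a) (g a) :=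
  Primrec.nat_min.to_comp.comp hf hg

@[fun_prop]
theorem nat_bodd_comp {f : α → ℕ} (hf : Computable f) : Computable fun a => (f a).bodd :=
  Computable.nat_bodd.comp hf

@[fun_prop]
theorem nat_unpair_comp {f : α → ℕ} (hf : Computable f) : Computable fun a => (f a).unpair :=
  Computable.unpair.comp hf

@[fun_prop]
theorem nat_pair_comp {f g : α → ℕ} (hf : Computable f) (hg : Computable g) :
    Computable fun a => Nat.pair (f a) (g a) :=
  Primrec₂.natPair.to_comp.comp hf hg

@[fun_prop]
theorem list_take_comp {f : α → ℕ} {g : α → List β} (hf : Computable f) (hg : Computable g) :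
    Computable fun a => (g a).take (f a) :=
  Primrec.list_take.to_comp.comp hf hg

@[fun_prop]
theorem list_length_comp {f : α → List β} (hf : Computable f) :
    Computable fun a => (f a).length :=
  Computable.list_length.comp hf

@[fun_prop]
theorem list_getElem?_comp {f : α → ℕ} {g : α → List β} (hf : Computable f)
    (hg : Computable g) : Computable fun a => (g a)[f a]? :=
  Computable.list_getElem?.comp hg hf

@[fun_prop]
theorem list_ofNat_getD_comp {f g : α → ℕ} (hf : Computable f) (hg : Computable g) :
    Computable fun a => (Denumerable.ofNat (List ℕ) (f a)).getD (g a) 0 :=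
  (Primrec.list_getD 0).to_comp.comp ((Computable.ofNat (List ℕ)).comp hf) hg

@[fun_prop]
theorem and_comp {f g : α → Bool} (hf : Computable f) (hg : Computable g) :
    Computable fun a => f a && g a :=
  (Primrec.dom_bool₂ (· && ·)).to_comp.comp hf hg

@[fun_prop]
theorem or_comp {f g : α → Bool} (hf : Computable f) (hg : Computable g) :
    Computable fun a => f a || g a :=
  (Primrec.dom_bool₂ (· || ·)).to_comp.comp hf hg

@[fun_prop]
theorem decide_lt_comp {f g : α → ℕ} (hf : Computable f) (hg : Computable g) :
    Computable fun a => decide (f a < g a) :=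
  (primrecRel_iff_primrec_decide.1 Primrec.nat_lt).to_comp.comp hf hg

@[fun_prop]
theorem decide_eq_comp [DecidableEq β] {f g : α → β} (hf : Computable f) (hg : Computable g) :
    Computable fun a => decide (f a = g a) :=
  (primrecRel_iff_primrec_decide.1 Primrec.eq).to_comp.comp hf hg

theorem bounded_all {g : α → ℕ} {R : α → ℕ → Bool} (hg : Computable g)
    (hR : Computable fun t : α × ℕ => R t.1 t.2) :
    ∃ B : α → Bool, Computable B ∧ ∀ a, B a = true ↔ ∀ j < g a, R a j = true := by
  refine ⟨fun a => Nat.rec true (fun j acc => acc && R a j) (g a),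
    Computable.nat_rec (f := g) (g := fun _ => true) (h := fun a z => z.2 && R a z.1) hg
      (Computable.const true) ?_, fun a => ?_⟩
  · have : Computable fun t : α × ℕ × Bool => R t.1 t.2.1 :=
      hR.comp (f := fun t => R t.1 t.2) (g := fun t : α × ℕ × Bool => (t.1, t.2.1))
        (by fun_prop)
    exact Computable.and_comp (by fun_prop) this
  · change (Nat.rec true (fun j acc => acc && R a j) (g a) : Bool) = true ↔ _
    induction g a with
    | zero => simp
    | succ n ih =>
      simp only [Bool.and_eq_true, ih]
      constructor
      · rintro ⟨h1, h2⟩ j hj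
        rcases Nat.lt_succ_iff_lt_or_eq.1 hj with h | rfl
        · exact h1 j h
        · exact h2
      · exact fun h => ⟨fun j hj => h j (by omega), h n (by omega)⟩

end Computable

end ComputableFunProp

/-! ### Calculus of `Σ⁰₁` predicates -/

/-- `p` is a `Σ⁰₁` predicate, presented as the projection of a decidable one. -/
def IsSigma {α : Type*} [Primcodable α] (p : α → Prop) : Prop :=
  ∃ R : α → ℕ → Bool, (Computable fun t : α × ℕ => R t.1 t.2) ∧ ∀ a, p a ↔ ∃ n, R a n = true

namespace IsSigma

variable {α β : Type*} [Primcodable α] [Primcodable β] {p q : α → Prop}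

theorem of_eq (hp : IsSigma p) (h : ∀ a, p a ↔ q a) : IsSigma q := by
  obtain ⟨R, hR, hR'⟩ := hp
  exact ⟨R, hR, fun a => (h a).symm.trans (hR' a)⟩

theorem of_bool {f : α → Bool} (hf : Computable f) : IsSigma fun a => f a = true :=
  ⟨fun a _ => f a, by fun_prop, fun a => by simp⟩

theorem const (P : Prop) : IsSigma fun _ : α => P := by
  classical
  exact (of_bool (Computable.const (decide P))).of_eq fun _ => by simp

theorem comp {p : β → Prop} (hp : IsSigma p) {g : α → β} (hg : Computable g) :
    IsSigma fun a => p (g a) := by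
  obtain ⟨R, hR, hR'⟩ := hp
  exact ⟨fun a n => R (g a) n,
    hR.comp (f := fun t => R t.1 t.2) (g := fun t : α × ℕ => (g t.1, t.2)) (by fun_prop),
    fun a => hR' (g a)⟩

theorem ex {p : α → ℕ → Prop} (hp : IsSigma fun t : α × ℕ => p t.1 t.2) :
    IsSigma fun a => ∃ v, p a v := by
  obtain ⟨R, hR, hR'⟩ := hp
  refine ⟨fun a n => R (a, n.unpair.1) n.unpair.2,
    hR.comp (f := fun t => R t.1 t.2)
      (g := fun t : α × ℕ => ((t.1, t.2.unpair.1), t.2.unpair.2)) (by fun_prop), fun a => ?_⟩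
  constructor
  · rintro ⟨v, hv⟩
    obtain ⟨n, hn⟩ := (hR' (a, v)).1 hv
    exact ⟨Nat.pair v n, by simpa using hn⟩
  · rintro ⟨n, hn⟩
    exact ⟨n.unpair.1, (hR' (a, n.unpair.1)).2 ⟨_, hn⟩⟩

theorem and (hp : IsSigma p) (hq : IsSigma q) : IsSigma fun a => p a ∧ q a := by
  obtain ⟨R, hR, hR'⟩ := hp
  obtain ⟨Q, hQ, hQ'⟩ := hq
  have h1 : Computable fun t : α × ℕ => R t.1 t.2.unpair.1 :=
    hR.comp (f := fun t => R t.1 t.2) (g := fun t : α × ℕ => (t.1, t.2.unpair.1)) (by fun_prop)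
  have h2 : Computable fun t : α × ℕ => Q t.1 t.2.unpair.2 :=
    hQ.comp (f := fun t => Q t.1 t.2) (g := fun t : α × ℕ => (t.1, t.2.unpair.2)) (by fun_prop)
  refine ⟨fun a n => R a n.unpair.1 && Q a n.unpair.2, h1.and_comp h2, fun a => ?_⟩
  beta_reduce
  rw [hR', hQ']
  constructor
  · rintro ⟨⟨n, hn⟩, m, hm⟩
    exact ⟨Nat.pair n m, by simp [hn, hm]⟩
  · rintro ⟨n, hn⟩
    rw [Bool.and_eq_true] at hn
    exact ⟨⟨_, hn.1⟩, _, hn.2⟩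

theorem or (hp : IsSigma p) (hq : IsSigma q) : IsSigma fun a => p a ∨ q a := by
  obtain ⟨R, hR, hR'⟩ := hp
  obtain ⟨Q, hQ, hQ'⟩ := hq
  refine ⟨fun a n => R a n || Q a n, hR.or_comp hQ, fun a => ?_⟩
  beta_reduce
  rw [hR', hQ', ← exists_or]
  simp

/-- The witnesses for the finitely many `j` are collected in one coded list, which turns the bounded
quantifier over existential statements into a single search. Entries beyond the list default to `0`
and are never consulted. -/
theorem ball {p : α → ℕ → Prop} (hp : IsSigma fun t : α × ℕ => p t.1 t.2) {g : α → ℕ}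
    (hg : Computable g) : IsSigma fun a => ∀ j < g a, p a j := by
  obtain ⟨R, hR, hR'⟩ := hp
  have h1 : Computable fun t : (α × ℕ) × ℕ =>
      R (t.1.1, t.2) ((Denumerable.ofNat (List ℕ) t.1.2).getD t.2 0) :=
    hR.comp (f := fun t => R t.1 t.2) (g := fun t : (α × ℕ) × ℕ =>
      ((t.1.1, t.2), (Denumerable.ofNat (List ℕ) t.1.2).getD t.2 0)) (by fun_prop)
  obtain ⟨B, hB, hB'⟩ := Computable.bounded_all
    (R := fun (a : α × ℕ) j => R (a.1, j) ((Denumerable.ofNat (List ℕ) a.2).getD j 0))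
    (g := fun t : α × ℕ => g t.1) (by fun_prop) h1
  refine ⟨fun a n => B (a, n), hB, fun a => ?_⟩
  simp only [hB']
  constructor
  · intro h
    have : ∀ j, ∃ n, j < g a → R (a, j) n = true := by
      intro j
      by_cases hj : j < g a
      · obtain ⟨n, hn⟩ := (hR' (a, j)).1 (h j hj)
        exact ⟨n, fun _ => hn⟩
      · exact ⟨0, fun h => absurd h hj⟩
    choose w hw using this
    refine ⟨Encodable.encode ((List.range (g a)).map w), fun j hj => ?_⟩
    rw [Denumerable.ofNat_encode]
    have : ((List.range (g a)).map w).getD j 0 = w j := by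
      simp [List.getD_eq_getElem?_getD, List.getElem?_map, List.getElem?_range hj]
    rw [this]
    exact hw j hj
  · rintro ⟨n, hn⟩ j hj
    exact (hR' (a, j)).2 ⟨_, hn j hj⟩

theorem eq [DecidableEq β] {f g : α → β} (hf : Computable f) (hg : Computable g) :
    IsSigma fun a => f a = g a :=
  (of_bool (hf.decide_eq_comp hg)).of_eq fun a => by simp

theorem nat_lt {f g : α → ℕ} (hf : Computable f) (hg : Computable g) :
    IsSigma fun a => f a < g a :=
  (of_bool (hf.decide_lt_comp hg)).of_eq fun a => by simp

theorem ex₂ {p : α → ℕ → ℕ → Prop} (hp : IsSigma fun t : α × ℕ × ℕ => p t.1 t.2.1 t.2.2) :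
    IsSigma fun a => ∃ v w, p a v w :=
  ex (ex (p := fun (t : α × ℕ) w => p t.1 t.2 w)
    (hp.comp (g := fun t : (α × ℕ) × ℕ => (t.1.1, t.1.2, t.2)) (by fun_prop)))

end IsSigma

/-- The witness is a number of steps within which a program for the semidecision procedure halts. -/
theorem REPred.isSigma {α : Type*} [Primcodable α] {p : α → Prop} (hp : REPred p) :
    IsSigma p := by
  obtain ⟨c, hc⟩ := Nat.Partrec.Code.exists_code.1 hp
  have h1 : Computable fun t : α × ℕ =>
      (Nat.Partrec.Code.evaln t.2 c (Encodable.encode t.1)).isSome :=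
    Primrec.option_isSome.to_comp.comp (Nat.Partrec.Code.primrec_evaln.to_comp.comp
      ((Computable.snd.pair (Computable.const c)).pair (Computable.encode.comp Computable.fst)))
  refine ⟨fun a n => (Nat.Partrec.Code.evaln n c (Encodable.encode a)).isSome, h1, fun a => ?_⟩
  have e : p a ↔ (c.eval (Encodable.encode a)).Dom := by
    rw [hc]
    simp [Part.dom_iff_mem, Part.assert]
  rw [e, Part.dom_iff_mem]
  simp only [Nat.Partrec.Code.evaln_complete, Option.isSome_iff_exists, Option.mem_def]
  exact exists_comm

/-! ### Arithmetic on codes of rational numbers -/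

/-- The rational number with code `n`. -/
noncomputable abbrev ratCode (n : ℕ) : ℝ := realSpace.pt n

namespace ratCode

/-- Codes of sums. -/
def add (m n : ℕ) : ℕ :=
  Nat.pair (m.unpair.1 * (n.unpair.2.unpair.2 + 1) + n.unpair.1 * (m.unpair.2.unpair.2 + 1))
    (Nat.pair (m.unpair.2.unpair.1 * (n.unpair.2.unpair.2 + 1) +
        n.unpair.2.unpair.1 * (m.unpair.2.unpair.2 + 1))
      ((m.unpair.2.unpair.2 + 1) * (n.unpair.2.unpair.2 + 1) - 1))

/-- Codes of negatives. -/
def neg (m : ℕ) : ℕ :=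
  Nat.pair m.unpair.2.unpair.1 (Nat.pair m.unpair.1 m.unpair.2.unpair.2)

/-- Codes of `a * 2 ^ (-k)`. -/
def dyadic (a k : ℕ) : ℕ := Nat.pair a (Nat.pair 0 (2 ^ k - 1))

/-- Codes of points of the dense sequence of the unit interval as rational numbers. -/
def ofUnit (m : ℕ) : ℕ :=
  Nat.pair (min m.unpair.1 (m.unpair.2 + 1)) (Nat.pair 0 m.unpair.2)

/-- Projection of rational numbers to the dense sequence of the unit interval. -/
def toUnit (m : ℕ) : ℕ :=
  Nat.pair (m.unpair.1 - m.unpair.2.unpair.1) m.unpair.2.unpair.2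

variable {α : Type*} [Primcodable α] {f g : α → ℕ}

@[fun_prop]
theorem computable_add (hf : Computable f) (hg : Computable g) :
    Computable fun a => add (f a) (g a) := by
  unfold add; fun_prop

@[fun_prop]
theorem computable_neg (hf : Computable f) : Computable fun a => neg (f a) := by
  unfold neg; fun_prop

@[fun_prop]
theorem computable_dyadic (hf : Computable f) (hg : Computable g) :
    Computable fun a => dyadic (f a) (g a) := by
  unfold dyadic; fun_prop

@[fun_prop]
theorem computable_ofUnit (hf : Computable f) : Computable fun a => ofUnit (f a) := by
  unfold ofUnit; fun_prop

@[fun_prop]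
theorem computable_toUnit (hf : Computable f) : Computable fun a => toUnit (f a) := by
  unfold toUnit; fun_prop

theorem def_eq (n : ℕ) :
    ratCode n = ((n.unpair.1 : ℝ) - n.unpair.2.unpair.1) / (n.unpair.2.unpair.2 + 1) := rfl

@[simp]
theorem ratCode_add (m n : ℕ) : ratCode (add m n) = ratCode m + ratCode n := by
  have h : ((((m.unpair.2.unpair.2 + 1) * (n.unpair.2.unpair.2 + 1) - 1 : ℕ) : ℝ)) + 1 =
      (m.unpair.2.unpair.2 + 1) * (n.unpair.2.unpair.2 + 1) := by
    rw [Nat.cast_sub (Nat.succ_le_of_lt (by positivity))]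
    push_cast
    ring
  simp only [def_eq, add, Nat.unpair_pair]
  rw [h]
  push_cast
  field_simp
  ring

@[simp]
theorem ratCode_neg (m : ℕ) : ratCode (neg m) = -ratCode m := by
  simp only [def_eq, neg, Nat.unpair_pair]
  ring

@[simp]
theorem ratCode_dyadic (a k : ℕ) : ratCode (dyadic a k) = a * (1 / 2) ^ k := by
  have h : (((2 ^ k - 1 : ℕ) : ℝ)) + 1 = 2 ^ k := by
    rw [Nat.cast_sub (Nat.one_le_two_pow)]
    push_cast
    ring
  simp only [def_eq, dyadic, Nat.unpair_pair]
  rw [h]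
  simp [div_eq_mul_inv]

@[simp]
theorem ratCode_ofUnit (m : ℕ) : ratCode (ofUnit m) = (unitIntervalSpace.pt m : ℝ) := by
  simp only [def_eq, ofUnit, Nat.unpair_pair]
  simp [unitIntervalSpace]

/-- Truncated subtraction in the code clamps at `0`, and the minimum in the dense sequence of the
interval clamps at `1`. -/
theorem pt_toUnit (m : ℕ) :
    unitIntervalSpace.pt (toUnit m) = projIcc 0 1 zero_le_one (ratCode m) := by
  apply Subtype.ext
  rw [coe_projIcc]
  simp only [def_eq, toUnit, unitIntervalSpace, Nat.unpair_pair]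
  generalize m.unpair.1 = a
  generalize m.unpair.2.unpair.1 = b
  generalize m.unpair.2.unpair.2 = c
  have hc : (0 : ℝ) < c + 1 := by positivity
  rcases le_total a b with h | h
  · have : (a : ℝ) ≤ b := by exact_mod_cast h
    rw [Nat.sub_eq_zero_of_le h, max_eq_left]
    · simp
    · exact (min_le_right _ _).trans (div_nonpos_of_nonpos_of_nonneg (by linarith) hc.le)
  · have : (b : ℝ) ≤ a := by exact_mod_cast h
    rw [max_eq_right (le_min zero_le_one (div_nonneg (by linarith) hc.le))]
    rw [Nat.cast_min, Nat.cast_sub h, ← min_div_div_right hc.le, min_comm]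
    push_cast
    rw [div_self hc.ne']

/-- Clearing the positive denominators and moving the negative parts across gives a comparison of
natural numbers. -/
theorem isSigma_lt (hf : Computable f) (hg : Computable g) :
    IsSigma fun a => ratCode (f a) < ratCode (g a) := by
  have h : IsSigma fun a => (f a).unpair.1 * ((g a).unpair.2.unpair.2 + 1) +
      (g a).unpair.2.unpair.1 * ((f a).unpair.2.unpair.2 + 1) <
      (g a).unpair.1 * ((f a).unpair.2.unpair.2 + 1) +
      (f a).unpair.2.unpair.1 * ((g a).unpair.2.unpair.2 + 1) :=
    IsSigma.nat_lt (by fun_prop) (by fun_prop)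
  refine h.of_eq fun a => ?_
  rw [def_eq, def_eq, div_lt_div_iff₀ (by positivity) (by positivity), ← Nat.cast_lt (α := ℝ)]
  push_cast
  constructor <;> intro h <;> linarith

theorem exists_btwn {x y : ℝ} (h : x < y) : ∃ c, x < ratCode c ∧ ratCode c < y := by
  have hd : DenseRange ratCode := realSpace.dense
  obtain ⟨c, hc⟩ := hd.exists_mem_open isOpen_Ioo (nonempty_Ioo.2 h)
  exact ⟨c, hc⟩

end ratCode

/-! ### Oracle segments and bounded search -/

theorem initialSegment_take (p : ℕ → ℕ) (k l : ℕ) :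
    (initialSegment p k).take l = initialSegment p (min l k) := by
  simp [initialSegment, ← List.map_take, List.take_range]

theorem initialSegment_getElem? (p : ℕ → ℕ) (k n m : ℕ) :
    (initialSegment p k)[n]? = some m ↔ n < k ∧ p n = m := by
  by_cases h : n < k
  · simp [initialSegment, h]
  · simp [initialSegment, h]

theorem initialSegment_length (p : ℕ → ℕ) (k : ℕ) : (initialSegment p k).length = k := by
  simp [initialSegment]

/-- The first value `v s` with `t s`, if there is one below `n`. -/
def boundedSearch (t : ℕ → Bool) (v : ℕ → ℕ) (n : ℕ) : Option ℕ :=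
  Nat.rec none (fun s acc => acc <|> bif t s then some (v s) else none) n

theorem boundedSearch_eq {t : ℕ → Bool} (v : ℕ → ℕ) (h : ∃ s, t s = true) (n : ℕ) :
    boundedSearch t v n = if Nat.find h < n then some (v (Nat.find h)) else none := by
  induction n with
  | zero => simp [boundedSearch]
  | succ n ih =>
    have e : boundedSearch t v (n + 1) =
      (boundedSearch t v n <|> bif t n then some (v n) else none) := rfl
    rw [e, ih]
    rcases lt_trichotomy (Nat.find h) n with hn | hn | hn
    · rw [if_pos hn, if_pos (by omega)]
      rfl
    · rw [if_neg (by omega), if_pos (by omega)]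
      have := Nat.find_spec h
      rw [hn] at this ⊢
      simp [this]
    · rw [if_neg (by omega), if_neg (by omega)]
      simp [Nat.find_min h hn]

theorem boundedSearch_congr {t t' : ℕ → Bool} (v : ℕ → ℕ) {n : ℕ}
    (h : ∀ s < n, t s = t' s) : boundedSearch t v n = boundedSearch t' v n := by
  induction n with
  | zero => rfl
  | succ n ih =>
    change (boundedSearch t v n <|> bif t n then some (v n) else none) =
      (boundedSearch t' v n <|> bif t' n then some (v n) else none)
    rw [ih fun s hs => h s (by omega), h n (by omega)]

theorem Computable.boundedSearch_comp {α : Type*} [Primcodable α] {t : α → ℕ → Bool}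
    {v : ℕ → ℕ} {g : α → ℕ} (ht : Computable fun z : α × ℕ => t z.1 z.2) (hv : Computable v)
    (hg : Computable g) : Computable fun a => boundedSearch (t a) v (g a) := by
  refine Computable.nat_rec (f := g) (g := fun _ => none)
    (h := fun a z => z.2 <|> bif t a z.1 then some (v z.1) else none) hg (Computable.const none) ?_
  have h1 : Computable fun z : α × ℕ × Option ℕ => t z.1 z.2.1 :=
    ht.comp (f := fun z => t z.1 z.2) (g := fun z : α × ℕ × Option ℕ => (z.1, z.2.1)) (by fun_prop)
  have h2 : Computable fun z : α × ℕ × Option ℕ => some (v z.2.1) :=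
    Computable.option_some.comp (by fun_prop)
  exact Primrec.option_orElse.to_comp.comp (by fun_prop : Computable fun z : α × ℕ × Option ℕ => z.2.2)
    (Computable.cond h1 h2 (Computable.const none))

/-! ### Names, effectively open sets and a criterion for `tt`-reducibility -/

namespace ComputablePolishSpace

variable {X Y : Type*} {α β : Type*} [Primcodable α] [Primcodable β]

/-- The points `pt (p n)` converge to `x` with speed `2 ^ (-n)`. -/
def IsWeakName (S : ComputablePolishSpace X) (p : ℕ → ℕ) (x : X) : Prop :=
  letI := S.metric
  ∀ n, dist (S.pt (p n)) x ≤ (1 / 2 : ℝ) ^ n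

theorem IsName.isWeakName {S : ComputablePolishSpace X} {p : ℕ → ℕ} {x : X}
    (h : S.IsName p x) : S.IsWeakName p x := by
  let _ := S.metric
  intro n
  refine le_of_tendsto (tendsto_const_nhds.dist h.2) ?_
  filter_upwards [eventually_ge_atTop n] with m hm
  exact (h.1 n m hm).le

/-- Two errors of at most a quarter of `2 ^ (-n)` add up to less than `2 ^ (-n)`; the spare room
provides the strict inequality in the definition of a name. -/
theorem isName_of_dist_lt {S : ComputablePolishSpace X} {p : ℕ → ℕ} {x : X}
    (h : letI := S.metric; ∀ n, dist (S.pt (p n)) x ≤ (1 / 2 : ℝ) ^ (n + 2)) : S.IsName p x := by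
  let _ := S.metric
  have h0 : Tendsto (fun n : ℕ => (1 / 2 : ℝ) ^ (n + 2)) atTop (𝓝 0) :=
    (tendsto_pow_atTop_nhds_zero_of_lt_one (by norm_num) (by norm_num)).comp
      (tendsto_add_atTop_nat 2)
  refine ⟨fun n m hnm => ?_, tendsto_iff_dist_tendsto_zero.2
    (squeeze_zero (fun _ => dist_nonneg) h h0)⟩
  have h1 := dist_triangle_right (S.pt (p n)) (S.pt (p m)) x
  have h2 : (1 / 2 : ℝ) ^ (m + 2) ≤ (1 / 2) ^ (n + 2) :=
    pow_le_pow_of_le_one (by norm_num) (by norm_num) (by omega)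
  have h3 : (1 / 2 : ℝ) ^ (n + 2) = (1 / 2) ^ n * (1 / 4) := by rw [pow_add]; norm_num
  have h4 : (0 : ℝ) < (1 / 2) ^ n := by positivity
  linarith [h n, h m]

/-- A uniform sequence of effectively open subsets `P a` of `S`. -/
def SigmaOpen (S : ComputablePolishSpace X) (P : α → X → Prop) : Prop :=
  ∃ W : α × List ℕ → Prop, IsSigma W ∧
    ∀ a x p, S.IsWeakName p x → (P a x ↔ ∃ k, W (a, initialSegment p k))

namespace SigmaOpen

variable {S : ComputablePolishSpace X} {P Q : α → X → Prop}

theorem of_eq (hP : SigmaOpen S P) (h : ∀ a x, P a x ↔ Q a x) : SigmaOpen S Q := by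
  obtain ⟨W, hW, hW'⟩ := hP
  exact ⟨W, hW, fun a x p hp => (h a x).symm.trans (hW' a x p hp)⟩

theorem of_isSigma {q : α → Prop} (hq : IsSigma q) : SigmaOpen S fun a _ => q a :=
  ⟨fun t => q t.1, hq.comp (by fun_prop), fun a x p _ => by simp⟩

theorem comp {P : β → X → Prop} (hP : SigmaOpen S P) {g : α → β} (hg : Computable g) :
    SigmaOpen S fun a => P (g a) := by
  obtain ⟨W, hW, hW'⟩ := hP
  exact ⟨fun t => W (g t.1, t.2), hW.comp (g := fun t : α × List ℕ => (g t.1, t.2)) (by fun_prop),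
    fun a x p hp => hW' (g a) x p hp⟩

theorem or (hP : SigmaOpen S P) (hQ : SigmaOpen S Q) : SigmaOpen S fun a x => P a x ∨ Q a x := by
  obtain ⟨W, hW, hW'⟩ := hP
  obtain ⟨V, hV, hV'⟩ := hQ
  refine ⟨fun t => W t ∨ V t, hW.or hV, fun a x p hp => ?_⟩
  beta_reduce
  rw [hW' a x p hp, hV' a x p hp, exists_or]

theorem ex {P : α → ℕ → X → Prop} (hP : SigmaOpen S fun t : α × ℕ => P t.1 t.2) :
    SigmaOpen S fun a x => ∃ v, P a v x := by
  obtain ⟨W, hW, hW'⟩ := hP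
  refine ⟨fun t => ∃ v, W ((t.1, v), t.2),
    IsSigma.ex (p := fun (t : α × List ℕ) v => W ((t.1, v), t.2))
      (hW.comp (g := fun t : (α × List ℕ) × ℕ => ((t.1.1, t.2), t.1.2)) (by fun_prop)),
    fun a x p hp => ?_⟩
  rw [exists_comm]
  exact exists_congr fun v => hW' (a, v) x p hp

theorem ex₂ {P : α → ℕ → ℕ → X → Prop}
    (hP : SigmaOpen S fun t : α × ℕ × ℕ => P t.1 t.2.1 t.2.2) :
    SigmaOpen S fun a x => ∃ v w, P a v w x :=
  ex (ex (P := fun (t : α × ℕ) w => P t.1 t.2 w)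
    (hP.comp (g := fun t : (α × ℕ) × ℕ => (t.1.1, t.1.2, t.2)) (by fun_prop)))

/-- Finitely many witnessing initial segments are prefixes of one longer segment. Since `W` need not
be closed under extension, the test searches the prefixes `take k` of the segment at hand. -/
theorem ball {P : α → ℕ → X → Prop} (hP : SigmaOpen S fun t : α × ℕ => P t.1 t.2) {g : α → ℕ}
    (hg : Computable g) : SigmaOpen S fun a x => ∀ j < g a, P a j x := by
  obtain ⟨W, hW, hW'⟩ := hP
  refine ⟨fun t => ∀ j < g t.1, ∃ k, W ((t.1, j), t.2.take k),
    IsSigma.ball (p := fun (t : α × List ℕ) j => ∃ k, W ((t.1, j), t.2.take k))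
      (IsSigma.ex (p := fun (t : (α × List ℕ) × ℕ) k => W ((t.1.1, t.2), t.1.2.take k))
        (hW.comp (g := fun t : ((α × List ℕ) × ℕ) × ℕ => ((t.1.1.1, t.1.2), t.1.1.2.take t.2))
          (by fun_prop))) (by fun_prop), fun a x p hp => ?_⟩
  simp only [initialSegment_take]
  constructor
  · intro h
    have : ∀ j, ∃ k, j < g a → W ((a, j), initialSegment p k) := by
      intro j
      by_cases hj : j < g a
      · obtain ⟨k, hk⟩ := (hW' (a, j) x p hp).1 (h j hj)
        exact ⟨k, fun _ => hk⟩
      · exact ⟨0, fun h => absurd h hj⟩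
    choose k hk using this
    refine ⟨(Finset.range (g a)).sup k, fun j hj => ⟨k j, ?_⟩⟩
    rw [min_eq_left (Finset.le_sup (Finset.mem_range.2 hj))]
    exact hk j hj
  · rintro ⟨k, hk⟩ j hj
    obtain ⟨l, hl⟩ := hk j hj
    exact (hW' (a, j) x p hp).2 ⟨_, hl⟩

/-- The two conditions may be witnessed by segments of different length. Treating them as a family
over two indices lets `ball` provide the common extension. -/
theorem and (hP : SigmaOpen S P) (hQ : SigmaOpen S Q) :
    SigmaOpen S fun a x => P a x ∧ Q a x := by
  have h : SigmaOpen S fun (t : α × ℕ) x => (t.2 = 0 ∧ P t.1 x) ∨ (t.2 = 1 ∧ Q t.1 x) := by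
    obtain ⟨W, hW, hW'⟩ := hP
    obtain ⟨V, hV, hV'⟩ := hQ
    refine ⟨fun t => (t.1.2 = 0 ∧ W (t.1.1, t.2)) ∨ (t.1.2 = 1 ∧ V (t.1.1, t.2)),
      ((IsSigma.eq (by fun_prop) (by fun_prop)).and (hW.comp
          (g := fun t : (α × ℕ) × List ℕ => (t.1.1, t.2)) (by fun_prop))).or
        ((IsSigma.eq (by fun_prop) (by fun_prop)).and (hV.comp
          (g := fun t : (α × ℕ) × List ℕ => (t.1.1, t.2)) (by fun_prop))), fun a x p hp => ?_⟩
    beta_reduce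
    rw [hW' a.1 x p hp, hV' a.1 x p hp, exists_or]
    simp only [exists_and_left]
  refine (ball (P := fun a j x => (j = 0 ∧ P a x) ∨ (j = 1 ∧ Q a x)) h
    (g := fun _ => 2) (by fun_prop)).of_eq fun a x => ⟨fun h => ?_, ?_⟩
  · have h0 := h 0 (by norm_num)
    have h1 := h 1 (by norm_num)
    simp at h0 h1
    exact ⟨h0, h1⟩
  · rintro ⟨h0, h1⟩ j hj
    interval_cases j <;> simp [h0, h1]

/-- No uniformity in `i` is assumed: for a fixed bound the finitely many procedures are simply
combined. This is what allows the pieces of monotonicity, and the algorithms attached to them, to be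
merely chosen. -/
theorem ex_lt_const {P : ℕ → α → X → Prop} (hP : ∀ i, SigmaOpen S (P i)) (M : ℕ) :
    SigmaOpen S fun a x => ∃ i < M, P i a x := by
  induction M with
  | zero => exact (of_isSigma (IsSigma.const False)).of_eq (by simp)
  | succ M ih =>
    refine (ih.or (hP M)).of_eq fun a x => ?_
    simp only [Nat.lt_succ_iff_lt_or_eq]
    constructor
    · rintro (⟨i, hi, h⟩ | h)
      exacts [⟨i, .inl hi, h⟩, ⟨M, .inr rfl, h⟩]
    · rintro ⟨i, hi | rfl, h⟩
      exacts [.inl ⟨i, hi, h⟩, .inr h]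

/-- For finitely many indices a non-uniform family becomes uniform by hard-wiring one procedure for
each index. -/
theorem finite_cases {P : ℕ → α → X → Prop} (hP : ∀ i, SigmaOpen S (P i)) (M : ℕ) :
    SigmaOpen S fun (t : ℕ × α) x => t.1 < M ∧ P t.1 t.2 x := by
  have h := ex_lt_const (P := fun i (t : ℕ × α) x => t.1 = i ∧ P i t.2 x)
    (fun i => (of_isSigma (IsSigma.eq (by fun_prop) (by fun_prop))).and
      ((hP i).comp (by fun_prop))) M
  refine h.of_eq fun t x => ⟨?_, fun h => ⟨t.1, h.1, rfl, h.2⟩⟩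
  rintro ⟨i, hi, h, h'⟩
  rw [h]
  exact ⟨hi, h'⟩

end SigmaOpen

/-- Initial segments which do not belong to a weak name of any point are recognizable. -/
theorem exists_isSigma_not_isWeakName (S : ComputablePolishSpace X) :
    ∃ B : List ℕ → Prop, IsSigma B ∧ ∀ p : ℕ → ℕ,
      (∃ k, B (initialSegment p k)) ↔ ¬ ∃ x, S.IsWeakName p x := by
  obtain ⟨φ, hφ, hφd⟩ := S.computable_dist
  have _ := S.complete
  let _ := S.metric
  -- Two entries with indices `n` and `m` are incompatible if their points are further apart than `2
  -- ^ (-n) + 2 ^ (-m)`. The extra `2 ^ (-k)` absorbs the error of the approximation of the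
  -- distance.
  let far : ℕ × ℕ × ℕ × ℕ → Prop := fun t => ∃ k,
    ratCode (ratCode.add (ratCode.dyadic 1 t.2.2.1) (ratCode.add (ratCode.dyadic 1 t.2.2.2)
      (ratCode.dyadic 1 k))) < ratCode (ratCode.dyadic (φ (t.1, t.2.1, k)) k)
  have hfar : IsSigma far := IsSigma.ex (p := fun (t : ℕ × ℕ × ℕ × ℕ) k =>
    ratCode (ratCode.add (ratCode.dyadic 1 t.2.2.1) (ratCode.add (ratCode.dyadic 1 t.2.2.2)
      (ratCode.dyadic 1 k))) < ratCode (ratCode.dyadic (φ (t.1, t.2.1, k)) k))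
    (ratCode.isSigma_lt (by fun_prop) (by fun_prop))
  have hfar' : ∀ i j n m, far (i, j, n, m) ↔
      (1 / 2 : ℝ) ^ n + (1 / 2) ^ m < dist (S.pt i) (S.pt j) := by
    intro i j n m
    simp only [far, ratCode.ratCode_add, ratCode.ratCode_dyadic, Nat.cast_one, one_mul]
    have key : ∀ k, |dist (S.pt i) (S.pt j) - φ (i, j, k) * (1 / 2) ^ k| ≤ (1 / 2) ^ k := by
      intro k
      have := hφd i j k
      rwa [div_eq_mul_inv, ← inv_pow, ← one_div] at this
    constructor
    · rintro ⟨k, hk⟩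
      linarith [(abs_le.1 (key k)).1]
    · intro h
      obtain ⟨k, hk⟩ := exists_pow_lt_of_lt_one (show 0 < (dist (S.pt i) (S.pt j) -
        ((1 / 2 : ℝ) ^ n + (1 / 2) ^ m)) / 2 by linarith) (show (1 / 2 : ℝ) < 1 by norm_num)
      exact ⟨k, by linarith [(abs_le.1 (key k)).2]⟩
  refine ⟨fun σ => ∃ n m i j, (σ[n]? = some i ∧ σ[m]? = some j) ∧ far (i, j, n, m),
    IsSigma.ex₂ (p := fun (σ : List ℕ) n m => ∃ i j,
      (σ[n]? = some i ∧ σ[m]? = some j) ∧ far (i, j, n, m))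
      (IsSigma.ex₂ (p := fun (t : List ℕ × ℕ × ℕ) i j =>
        (t.1[t.2.1]? = some i ∧ t.1[t.2.2]? = some j) ∧ far (i, j, t.2.1, t.2.2)) ?_), fun p => ?_⟩
  · refine ((IsSigma.eq ?_ ?_).and (IsSigma.eq ?_ ?_)).and (hfar.comp (g :=
      fun t : (List ℕ × ℕ × ℕ) × ℕ × ℕ => (t.2.1, t.2.2, t.1.2.1, t.1.2.2)) (by fun_prop))
    · fun_prop
    · exact Computable.option_some.comp (by fun_prop)
    · fun_prop
    · exact Computable.option_some.comp (by fun_prop)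
  · simp only [initialSegment_getElem?, hfar']
    constructor
    · rintro ⟨k, n, m, i, j, ⟨⟨-, rfl⟩, -, rfl⟩, h⟩ ⟨x, hx⟩
      have h1 : dist (S.pt (p n)) (S.pt (p m)) ≤ dist (S.pt (p n)) x + dist (S.pt (p m)) x :=
        dist_triangle_right _ _ _
      have h2 : dist (S.pt (p n)) x ≤ (1 / 2 : ℝ) ^ n := hx n
      have h3 : dist (S.pt (p m)) x ≤ (1 / 2 : ℝ) ^ m := hx m
      linarith
    · intro h
      by_contra hcon
      apply h
      -- Without an incompatible pair the sequence is Cauchy, and by completeness its limit is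
      -- weakly named. This is where the weak inequality in `IsWeakName` matters, being preserved
      -- under limits.
      have hd : ∀ n m, dist (S.pt (p n)) (S.pt (p m)) ≤ (1 / 2 : ℝ) ^ n + (1 / 2) ^ m := by
        intro n m
        by_contra hlt
        exact hcon ⟨n + m + 1, n, m, _, _, ⟨⟨by omega, rfl⟩, by omega, rfl⟩, not_le.1 hlt⟩
      have h0 : Tendsto (fun n : ℕ => (1 / 2 : ℝ) ^ n) atTop (𝓝 0) :=
        tendsto_pow_atTop_nhds_zero_of_lt_one (by norm_num) (by norm_num)
      have hc : CauchySeq fun n => S.pt (p n) := by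
        refine cauchySeq_of_le_tendsto_0 (fun n => (1 / 2 : ℝ) ^ n + (1 / 2) ^ n)
          (fun n m N hn hm => (hd n m).trans (add_le_add ?_ ?_)) (by simpa using h0.add h0)
        · exact pow_le_pow_of_le_one (by norm_num) (by norm_num) hn
        · exact pow_le_pow_of_le_one (by norm_num) (by norm_num) hm
      obtain ⟨x, hx⟩ := cauchySeq_tendsto_of_complete hc
      refine ⟨x, fun n => ?_⟩
      have h1 : Tendsto (fun m : ℕ => (1 / 2 : ℝ) ^ n + (1 / 2) ^ m) atTop (𝓝 ((1 / 2) ^ n)) := by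
        simpa using h0.const_add ((1 / 2 : ℝ) ^ n)
      exact le_of_tendsto_of_tendsto' (tendsto_const_nhds.dist hx) h1 (hd n)

/-- The points `y a` can be approximated uniformly in `a`, given any name of `x`, by a search which
terminates on every input. -/
def Approximable (S : ComputablePolishSpace X) (T : ComputablePolishSpace Y) (x : X)
    (y : α → Y) : Prop :=
  letI := T.metric
  ∃ P : α × ℕ × ℕ → X → Prop, SigmaOpen S P ∧
    (∀ a j k, P (a, j, k) x → dist (T.pt j) (y a) ≤ (1 / 2 : ℝ) ^ k) ∧
    ∀ x' a k, ∃ j, P (a, j, k) x'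

/-- Search for an index satisfying the approximation condition, or for evidence that the oracle is
not a weak name of anything. One of the two always exists, so the functional is total; on names of
`x` the second outcome is impossible and the first is sound. -/
theorem Approximable.ttReducible {S : ComputablePolishSpace X} {T : ComputablePolishSpace Y}
    {x : X} {y : Y} (h : Approximable S T x fun _ : Unit => y) : TTReducible S T y x := by
  obtain ⟨P, ⟨W, hW, hWP⟩, hsound, htotal⟩ := h
  obtain ⟨B, hB, hB'⟩ := S.exists_isSigma_not_isWeakName
  obtain ⟨R, hR, hR'⟩ : IsSigma fun t : (ℕ × ℕ) × List ℕ => W (((), t.1), t.2) ∨ B t.2 :=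
    (hW.comp (g := fun t : (ℕ × ℕ) × List ℕ => (((), t.1), t.2)) (by fun_prop)).or
      (hB.comp (by fun_prop))
  -- `s` codes a candidate index, the length of the prefix to be read, and a stage of the
  -- enumeration. That length is at most `s`, so for `s` below the length of `σ` the outcome depends
  -- on the oracle only and not on the segment supplied; the first successful `s` is therefore the
  -- same for all long enough segments. The precision `n + 2` is what `isName_of_dist_lt` asks for.
  let test : ℕ → List ℕ → ℕ → Bool := fun n σ s =>
    R ((s.unpair.1, n + 2), σ.take s.unpair.2.unpair.1) s.unpair.2.unpair.2
  have htest : Computable fun t : (List ℕ × ℕ) × ℕ => test t.1.2 t.1.1 t.2 :=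
    hR.comp (f := fun t => R t.1 t.2) (g := fun t : (List ℕ × ℕ) × ℕ =>
      (((t.2.unpair.1, t.1.2 + 2), t.1.1.take t.2.unpair.2.unpair.1), t.2.unpair.2.unpair.2))
      (by fun_prop)
  let lim : (ℕ → ℕ) → ℕ → ℕ → Bool := fun p n s =>
    R ((s.unpair.1, n + 2), initialSegment p s.unpair.2.unpair.1) s.unpair.2.unpair.2
  have hlim : ∀ p n, ∃ s, lim p n s = true := by
    intro p n
    have key : ∃ j k, W (((), j, n + 2), initialSegment p k) ∨ B (initialSegment p k) := by
      by_cases hp : ∃ x, S.IsWeakName p x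
      · obtain ⟨x', hx'⟩ := hp
        obtain ⟨j, hj⟩ := htotal x' () (n + 2)
        obtain ⟨k, hk⟩ := (hWP _ x' p hx').1 hj
        exact ⟨j, k, .inl hk⟩
      · obtain ⟨k, hk⟩ := (hB' p).2 hp
        exact ⟨0, k, .inr hk⟩
    obtain ⟨j, k, hjk⟩ := key
    obtain ⟨m, hm⟩ := (hR' ((j, n + 2), initialSegment p k)).1 hjk
    exact ⟨Nat.pair j (Nat.pair k m), by simpa [lim] using hm⟩
  have hcongr : ∀ p n k, boundedSearch (test n (initialSegment p k)) (fun s => s.unpair.1) k =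
      boundedSearch (lim p n) (fun s => s.unpair.1) k := by
    intro p n k
    refine boundedSearch_congr _ fun s hs => ?_
    have : s.unpair.2.unpair.1 ≤ s :=
      (Nat.unpair_left_le _).trans (Nat.unpair_right_le _)
    simp only [test, lim, initialSegment_take]
    rw [min_eq_left (by omega)]
  refine ⟨fun p n => (Nat.find (hlim p n)).unpair.1,
    ⟨fun σ n => boundedSearch (test n σ) (fun s => s.unpair.1) σ.length, ?_, fun p n => ?_⟩,
    fun p hp => ?_⟩
  · exact Computable.boundedSearch_comp (α := List ℕ × ℕ) (t := fun a s => test a.2 a.1 s) htest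
      (by fun_prop) (g := fun a => a.1.length) (by fun_prop)
  · simp only [initialSegment_length, hcongr, boundedSearch_eq _ (hlim p n)]
    refine ⟨⟨Nat.find (hlim p n) + 1, by simp⟩, fun k m hm => ?_⟩
    split_ifs at hm
    exact (Option.some.inj hm).symm
  · refine isName_of_dist_lt fun n => ?_
    have hs : lim p n (Nat.find (hlim p n)) = true := Nat.find_spec (hlim p n)
    have hs' := (hR' _).2 ⟨_, hs⟩
    rcases hs' with h | h
    · exact hsound () _ _ ((hWP _ x p hp.isWeakName).2 ⟨_, h⟩)
    · exact absurd ⟨x, hp.isWeakName⟩ ((hB' p).1 ⟨_, h⟩)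

/-! ### Approximation in products and in the basic spaces -/

theorem Approximable.prod {Z : Type*} {S : ComputablePolishSpace X} {T : ComputablePolishSpace Y}
    {U : ComputablePolishSpace Z} {x : X} {y : α → Y} {z : α → Z} (hy : Approximable S T x y)
    (hz : Approximable S U x z) : Approximable S (T.prod U) x fun a => (y a, z a) := by
  let _ := T.metric
  let _ := U.metric
  obtain ⟨P, hP, hPs, hPt⟩ := hy
  obtain ⟨Q, hQ, hQs, hQt⟩ := hz
  refine ⟨fun t x => P (t.1, t.2.1.unpair.1, t.2.2) x ∧ Q (t.1, t.2.1.unpair.2, t.2.2) x,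
    (hP.comp (g := fun t : α × ℕ × ℕ => (t.1, t.2.1.unpair.1, t.2.2)) (by fun_prop)).and
      (hQ.comp (g := fun t : α × ℕ × ℕ => (t.1, t.2.1.unpair.2, t.2.2)) (by fun_prop)),
    fun a j k h => max_le (hPs _ _ _ h.1) (hQs _ _ _ h.2), fun x' a k => ?_⟩
  obtain ⟨i, hi⟩ := hPt x' a k
  obtain ⟨j, hj⟩ := hQt x' a k
  exact ⟨Nat.pair i j, by simpa using ⟨hi, hj⟩⟩

/-- The first `k + 2` terms contribute at most `(k + 2) * 2 ^ (-(2 * k + 4)) ≤ 2 ^ (-(k + 2))`, and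
the weights of the tail sum up to `2 * 2 ^ (-(k + 2))`; together this is three quarters of `2 ^
(-k)`. -/
theorem tsum_min_dist_le [MetricSpace X] {x y : ℕ → X} {k : ℕ}
    (h : ∀ i < k + 2, dist (x i) (y i) ≤ (1 / 2 : ℝ) ^ (2 * k + 4)) :
    ∑' i : ℕ, min ((2 : ℝ)⁻¹ ^ Encodable.encode i) (dist (x i) (y i)) ≤ (1 / 2 : ℝ) ^ k := by
  have hsum := PiCountable.dist_summable x y
  rw [← hsum.sum_add_tsum_nat_add (k + 2)]
  have h1 : ∑ i ∈ Finset.range (k + 2), min ((2 : ℝ)⁻¹ ^ Encodable.encode i) (dist (x i) (y i)) ≤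
      (1 / 2) ^ (k + 2) := by
    refine (Finset.sum_le_card_nsmul _ _ ((1 / 2 : ℝ) ^ (2 * k + 4)) fun i hi =>
      (min_le_right _ _).trans (h i (Finset.mem_range.1 hi))).trans ?_
    rw [Finset.card_range, nsmul_eq_mul]
    have hlt : ((k + 2 : ℕ) : ℝ) ≤ 2 ^ (k + 2) := by
      exact_mod_cast (Nat.lt_two_pow_self (n := k + 2)).le
    have e : ((1 : ℝ) / 2) ^ (k + 2) = 2 ^ (k + 2) * (1 / 2) ^ (2 * k + 4) := by
      have : 2 * k + 4 = (k + 2) + (k + 2) := by ring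
      rw [this, pow_add (1 / 2 : ℝ) (k + 2), ← mul_assoc, ← mul_pow]
      norm_num
    rw [e]
    gcongr
  have h2 : ∑' i : ℕ, min ((2 : ℝ)⁻¹ ^ Encodable.encode (i + (k + 2)))
      (dist (x (i + (k + 2))) (y (i + (k + 2)))) ≤ 2 * (1 / 2) ^ (k + 2) := by
    have hg : HasSum (fun i : ℕ => (2 : ℝ)⁻¹ ^ (i + (k + 2))) (2 * (1 / 2) ^ (k + 2)) := by
      have := hasSum_geometric_two.mul_right (((1 : ℝ) / 2) ^ (k + 2))
      have e : (fun i : ℕ => (2 : ℝ)⁻¹ ^ (i + (k + 2))) =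
          fun i : ℕ => ((1 : ℝ) / 2) ^ i * (1 / 2) ^ (k + 2) := by
        funext i
        rw [pow_add, one_div]
      rwa [e]
    simp only [Encodable.encode_nat]
    rw [← hg.tsum_eq]
    refine Summable.tsum_le_tsum (fun i => min_le_left _ _) ?_ hg.summable
    exact Summable.of_nonneg_of_le (fun i => le_min (by positivity) dist_nonneg)
      (fun i => min_le_left _ _) hg.summable
  have e : ((1 : ℝ) / 2) ^ (k + 2) = (1 / 2) ^ k * (1 / 4) := by rw [pow_add]; norm_num
  have hpos : (0 : ℝ) < (1 / 2) ^ k := by positivity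
  refine (add_le_add h1 h2).trans ?_
  rw [e]
  linarith

theorem dist_omegaPower_le (S : ComputablePolishSpace X) {x y : ℕ → X} {k : ℕ}
    (h : ∀ i < k + 2, @dist X S.metric.toDist (x i) (y i) ≤ (1 / 2 : ℝ) ^ (2 * k + 4)) :
    @dist (ℕ → X) S.omegaPower.metric.toDist x y ≤ (1 / 2 : ℝ) ^ k :=
  @tsum_min_dist_le X S.metric x y k h

theorem min_dist_le_dist_omegaPower (S : ComputablePolishSpace X) (x y : ℕ → X) (i : ℕ) :
    min ((1 / 2 : ℝ) ^ i) (@dist X S.metric.toDist (x i) (y i)) ≤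
      @dist (ℕ → X) S.omegaPower.metric.toDist x y := by
  let _ := S.metric
  rw [one_div]
  exact PiCountable.min_dist_le_dist_pi x y i

/-- For `i < n` the weight `2 ^ (-i)` exceeds `2 ^ (-n)`, so the minimum in the product metric must
be attained by the distance of the coordinates. -/
theorem dist_coord_le_of_dist_omegaPower_le (S : ComputablePolishSpace X) {x y : ℕ → X}
    {i n : ℕ} (hn : i < n) (h : @dist (ℕ → X) S.omegaPower.metric.toDist x y ≤ (1 / 2) ^ n) :
    @dist X S.metric.toDist (x i) (y i) ≤ (1 / 2) ^ n := by
  rcases min_le_iff.1 ((S.min_dist_le_dist_omegaPower x y i).trans h) with h2 | h2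
  · exact absurd h2 (not_le.2 (pow_lt_pow_right_of_lt_one₀ (by norm_num) (by norm_num) hn))
  · exact h2

/-- A point of the power is approximated by approximating its first `k + 2` coordinates to precision
`2 ^ (-(2 * k + 4))`, the amount required by `dist_omegaPower_le`. -/
theorem Approximable.omegaPower {S : ComputablePolishSpace X} {T : ComputablePolishSpace Y}
    {x : X} {y : ℕ → Y} (hy : Approximable S T x y) :
    Approximable S T.omegaPower x fun _ : Unit => y := by
  let _ := T.metric
  obtain ⟨P, hP, hPs, hPt⟩ := hy
  refine ⟨fun t x => ∀ i < t.2.2 + 2,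
    P (i, (Denumerable.ofNat (List ℕ) t.2.1).getD i 0, 2 * t.2.2 + 4) x,
    SigmaOpen.ball (P := fun (t : Unit × ℕ × ℕ) i =>
      P (i, (Denumerable.ofNat (List ℕ) t.2.1).getD i 0, 2 * t.2.2 + 4))
      (hP.comp (g := fun t : (Unit × ℕ × ℕ) × ℕ =>
        (t.2, (Denumerable.ofNat (List ℕ) t.1.2.1).getD t.2 0, 2 * t.1.2.2 + 4)) (by fun_prop))
      (by fun_prop), fun _ j k h => ?_, fun x' _ k => ?_⟩
  · exact T.dist_omegaPower_le fun i hi => hPs _ _ _ (h i hi)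
  · choose g hg using fun i => hPt x' i (2 * k + 4)
    refine ⟨Encodable.encode ((List.range (k + 2)).map g), fun i hi => ?_⟩
    rw [Denumerable.ofNat_encode]
    have : ((List.range (k + 2)).map g).getD i 0 = g i := by
      simp [List.getD_eq_getElem?_getD, List.getElem?_map, List.getElem?_range hi]
    rw [this]
    exact hg i

theorem Approximable.bool {S : ComputablePolishSpace X} {x : X} {s : α → Bool}
    (P : α × Bool → X → Prop) (hP : SigmaOpen S P) (hsound : ∀ a b, P (a, b) x → s a = b)
    (htotal : ∀ x' a, ∃ b, P (a, b) x') : Approximable S boolSpace x s := by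
  let _ := boolMetric
  refine ⟨fun t => P (t.1, t.2.1.bodd), hP.comp (by fun_prop), fun a j k h => ?_, fun x' a k => ?_⟩
  · rw [hsound a _ h]
    exact (dist_self j.bodd).trans_le (by positivity)
  · obtain ⟨b, hb⟩ := htotal x' a
    cases b
    · exact ⟨0, by simpa using hb⟩
    · exact ⟨1, by simpa using hb⟩

theorem Approximable.real {S : ComputablePolishSpace X} {x : X} {y : α → ℝ}
    (P : α × ℕ × ℕ → X → Prop) (hP : SigmaOpen S P)
    (hsound : ∀ a c k, P (a, c, k) x → |ratCode c - y a| ≤ (1 / 2) ^ k)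
    (htotal : ∀ x' a k, ∃ c, P (a, c, k) x') : Approximable S realSpace x y :=
  ⟨P, hP, hsound, htotal⟩

/-- Rational approximations may be projected to the interval: the projection does not increase
distances and fixes `y a`. -/
theorem Approximable.unitInterval {S : ComputablePolishSpace X} {x : X} {y : α → unitInterval}
    (P : α × ℕ × ℕ → X → Prop) (hP : SigmaOpen S P)
    (hsound : ∀ a c k, P (a, c, k) x → |ratCode c - y a| ≤ (1 / 2) ^ k)
    (htotal : ∀ x' a k, ∃ c, P (a, c, k) x') : Approximable S unitIntervalSpace x y := by
  refine ⟨fun t x => ∃ c, ratCode.toUnit c = t.2.1 ∧ P (t.1, c, t.2.2) x,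
    SigmaOpen.ex (P := fun (t : α × ℕ × ℕ) c x => ratCode.toUnit c = t.2.1 ∧ P (t.1, c, t.2.2) x)
      ((SigmaOpen.of_isSigma (IsSigma.eq (by fun_prop) (by fun_prop))).and
        (hP.comp (g := fun t : (α × ℕ × ℕ) × ℕ => (t.1.1, t.2, t.1.2.2)) (by fun_prop))), ?_, ?_⟩
  · rintro a j k ⟨c, rfl, hc⟩
    rw [ratCode.pt_toUnit]
    refine le_trans ?_ (hsound a c k hc)
    have := abs_projIcc_sub_projIcc (a := (0 : ℝ)) (b := 1) (c := ratCode c) (d := y a)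
      zero_le_one
    rwa [projIcc_val] at this
  · intro x' a k
    obtain ⟨c, hc⟩ := htotal x' a k
    exact ⟨_, c, rfl, hc⟩

/-! ### Computable real functions -/

/-- A uniformly computable sequence of real valued functions on `S`. -/
structure ComputableReal (S : ComputablePolishSpace X) (h : α → X → ℝ) : Prop where
  lt : SigmaOpen S fun (t : α × ℕ) x => h t.1 x < ratCode t.2
  gt : SigmaOpen S fun (t : α × ℕ) x => ratCode t.2 < h t.1 x

namespace ComputableReal

variable {S : ComputablePolishSpace X} {h : α → X → ℝ}

/-- A strict inequality for `h a x` is confirmed as soon as an approximation satisfies it with room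
for the error. The guard `g a < n` discards entries too coarse to carry information, such as entries
of a name in a countable power whose index does not exceed that of the coordinate sought. -/
theorem of_approx {u : α → ℕ → ℕ} {g : α → ℕ} (hu : Computable fun t : α × ℕ => u t.1 t.2)
    (hg : Computable g) (H : letI := S.metric; ∀ a x m n, g a < n →
      dist (S.pt m) x ≤ (1 / 2 : ℝ) ^ n → |ratCode (u a m) - h a x| ≤ (1 / 2) ^ n) :
    ComputableReal S h := by
  have hu1 : Computable fun t : ((α × ℕ) × List ℕ) × ℕ × ℕ => u t.1.1.1 t.2.2 :=
    hu.comp (f := fun t => u t.1 t.2)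
      (g := fun t : ((α × ℕ) × List ℕ) × ℕ × ℕ => (t.1.1.1, t.2.2)) (by fun_prop)
  have hb : IsSigma fun t : ((α × ℕ) × List ℕ) × ℕ × ℕ =>
      g t.1.1.1 < t.2.1 ∧ t.1.2[t.2.1]? = some t.2.2 :=
    (IsSigma.nat_lt (by fun_prop) (by fun_prop)).and
      (IsSigma.eq (by fun_prop) (Computable.option_some.comp (by fun_prop)))
  have conv : ∀ (a : α) (δ : ℝ), 0 < δ → ∃ n, g a < n ∧ 2 * (1 / 2 : ℝ) ^ n < δ := by
    intro a δ hδ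
    obtain ⟨n, hn⟩ := exists_pow_lt_of_lt_one (half_pos hδ) (show (1 / 2 : ℝ) < 1 by norm_num)
    refine ⟨n + g a + 1, by omega, ?_⟩
    have : (1 / 2 : ℝ) ^ (n + g a + 1) ≤ (1 / 2) ^ n :=
      pow_le_pow_of_le_one (by norm_num) (by norm_num) (by omega)
    linarith
  constructor
  · refine ⟨fun t => ∃ n m, (g t.1.1 < n ∧ t.2[n]? = some m) ∧
      ratCode (ratCode.add (u t.1.1 m) (ratCode.dyadic 1 n)) < ratCode t.1.2,
      IsSigma.ex₂ (p := fun (t : (α × ℕ) × List ℕ) n m => (g t.1.1 < n ∧ t.2[n]? = some m) ∧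
        ratCode (ratCode.add (u t.1.1 m) (ratCode.dyadic 1 n)) < ratCode t.1.2)
        (hb.and (ratCode.isSigma_lt (by fun_prop) (by fun_prop))), fun a x p hp => ?_⟩
    simp only [initialSegment_getElem?, ratCode.ratCode_add, ratCode.ratCode_dyadic, Nat.cast_one,
      one_mul]
    constructor
    · intro hlt
      obtain ⟨n, hn, hn'⟩ := conv a.1 (ratCode a.2 - h a.1 x) (by linarith)
      have := (abs_le.1 (H a.1 x (p n) n hn (hp n))).2
      exact ⟨n + 1, n, _, ⟨hn, by omega, rfl⟩, by linarith⟩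
    · rintro ⟨k, n, m, ⟨hn, -, rfl⟩, hlt⟩
      have := (abs_le.1 (H a.1 x (p n) n hn (hp n))).1
      linarith
  · refine ⟨fun t => ∃ n m, (g t.1.1 < n ∧ t.2[n]? = some m) ∧
      ratCode (ratCode.add t.1.2 (ratCode.dyadic 1 n)) < ratCode (u t.1.1 m),
      IsSigma.ex₂ (p := fun (t : (α × ℕ) × List ℕ) n m => (g t.1.1 < n ∧ t.2[n]? = some m) ∧
        ratCode (ratCode.add t.1.2 (ratCode.dyadic 1 n)) < ratCode (u t.1.1 m))
        (hb.and (ratCode.isSigma_lt (by fun_prop) (by fun_prop))), fun a x p hp => ?_⟩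
    simp only [initialSegment_getElem?, ratCode.ratCode_add, ratCode.ratCode_dyadic, Nat.cast_one,
      one_mul]
    constructor
    · intro hlt
      obtain ⟨n, hn, hn'⟩ := conv a.1 (h a.1 x - ratCode a.2) (by linarith)
      have := (abs_le.1 (H a.1 x (p n) n hn (hp n))).1
      exact ⟨n + 1, n, _, ⟨hn, by omega, rfl⟩, by linarith⟩
    · rintro ⟨k, n, m, ⟨hn, -, rfl⟩, hlt⟩
      have := (abs_le.1 (H a.1 x (p n) n hn (hp n))).2
      linarith

theorem comp (hh : ComputableReal S h) {g : β → α} (hg : Computable g) :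
    ComputableReal S fun b => h (g b) :=
  ⟨hh.lt.comp (g := fun t : β × ℕ => (g t.1, t.2)) (by fun_prop),
    hh.gt.comp (g := fun t : β × ℕ => (g t.1, t.2)) (by fun_prop)⟩

/-- Membership of `h a x` in the rational interval with endpoints coded by `t`. -/
theorem between (hh : ComputableReal S h) : SigmaOpen S fun (t : α × ℕ × ℕ) x =>
    ratCode t.2.1 < h t.1 x ∧ h t.1 x < ratCode t.2.2 :=
  (hh.gt.comp (g := fun t : α × ℕ × ℕ => (t.1, t.2.1)) (by fun_prop)).and
    (hh.lt.comp (g := fun t : α × ℕ × ℕ => (t.1, t.2.2)) (by fun_prop))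

theorem near (hh : ComputableReal S h) : SigmaOpen S fun (t : α × ℕ × ℕ) x =>
    |ratCode t.2.1 - h t.1 x| < (1 / 2) ^ t.2.2 := by
  refine (hh.between.comp (g := fun t : α × ℕ × ℕ =>
    (t.1, ratCode.add t.2.1 (ratCode.neg (ratCode.dyadic 1 t.2.2)),
      ratCode.add t.2.1 (ratCode.dyadic 1 t.2.2))) (by fun_prop)).of_eq fun t x => ?_
  simp only [ratCode.ratCode_add, ratCode.ratCode_neg, ratCode.ratCode_dyadic, Nat.cast_one,
    one_mul, abs_lt]
  constructor <;> rintro ⟨h1, h2⟩ <;> constructor <;> linarith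

end ComputableReal

end ComputablePolishSpace

open ComputablePolishSpace

theorem ratCode.exists_near (y : ℝ) (k : ℕ) : ∃ c, |ratCode c - y| < (1 / 2) ^ k := by
  obtain ⟨c, h1, h2⟩ := ratCode.exists_btwn (show y < y + (1 / 2) ^ k by
    linarith [show (0 : ℝ) < (1 / 2) ^ k by positivity])
  exact ⟨c, by rw [abs_lt]; constructor <;> linarith⟩

theorem hilbertCube_coord : ComputableReal hilbertCube fun (i : ℕ) x => (x i : ℝ) := by
  refine ComputableReal.of_approx
    (u := fun i m => ratCode.ofUnit ((Denumerable.ofNat (List ℕ) m).getD i 0)) (g := fun i => i)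
    (by fun_prop) (by fun_prop) fun i x m n hn h => ?_
  rw [ratCode.ratCode_ofUnit]
  exact unitIntervalSpace.dist_coord_le_of_dist_omegaPower_le hn h

theorem realTimesCantor_fst :
    ComputableReal realTimesCantor fun (_ : Unit) (y : ℝ × (ℕ → Bool)) => y.1 :=
  ComputableReal.of_approx (u := fun _ m => m.unpair.1) (g := fun _ => 0)
    (by fun_prop) (by fun_prop) fun _ _ _ _ _ h => (le_max_left _ _).trans h

theorem realTimesCantor_bit :
    SigmaOpen realTimesCantor fun (t : ℕ × Bool) (y : ℝ × (ℕ → Bool)) => y.2 t.1 = t.2 := by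
  have h : ComputableReal realTimesCantor fun (i : ℕ) (y : ℝ × (ℕ → Bool)) =>
      ((y.2 i).toNat : ℝ) := by
    refine ComputableReal.of_approx (u := fun i m => ratCode.dyadic
      (((Denumerable.ofNat (List ℕ) m.unpair.2).getD i 0).bodd.toNat) 0) (g := fun i => i)
      ?_ (by fun_prop) fun i y m n hn h => ?_
    · have : Computable fun t : ℕ × ℕ =>
          ((Denumerable.ofNat (List ℕ) t.2.unpair.2).getD t.1 0).bodd.toNat :=
        (Primrec.dom_bool Bool.toNat).to_comp.comp (by fun_prop)
      fun_prop
    · rw [ratCode.ratCode_dyadic]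
      rw [pow_zero, mul_one]
      exact boolSpace.dist_coord_le_of_dist_omegaPower_le hn ((le_max_right _ _).trans h)
  -- The code `dyadic 1 1` stands for `1 / 2`, which separates the two values of the bit.
  have key := (((SigmaOpen.of_isSigma (S := realTimesCantor)
    (IsSigma.eq (f := fun t : ℕ × Bool => t.2) (g := fun _ => true) (by fun_prop) (by fun_prop))).and
    (h.gt.comp (g := fun t : ℕ × Bool => (t.1, ratCode.dyadic 1 1)) (by fun_prop))).or
    ((SigmaOpen.of_isSigma (S := realTimesCantor)
    (IsSigma.eq (f := fun t : ℕ × Bool => t.2) (g := fun _ => false) (by fun_prop) (by fun_prop))).and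
    (h.lt.comp (g := fun t : ℕ × Bool => (t.1, ratCode.dyadic 1 1)) (by fun_prop))))
  refine key.of_eq fun t y => ?_
  simp only [ratCode.ratCode_dyadic]
  cases t.2 <;> cases y.2 t.1 <;> norm_num

@[fun_prop]
theorem Computable.list_ofNat_comp {α : Type*} [Primcodable α] {f : α → ℕ} (hf : Computable f) :
    Computable fun a => Denumerable.ofNat (List ℕ) (f a) :=
  (Computable.ofNat (List ℕ)).comp hf

/-! ### Effective continuity on the line -/

/-- `F : ℝ → ℝ` is effectively continuous: the inclusions `F (ρ a, ρ b) ⊆ (ρ c, ρ d)` between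
rational intervals are semidecided by some `V` which is large enough to witness continuity. -/
def EffectivelyContinuous (F : ℝ → ℝ) : Prop :=
  ∃ V : ℕ × ℕ × ℕ × ℕ → Prop, IsSigma V ∧
    (∀ a b c d h, V (a, b, c, d) → ratCode a < h → h < ratCode b →
      ratCode c < F h ∧ F h < ratCode d) ∧
    ∀ h c d, ratCode c < F h → F h < ratCode d →
      ∃ a b, V (a, b, c, d) ∧ ratCode a < h ∧ h < ratCode b

namespace EffectivelyContinuous

variable {F : ℝ → ℝ} {X α : Type*} [Primcodable α] {S : ComputablePolishSpace X} {h : α → X → ℝ}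

theorem neg (hF : EffectivelyContinuous F) : EffectivelyContinuous fun x => -F x := by
  obtain ⟨V, hV, hs, ht⟩ := hF
  refine ⟨fun t => V (t.1, t.2.1, ratCode.neg t.2.2.2, ratCode.neg t.2.2.1),
    hV.comp (g := fun t : ℕ × ℕ × ℕ × ℕ =>
      (t.1, t.2.1, ratCode.neg t.2.2.2, ratCode.neg t.2.2.1)) (by fun_prop), ?_, ?_⟩
  · intro a b c d h hv h1 h2
    have := hs _ _ _ _ h hv h1 h2
    simp only [ratCode.ratCode_neg] at this
    constructor <;> linarith
  · intro h c d h1 h2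
    beta_reduce at h1 h2
    exact ht h (ratCode.neg d) (ratCode.neg c) (by rw [ratCode.ratCode_neg]; linarith)
      (by rw [ratCode.ratCode_neg]; linarith)

theorem continuous (hF : EffectivelyContinuous F) : Continuous F := by
  obtain ⟨V, hV, hs, ht⟩ := hF
  refine continuous_iff_continuousAt.2 fun x => ?_
  refine (nhds_basis_Ioo (F x)).tendsto_right_iff.2 ?_
  rintro ⟨l, r⟩ ⟨hl, hr⟩
  obtain ⟨c, hc1, hc2⟩ := ratCode.exists_btwn hl
  obtain ⟨d, hd1, hd2⟩ := ratCode.exists_btwn hr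
  obtain ⟨a, b, hv, ha, hb⟩ := ht x c d hc2 hd1
  filter_upwards [Ioo_mem_nhds ha hb] with y hy
  have := hs a b c d y hv hy.1 hy.2
  exact ⟨hc1.trans this.1, this.2.trans hd2⟩

theorem comp (hF : EffectivelyContinuous F) (hh : ComputableReal S h) :
    ComputableReal S fun a x => F (h a x) := by
  obtain ⟨V, hV, hs, ht⟩ := hF
  have key : SigmaOpen S fun (t : α × ℕ × ℕ) x => ∃ a b, V (a, b, t.2.1, t.2.2) ∧
      ratCode a < h t.1 x ∧ h t.1 x < ratCode b :=
    SigmaOpen.ex₂ (P := fun (t : α × ℕ × ℕ) a b x => V (a, b, t.2.1, t.2.2) ∧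
      ratCode a < h t.1 x ∧ h t.1 x < ratCode b)
      ((SigmaOpen.of_isSigma (hV.comp (g := fun t : (α × ℕ × ℕ) × ℕ × ℕ =>
        (t.2.1, t.2.2, t.1.2.1, t.1.2.2)) (by fun_prop))).and
        (hh.between.comp (g := fun t : (α × ℕ × ℕ) × ℕ × ℕ => (t.1.1, t.2.1, t.2.2))
          (by fun_prop)))
  constructor
  · refine (SigmaOpen.ex (P := fun (t : α × ℕ) c x => ∃ a b, V (a, b, c, t.2) ∧
      ratCode a < h t.1 x ∧ h t.1 x < ratCode b) (key.comp
        (g := fun t : (α × ℕ) × ℕ => (t.1.1, t.2, t.1.2)) (by fun_prop))).of_eq fun t x => ?_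
    constructor
    · rintro ⟨c, a, b, hv, h1, h2⟩
      exact (hs _ _ _ _ _ hv h1 h2).2
    · intro hlt
      obtain ⟨c, -, hc⟩ := ratCode.exists_btwn (sub_one_lt (F (h t.1 x)))
      obtain ⟨a, b, hab⟩ := ht _ c _ hc hlt
      exact ⟨c, a, b, hab⟩
  · refine (SigmaOpen.ex (P := fun (t : α × ℕ) c x => ∃ a b, V (a, b, t.2, c) ∧
      ratCode a < h t.1 x ∧ h t.1 x < ratCode b) (key.comp
        (g := fun t : (α × ℕ) × ℕ => (t.1.1, t.1.2, t.2)) (by fun_prop))).of_eq fun t x => ?_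
    constructor
    · rintro ⟨c, a, b, hv, h1, h2⟩
      exact (hs _ _ _ _ _ hv h1 h2).1
    · intro hlt
      obtain ⟨c, hc, -⟩ := ratCode.exists_btwn (lt_add_one (F (h t.1 x)))
      obtain ⟨a, b, hab⟩ := ht _ _ c hlt hc
      exact ⟨c, a, b, hab⟩

theorem isSigma_lt (hF : EffectivelyContinuous F) :
    IsSigma fun t : ℕ × ℕ => F (ratCode t.1) < ratCode t.2 := by
  obtain ⟨V, hV, hs, ht⟩ := hF
  have key : IsSigma fun t : (ℕ × ℕ) × ℕ => ∃ a b, V (a, b, t.2, t.1.2) ∧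
      ratCode a < ratCode t.1.1 ∧ ratCode t.1.1 < ratCode b :=
    IsSigma.ex₂ (p := fun (t : (ℕ × ℕ) × ℕ) a b => V (a, b, t.2, t.1.2) ∧
      ratCode a < ratCode t.1.1 ∧ ratCode t.1.1 < ratCode b)
      ((hV.comp (g := fun t : ((ℕ × ℕ) × ℕ) × ℕ × ℕ =>
        (t.2.1, t.2.2, t.1.2, t.1.1.2)) (by fun_prop)).and
        ((ratCode.isSigma_lt (by fun_prop) (by fun_prop)).and
          (ratCode.isSigma_lt (by fun_prop) (by fun_prop))))
  refine (IsSigma.ex (p := fun (t : ℕ × ℕ) c => ∃ a b, V (a, b, c, t.2) ∧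
      ratCode a < ratCode t.1 ∧ ratCode t.1 < ratCode b) key).of_eq fun t => ?_
  constructor
  · rintro ⟨c, a, b, hv, h1, h2⟩
    exact (hs _ _ _ _ _ hv h1 h2).2
  · intro hlt
    obtain ⟨c, -, hc⟩ := ratCode.exists_btwn (sub_one_lt (F (ratCode t.1)))
    obtain ⟨a, b, hab⟩ := ht _ c _ hc hlt
    exact ⟨c, a, b, hab⟩

theorem isSigma_gt (hF : EffectivelyContinuous F) :
    IsSigma fun t : ℕ × ℕ => ratCode t.2 < F (ratCode t.1) := by
  refine (hF.neg.isSigma_lt.comp (g := fun t : ℕ × ℕ => (t.1, ratCode.neg t.2))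
    (by fun_prop)).of_eq fun t => ?_
  rw [ratCode.ratCode_neg, neg_lt_neg_iff]

theorem isSigma_lt_apply (hF : EffectivelyContinuous F) :
    IsSigma fun t : ℕ × ℕ => F (ratCode t.1) < F (ratCode t.2) := by
  refine (IsSigma.ex (p := fun (t : ℕ × ℕ) c => F (ratCode t.1) < ratCode c ∧
    ratCode c < F (ratCode t.2)) ((hF.isSigma_lt.comp (g := fun t : (ℕ × ℕ) × ℕ => (t.1.1, t.2))
      (by fun_prop)).and (hF.isSigma_gt.comp (g := fun t : (ℕ × ℕ) × ℕ => (t.1.2, t.2))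
      (by fun_prop)))).of_eq fun t => ?_
  exact ⟨fun ⟨c, h1, h2⟩ => h1.trans h2, fun h => ratCode.exists_btwn h⟩

end EffectivelyContinuous

/-- The extension of a self-map of the unit interval to the real line, constant on both sides. -/
noncomputable def realExtend (f : unitInterval → unitInterval) (h : ℝ) : ℝ :=
  f (projIcc 0 1 zero_le_one h)

theorem realExtend_coe (f : unitInterval → unitInterval) (x : unitInterval) :
    realExtend f x = f x := by
  rw [realExtend, projIcc_val]

/-- A finite list of sufficiently accurate approximations can be continued to a name, so whatever a
computation does on that list it does on some name of `u`. -/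
theorem exists_initialSegment_isName {l : ℕ} (σ : ℕ → ℕ) (u : unitInterval)
    (h : ∀ m < l, |(unitIntervalSpace.pt (σ m) : ℝ) - u| < (1 / 2) ^ (m + 2)) :
    ∃ p, unitIntervalSpace.IsName p u ∧ initialSegment p l = initialSegment σ l := by
  have hd : DenseRange unitIntervalSpace.pt := unitIntervalSpace.dense
  have hex : ∀ m, ∃ i, dist (unitIntervalSpace.pt i) u < (1 / 2 : ℝ) ^ (m + 2) := by
    intro m
    obtain ⟨i, hi⟩ := hd.exists_dist_lt u (show (0 : ℝ) < (1 / 2) ^ (m + 2) by positivity)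
    exact ⟨i, by rwa [dist_comm]⟩
  choose g hg using hex
  refine ⟨fun m => if m < l then σ m else g m, isName_of_dist_lt fun m => ?_, ?_⟩
  · by_cases hm : m < l
    · rw [if_pos hm]
      exact (h m hm).le
    · rw [if_neg hm]
      exact (hg m).le
  · refine List.map_congr_left fun m hm => ?_
    simp [List.mem_range.1 hm]

/-- A computation that produces an output entry has read only a finite part of the name, and this
part belongs to names of all points of a whole neighbourhood. Hence the entry bounds `f` on that
neighbourhood. -/
theorem ComputablePolishSpace.IsComputableMap.effectivelyContinuous
    {f : unitInterval → unitInterval}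
    (hf : unitIntervalSpace.IsComputableMap unitIntervalSpace f) :
    EffectivelyContinuous (realExtend f) := by
  obtain ⟨φ, hφ, hφf⟩ := hf
  let close : ℕ × ℕ × ℕ → Prop := fun t =>
    ratCode (ratCode.add (ratCode.ofUnit (ratCode.toUnit t.1))
      (ratCode.neg (ratCode.dyadic 1 (t.2.2 + 2)))) < ratCode (ratCode.ofUnit t.2.1) ∧
    ratCode (ratCode.ofUnit t.2.1) < ratCode (ratCode.add
      (ratCode.ofUnit (ratCode.toUnit t.1)) (ratCode.dyadic 1 (t.2.2 + 2)))
  have hclose : IsSigma close :=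
    (ratCode.isSigma_lt (by fun_prop) (by fun_prop)).and
      (ratCode.isSigma_lt (by fun_prop) (by fun_prop))
  have hclose' : ∀ q s m, close (q, s, m) ↔ |(unitIntervalSpace.pt s : ℝ) -
      (projIcc (0 : ℝ) 1 zero_le_one (ratCode q) : ℝ)| < (1 / 2) ^ (m + 2) := by
    intro q s m
    simp only [close, ratCode.ratCode_add, ratCode.ratCode_neg, ratCode.ratCode_dyadic,
      ratCode.ratCode_ofUnit, ratCode.pt_toUnit, Nat.cast_one, one_mul, abs_lt]
    constructor <;> rintro ⟨h1, h2⟩ <;> constructor <;> linarith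
  -- `e` codes an oracle segment on which the output entry `n` is `j`. Its entries are close to the
  -- projections of both end points and hence of everything between them, while the ball of radius
  -- `2 ^ (-n)` around the output point fits strictly between `ratCode c` and `ratCode d`.
  let V : ℕ × ℕ × ℕ × ℕ → Prop := fun t => ∃ e n j,
    φ (Denumerable.ofNat (List ℕ) e) n = some j ∧
    (ratCode t.2.2.1 < ratCode (ratCode.add (ratCode.ofUnit j) (ratCode.neg (ratCode.dyadic 1 n))) ∧
      ratCode (ratCode.add (ratCode.ofUnit j) (ratCode.dyadic 1 n)) < ratCode t.2.2.2) ∧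
    ∀ m < (Denumerable.ofNat (List ℕ) e).length,
      close (t.1, (Denumerable.ofNat (List ℕ) e).getD m 0, m) ∧
      close (t.2.1, (Denumerable.ofNat (List ℕ) e).getD m 0, m)
  have hV : IsSigma V := by
    refine IsSigma.ex (p := fun (t : ℕ × ℕ × ℕ × ℕ) e => ∃ n j,
      φ (Denumerable.ofNat (List ℕ) e) n = some j ∧
      (ratCode t.2.2.1 < ratCode (ratCode.add (ratCode.ofUnit j) (ratCode.neg (ratCode.dyadic 1 n))) ∧
        ratCode (ratCode.add (ratCode.ofUnit j) (ratCode.dyadic 1 n)) < ratCode t.2.2.2) ∧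
      ∀ m < (Denumerable.ofNat (List ℕ) e).length,
        close (t.1, (Denumerable.ofNat (List ℕ) e).getD m 0, m) ∧
        close (t.2.1, (Denumerable.ofNat (List ℕ) e).getD m 0, m)) ?_
    refine IsSigma.ex₂ (p := fun (t : (ℕ × ℕ × ℕ × ℕ) × ℕ) n j =>
      φ (Denumerable.ofNat (List ℕ) t.2) n = some j ∧
      (ratCode t.1.2.2.1 < ratCode (ratCode.add (ratCode.ofUnit j) (ratCode.neg (ratCode.dyadic 1 n))) ∧
        ratCode (ratCode.add (ratCode.ofUnit j) (ratCode.dyadic 1 n)) < ratCode t.1.2.2.2) ∧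
      ∀ m < (Denumerable.ofNat (List ℕ) t.2).length,
        close (t.1.1, (Denumerable.ofNat (List ℕ) t.2).getD m 0, m) ∧
        close (t.1.2.1, (Denumerable.ofNat (List ℕ) t.2).getD m 0, m)) ?_
    refine (IsSigma.eq (hφ.comp (by fun_prop) (by fun_prop))
      (Computable.option_some.comp (by fun_prop))).and
      (((ratCode.isSigma_lt (by fun_prop) (by fun_prop)).and
        (ratCode.isSigma_lt (by fun_prop) (by fun_prop))).and ?_)
    refine IsSigma.ball (p := fun (t : ((ℕ × ℕ × ℕ × ℕ) × ℕ) × ℕ × ℕ) m =>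
        close (t.1.1.1, (Denumerable.ofNat (List ℕ) t.1.2).getD m 0, m) ∧
        close (t.1.1.2.1, (Denumerable.ofNat (List ℕ) t.1.2).getD m 0, m))
      ((hclose.comp (g := fun t : (((ℕ × ℕ × ℕ × ℕ) × ℕ) × ℕ × ℕ) × ℕ =>
        (t.1.1.1.1, (Denumerable.ofNat (List ℕ) t.1.1.2).getD t.2 0, t.2)) (by fun_prop)).and
      (hclose.comp (g := fun t : (((ℕ × ℕ × ℕ × ℕ) × ℕ) × ℕ × ℕ) × ℕ =>
        (t.1.1.1.2.1, (Denumerable.ofNat (List ℕ) t.1.1.2).getD t.2 0, t.2)) (by fun_prop)))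
      (by fun_prop)
  refine ⟨V, hV, ?_, ?_⟩
  · rintro a b c d h ⟨e, n, j, hj, ⟨hc, hd⟩, hcl⟩ ha hb
    simp only [ratCode.ratCode_add, ratCode.ratCode_neg, ratCode.ratCode_dyadic,
      ratCode.ratCode_ofUnit, Nat.cast_one, one_mul] at hc hd
    generalize Denumerable.ofNat (List ℕ) e = σ at hj hcl
    have hσ : initialSegment (fun m => σ.getD m 0) σ.length = σ := by
      refine List.ext_getElem (by simp [initialSegment]) fun m h1 h2 => ?_
      simp [initialSegment, h2]
    obtain ⟨p, hp, hpσ⟩ := exists_initialSegment_isName (l := σ.length) (fun m => σ.getD m 0)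
      (projIcc 0 1 zero_le_one h) (by
        intro m hm
        obtain ⟨h1, h2⟩ := hcl m hm
        rw [hclose', abs_lt] at h1 h2
        have m1 : (projIcc (0 : ℝ) 1 zero_le_one (ratCode a) : ℝ) ≤ projIcc 0 1 zero_le_one h :=
          monotone_projIcc zero_le_one ha.le
        have m2 : (projIcc (0 : ℝ) 1 zero_le_one h : ℝ) ≤ projIcc 0 1 zero_le_one (ratCode b) :=
          monotone_projIcc zero_le_one hb.le
        rw [abs_lt]
        constructor <;> linarith [h1.1, h1.2, h2.1, h2.2])
    rw [hσ] at hpσ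
    obtain ⟨q, hq, hqn⟩ := hφf _ p hp
    have hjq : j = q n := (hq n).2 σ.length j (by rwa [hpσ])
    have hdist : |(unitIntervalSpace.pt (q n) : ℝ) - realExtend f h| ≤ (1 / 2) ^ n :=
      hqn.isWeakName n
    rw [← hjq, abs_le] at hdist
    constructor <;> linarith [hdist.1, hdist.2]
  · intro h c d hc hd
    set u := projIcc (0 : ℝ) 1 zero_le_one h with hu
    have hdr : DenseRange unitIntervalSpace.pt := unitIntervalSpace.dense
    have hex : ∀ m, ∃ i, |(unitIntervalSpace.pt i : ℝ) - u| < (1 / 2 : ℝ) ^ (m + 2) := by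
      intro m
      obtain ⟨i, hi⟩ := hdr.exists_dist_lt u (show (0 : ℝ) < (1 / 2) ^ (m + 2) by positivity)
      rw [dist_comm] at hi
      exact ⟨i, hi⟩
    choose p hp using hex
    have hpn : unitIntervalSpace.IsName p u := isName_of_dist_lt fun m => (hp m).le
    obtain ⟨q, hq, hqn⟩ := hφf _ p hpn
    obtain ⟨n, hn⟩ := exists_pow_lt_of_lt_one (show 0 < min (realExtend f h - ratCode c)
      (ratCode d - realExtend f h) / 2 by
        have := lt_min (sub_pos.2 hc) (sub_pos.2 hd)
        linarith) (show (1 / 2 : ℝ) < 1 by norm_num)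
    have hn1 := min_le_left (realExtend f h - ratCode c) (ratCode d - realExtend f h)
    have hn2 := min_le_right (realExtend f h - ratCode c) (ratCode d - realExtend f h)
    have hdist : |(unitIntervalSpace.pt (q n) : ℝ) - realExtend f h| ≤ (1 / 2) ^ n :=
      hqn.isWeakName n
    rw [abs_le] at hdist
    obtain ⟨k, hk⟩ := (hq n).1
    -- The name `p` was chosen with strict inequalities, so the part of it that is read remains
    -- accurate for all points near `h`.
    have hopen : ∀ᶠ y in 𝓝 h, ∀ m ∈ Finset.range k, |(unitIntervalSpace.pt (p m) : ℝ) -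
        (projIcc (0 : ℝ) 1 zero_le_one y : ℝ)| < (1 / 2) ^ (m + 2) := by
      rw [eventually_all_finset]
      intro m _
      have hcont : Continuous fun y : ℝ => |(unitIntervalSpace.pt (p m) : ℝ) -
          (projIcc (0 : ℝ) 1 zero_le_one y : ℝ)| :=
        (continuous_const.sub (continuous_subtype_val.comp continuous_projIcc)).abs
      exact hcont.continuousAt.eventually_lt continuousAt_const (hp m)
    obtain ⟨l, r, ⟨hl, hr⟩, hlr⟩ := mem_nhds_iff_exists_Ioo_subset.1 hopen
    obtain ⟨a, ha1, ha2⟩ := ratCode.exists_btwn hl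
    obtain ⟨b, hb1, hb2⟩ := ratCode.exists_btwn hr
    refine ⟨a, b, ⟨Encodable.encode (initialSegment p k), n, q n, ?_, ?_, ?_⟩, ha2, hb1⟩
    · rwa [Denumerable.ofNat_encode]
    · simp only [ratCode.ratCode_add, ratCode.ratCode_neg, ratCode.ratCode_dyadic,
        ratCode.ratCode_ofUnit, Nat.cast_one, one_mul]
      constructor <;> linarith [hdist.1, hdist.2]
    · rw [Denumerable.ofNat_encode, initialSegment_length]
      intro m hm
      have e : (initialSegment p k).getD m 0 = p m := by
        simp [initialSegment, hm]
      rw [e, hclose', hclose']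
      exact ⟨hlr ⟨ha1, ha2.trans hr⟩ m (Finset.mem_range.2 hm),
        hlr ⟨hl.trans hb1, hb2⟩ m (Finset.mem_range.2 hm)⟩

/-! ### `Π⁰₁` sets of reals -/

/-- The complement of `A ⊆ ℝ` is the union of a `Σ⁰₁` family of rational open intervals. -/
def IsRealPi01 (A : Set ℝ) : Prop :=
  ∃ O : ℕ × ℕ → Prop, IsSigma O ∧
    ∀ h, h ∉ A ↔ ∃ c d, O (c, d) ∧ ratCode c < h ∧ h < ratCode d

namespace IsRealPi01

variable {A B : Set ℝ}

theorem empty : IsRealPi01 ∅ := by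
  refine ⟨fun _ => True, IsSigma.const True, fun h => ?_⟩
  obtain ⟨c, -, hc⟩ := ratCode.exists_btwn (sub_one_lt h)
  obtain ⟨d, hd, -⟩ := ratCode.exists_btwn (lt_add_one h)
  simpa using ⟨⟨c, hc⟩, d, hd⟩

theorem sigmaOpen_notMem {X α : Type*} [Primcodable α] {S : ComputablePolishSpace X}
    {h : α → X → ℝ} (hA : IsRealPi01 A) (hh : ComputableReal S h) :
    SigmaOpen S fun a x => h a x ∉ A := by
  obtain ⟨O, hO, hO'⟩ := hA
  refine (SigmaOpen.ex₂ (P := fun a c d x => O (c, d) ∧ ratCode c < h a x ∧ h a x < ratCode d)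
    ((SigmaOpen.of_isSigma (hO.comp (g := fun t : α × ℕ × ℕ => (t.2.1, t.2.2))
      (by fun_prop))).and hh.between)).of_eq fun a x => (hO' _).symm

theorem isSigma_notMem (hA : IsRealPi01 A) : IsSigma fun q => ratCode q ∉ A := by
  obtain ⟨O, hO, hO'⟩ := hA
  exact (IsSigma.ex₂ (p := fun q c d => O (c, d) ∧ ratCode c < ratCode q ∧ ratCode q < ratCode d)
    ((hO.comp (g := fun t : ℕ × ℕ × ℕ => (t.2.1, t.2.2)) (by fun_prop)).and
      ((ratCode.isSigma_lt (by fun_prop) (by fun_prop)).and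
        (ratCode.isSigma_lt (by fun_prop) (by fun_prop))))).of_eq fun a => (hO' _).symm

theorem isClosed (hA : IsRealPi01 A) : IsClosed A := by
  obtain ⟨O, hO, hO'⟩ := hA
  rw [← isOpen_compl_iff, isOpen_iff_mem_nhds]
  intro h hh
  obtain ⟨c, d, hcd, h1, h2⟩ := (hO' h).1 hh
  filter_upwards [Ioo_mem_nhds h1 h2] with y hy
  exact (hO' y).2 ⟨c, d, hcd, hy.1, hy.2⟩

/-- The complement is covered by the rational intervals whose end points lie strictly inside an
enumerated interval for `A` and strictly inside one for `B`. -/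
theorem union (hA : IsRealPi01 A) (hB : IsRealPi01 B) : IsRealPi01 (A ∪ B) := by
  obtain ⟨O, hO, hO'⟩ := hA
  obtain ⟨Q, hQ, hQ'⟩ := hB
  refine ⟨fun t => (∃ c d, O (c, d) ∧ ratCode c < ratCode t.1 ∧ ratCode t.2 < ratCode d) ∧
      ∃ c d, Q (c, d) ∧ ratCode c < ratCode t.1 ∧ ratCode t.2 < ratCode d,
    (IsSigma.ex₂ (p := fun (t : ℕ × ℕ) c d => O (c, d) ∧ ratCode c < ratCode t.1 ∧
      ratCode t.2 < ratCode d) ?_).and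
    (IsSigma.ex₂ (p := fun (t : ℕ × ℕ) c d => Q (c, d) ∧ ratCode c < ratCode t.1 ∧
      ratCode t.2 < ratCode d) ?_), fun h => ?_⟩
  · exact (hO.comp (g := fun t : (ℕ × ℕ) × ℕ × ℕ => (t.2.1, t.2.2)) (by fun_prop)).and
      ((ratCode.isSigma_lt (by fun_prop) (by fun_prop)).and
        (ratCode.isSigma_lt (by fun_prop) (by fun_prop)))
  · exact (hQ.comp (g := fun t : (ℕ × ℕ) × ℕ × ℕ => (t.2.1, t.2.2)) (by fun_prop)).and
      ((ratCode.isSigma_lt (by fun_prop) (by fun_prop)).and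
        (ratCode.isSigma_lt (by fun_prop) (by fun_prop)))
  · rw [mem_union, not_or, hO', hQ']
    constructor
    · rintro ⟨⟨c, d, hcd, h1, h2⟩, c', d', hcd', h1', h2'⟩
      obtain ⟨a, ha, ha'⟩ := ratCode.exists_btwn (max_lt h1 h1')
      obtain ⟨b, hb, hb'⟩ := ratCode.exists_btwn (lt_min h2 h2')
      exact ⟨a, b, ⟨⟨c, d, hcd, (le_max_left _ _).trans_lt ha, hb'.trans_le (min_le_left _ _)⟩,
        c', d', hcd', (le_max_right _ _).trans_lt ha, hb'.trans_le (min_le_right _ _)⟩, ha', hb⟩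
    · rintro ⟨a, b, ⟨⟨c, d, hcd, h1, h2⟩, c', d', hcd', h1', h2'⟩, ha, hb⟩
      exact ⟨⟨c, d, hcd, h1.trans ha, hb.trans h2⟩, c', d', hcd', h1'.trans ha, hb.trans h2'⟩

theorem biUnion {ι : Type*} {s : Set ι} (hs : s.Finite) {A : ι → Set ℝ}
    (h : ∀ i ∈ s, IsRealPi01 (A i)) : IsRealPi01 (⋃ i ∈ s, A i) := by
  induction s, hs using Set.Finite.induction_on with
  | empty => simpa using empty
  | insert _ _ ih =>
    rw [biUnion_insert]
    exact (h _ (mem_insert _ _)).union (ih fun i hi => h i (mem_insert_of_mem _ hi))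

end IsRealPi01

theorem ratCode.ratCode_zero : ratCode 0 = 0 := by simp [ratCode.def_eq]

/-- The enumerated balls become intervals of the line, and all rational intervals to the left of `0`
or to the right of `1` are added. -/
theorem ComputablePolishSpace.IsPi01.isRealPi01 {C : Set unitInterval}
    (hC : unitIntervalSpace.IsPi01 C) : IsRealPi01 ((↑) '' C : Set ℝ) := by
  obtain ⟨W, hW, hWC⟩ := hC
  let rad : ℕ → ℕ → ℕ := fun a b => Nat.pair a (Nat.pair 0 b)
  have hrad : ∀ a b, ratCode (rad a b) = (a : ℝ) / ((b : ℝ) + 1) := fun a b => by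
    simp [rad, ratCode.def_eq]
  refine ⟨fun t => (∃ n a b, W (n, a, b) ∧
      t.1 = ratCode.add (ratCode.ofUnit n) (ratCode.neg (rad a b)) ∧
      t.2 = ratCode.add (ratCode.ofUnit n) (rad a b)) ∨
      (ratCode t.2 < ratCode 0 ∨ ratCode (ratCode.dyadic 1 0) < ratCode t.1), ?_, fun h => ?_⟩
  · refine (IsSigma.ex (p := fun (t : ℕ × ℕ) n => ∃ a b, W (n, a, b) ∧
      t.1 = ratCode.add (ratCode.ofUnit n) (ratCode.neg (rad a b)) ∧
      t.2 = ratCode.add (ratCode.ofUnit n) (rad a b)) (IsSigma.ex₂ (p :=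
        fun (t : (ℕ × ℕ) × ℕ) a b => W (t.2, a, b) ∧
      t.1.1 = ratCode.add (ratCode.ofUnit t.2) (ratCode.neg (rad a b)) ∧
      t.1.2 = ratCode.add (ratCode.ofUnit t.2) (rad a b)) ?_)).or
      ((ratCode.isSigma_lt (by fun_prop) (by fun_prop)).or
        (ratCode.isSigma_lt (by fun_prop) (by fun_prop)))
    refine (hW.isSigma.comp (g := fun t : ((ℕ × ℕ) × ℕ) × ℕ × ℕ => (t.1.2, t.2.1, t.2.2))
      (by fun_prop)).and ((IsSigma.eq (by fun_prop) ?_).and (IsSigma.eq (by fun_prop) ?_)) <;>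
    · simp only [rad]
      fun_prop
  · simp only [ratCode.ratCode_zero, ratCode.ratCode_dyadic, Nat.cast_one, pow_zero, mul_one]
    have mem : ∀ u : unitInterval, u ∉ C ↔ ∃ n a b, W (n, a, b) ∧
        |(u : ℝ) - unitIntervalSpace.pt n| < (a : ℝ) / ((b : ℝ) + 1) := by
      intro u
      rw [← mem_compl_iff, hWC]
      simp only [mem_iUnion, exists_prop]
      rfl
    constructor
    · intro hh
      rcases lt_or_ge h 0 with hneg | hnn
      · obtain ⟨c, -, hc⟩ := ratCode.exists_btwn (sub_one_lt h)
        obtain ⟨d, hd, hd'⟩ := ratCode.exists_btwn hneg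
        exact ⟨c, d, .inr (.inl hd'), hc, hd⟩
      rcases lt_or_ge 1 h with hpos | hle
      · obtain ⟨d, hd, -⟩ := ratCode.exists_btwn (lt_add_one h)
        obtain ⟨c, hc', hc⟩ := ratCode.exists_btwn hpos
        exact ⟨c, d, .inr (.inr hc'), hc, hd⟩
      have hu : (⟨h, hnn, hle⟩ : unitInterval) ∉ C := fun hu => hh ⟨_, hu, rfl⟩
      obtain ⟨n, a, b, hw, hab⟩ := (mem _).1 hu
      refine ⟨_, _, .inl ⟨n, a, b, hw, rfl, rfl⟩, ?_⟩
      simp only [ratCode.ratCode_add, ratCode.ratCode_neg, ratCode.ratCode_ofUnit, hrad]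
      rw [abs_lt] at hab
      constructor <;> linarith [hab.1, hab.2]
    · rintro ⟨c, d, ⟨n, a, b, hw, hc, hd⟩ | hcd | hcd, h1, h2⟩ ⟨u, hu, rfl⟩
      · rw [hc] at h1
        rw [hd] at h2
        simp only [ratCode.ratCode_add, ratCode.ratCode_neg, ratCode.ratCode_ofUnit, hrad] at h1 h2
        exact (mem u).2 ⟨n, a, b, hw, by rw [abs_lt]; constructor <;> linarith⟩ hu
      · linarith [u.2.1]
      · linarith [u.2.2]

/-! ### Local extrema: finiteness and computability -/

/-- Both Dedekind cuts of the real number `e` are `Σ⁰₁`. -/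
structure IsComputableNumber (e : ℝ) : Prop where
  lt : IsSigma fun q => ratCode q < e
  gt : IsSigma fun q => e < ratCode q

theorem isComputableNumber_ratCode (c : ℕ) : IsComputableNumber (ratCode c) :=
  ⟨ratCode.isSigma_lt (by fun_prop) (by fun_prop), ratCode.isSigma_lt (by fun_prop) (by fun_prop)⟩

/-- At an isolated peak `e`, a rational lies to the left of `e` exactly if some rational further
right has a larger value, and symmetrically on the other side. These comparisons are semidecidable,
so both cuts of `e` are. -/
theorem StrictMonoOn.isComputableNumber_of_strictAntiOn {G : ℝ → ℝ} (hG : EffectivelyContinuous G)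
    {u v : ℕ} {e : ℝ} (hu : ratCode u < e) (hv : e < ratCode v)
    (h1 : StrictMonoOn G (Icc (ratCode u) e)) (h2 : StrictAntiOn G (Icc e (ratCode v))) :
    IsComputableNumber e := by
  -- Rationals outside the window are settled by comparison with `u'` and `v'`. Taking these
  -- strictly between the window's end points and `e` makes the cases overlap, so that no boundary
  -- case is left over.
  obtain ⟨u', hu1, hu2⟩ := ratCode.exists_btwn hu
  obtain ⟨v', hv1, hv2⟩ := ratCode.exists_btwn hv
  have hG' : IsSigma fun t : ℕ × ℕ => G (ratCode t.1) < G (ratCode t.2) := hG.isSigma_lt_apply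
  constructor
  · refine ((ratCode.isSigma_lt (f := fun q : ℕ => q) (g := fun _ => u') (by fun_prop)
      (by fun_prop)).or (IsSigma.ex (p := fun q q' => (ratCode u < ratCode q ∧
        ratCode q < ratCode q' ∧ ratCode q' < ratCode v) ∧ G (ratCode q) < G (ratCode q'))
      (((ratCode.isSigma_lt (by fun_prop) (by fun_prop)).and
        ((ratCode.isSigma_lt (by fun_prop) (by fun_prop)).and
        (ratCode.isSigma_lt (by fun_prop) (by fun_prop)))).and hG'))).of_eq fun q => ?_
    constructor
    · rintro (h | ⟨q', ⟨h3, h4, h5⟩, h6⟩)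
      · exact h.trans hu2
      · by_contra hcon
        rw [not_lt] at hcon
        exact lt_asymm h6 (h2 ⟨hcon, by linarith⟩ ⟨by linarith, h5.le⟩ h4)
    · intro h
      rcases lt_or_ge (ratCode q) (ratCode u') with h3 | h3
      · exact .inl h3
      · obtain ⟨q', h4, h5⟩ := ratCode.exists_btwn h
        exact .inr ⟨q', ⟨by linarith, h4, by linarith⟩,
          h1 ⟨by linarith, h.le⟩ ⟨by linarith, h5.le⟩ h4⟩
  · refine ((ratCode.isSigma_lt (f := fun _ : ℕ => v') (g := fun q => q) (by fun_prop)
      (by fun_prop)).or (IsSigma.ex (p := fun q q' => (ratCode u < ratCode q' ∧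
        ratCode q' < ratCode q ∧ ratCode q < ratCode v) ∧ G (ratCode q) < G (ratCode q'))
      (((ratCode.isSigma_lt (by fun_prop) (by fun_prop)).and
        ((ratCode.isSigma_lt (by fun_prop) (by fun_prop)).and
        (ratCode.isSigma_lt (by fun_prop) (by fun_prop)))).and hG'))).of_eq fun q => ?_
    constructor
    · rintro (h | ⟨q', ⟨h3, h4, h5⟩, h6⟩)
      · exact hv1.trans h
      · by_contra hcon
        rw [not_lt] at hcon
        exact lt_asymm h6 (h1 ⟨h3.le, by linarith⟩ ⟨by linarith, hcon⟩ h4)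
    · intro h
      rcases lt_or_ge (ratCode v') (ratCode q) with h3 | h3
      · exact .inl h3
      · obtain ⟨q', h4, h5⟩ := ratCode.exists_btwn h
        exact .inr ⟨q', ⟨by linarith, h5, by linarith⟩,
          h2 ⟨h4.le, by linarith⟩ ⟨by linarith, by linarith⟩ h5⟩

theorem StrictMonoOn.not_isLocalMax_left {G : ℝ → ℝ} {e v : ℝ} (hv : e < v)
    (h : StrictMonoOn G (Icc e v)) : ¬ IsLocalMax G e := by
  intro hmax
  obtain ⟨l, r, ⟨hl, hr⟩, hlr⟩ := mem_nhds_iff_exists_Ioo_subset.1 hmax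
  obtain ⟨y, hy1, hy2⟩ := exists_between (lt_min hr hv)
  have h1 : G y ≤ G e := hlr ⟨hl.trans hy1, hy2.trans_le (min_le_left _ _)⟩
  exact absurd (h ⟨le_rfl, hv.le⟩ ⟨hy1.le, (hy2.trans_le (min_le_right _ _)).le⟩ hy1) h1.not_gt

theorem StrictAntiOn.not_isLocalMax_right {G : ℝ → ℝ} {u e : ℝ} (hu : u < e)
    (h : StrictAntiOn G (Icc u e)) : ¬ IsLocalMax G e := by
  intro hmax
  obtain ⟨l, r, ⟨hl, hr⟩, hlr⟩ := mem_nhds_iff_exists_Ioo_subset.1 hmax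
  obtain ⟨y, hy1, hy2⟩ := exists_between (max_lt hl hu)
  have h1 : G y ≤ G e := hlr ⟨(le_max_left _ _).trans_lt hy1, hy2.trans hr⟩
  exact absurd (h ⟨((le_max_right _ _).trans_lt hy1).le, hy2.le⟩ ⟨hu.le, le_rfl⟩ hy2) h1.not_gt

theorem IsLocalMax.isComputableNumber {G : ℝ → ℝ} (hG : EffectivelyContinuous G)
    {u v : ℕ} {e : ℝ} (he : IsLocalMax G e) (hu : ratCode u < e) (hv : e < ratCode v)
    (h1 : StrictMonoOn G (Icc (ratCode u) e) ∨ StrictAntiOn G (Icc (ratCode u) e))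
    (h2 : StrictMonoOn G (Icc e (ratCode v)) ∨ StrictAntiOn G (Icc e (ratCode v))) :
    IsComputableNumber e :=
  (h1.resolve_right fun h => h.not_isLocalMax_right hu he).isComputableNumber_of_strictAntiOn
    hG hu hv (h2.resolve_left fun h => h.not_isLocalMax_left hv he)

section Extrema

variable {f : unitInterval → unitInterval}

theorem IsLocalExtr.mem_image_localExtrema {z : ℝ} (hz : z ∈ Ioo (0 : ℝ) 1)
    (h : IsLocalExtr (realExtend f) z) : z ∈ ((↑) '' localExtrema f : Set ℝ) := by
  let x : unitInterval := ⟨z, hz.1.le, hz.2.le⟩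
  refine ⟨x, ⟨fun h0 => hz.1.ne' (congrArg Subtype.val h0),
    fun h1 => hz.2.ne (congrArg Subtype.val h1), ?_⟩, rfl⟩
  have ht : Tendsto ((↑) : unitInterval → ℝ) (𝓝 x) (𝓝 z) := continuous_subtype_val.tendsto x
  refine h.imp (fun h => ?_) fun h => ?_
  · filter_upwards [ht.eventually h] with y hy
    have e := realExtend_coe f x
    rw [realExtend_coe, show z = (x : ℝ) from rfl, e] at hy
    exact hy
  · filter_upwards [ht.eventually h] with y hy
    have e := realExtend_coe f x
    rw [realExtend_coe, show z = (x : ℝ) from rfl, e] at hy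
    exact hy

theorem isLocalExtr_realExtend {x : unitInterval} (h : IsLocalExtr f x) :
    IsLocalExtr (realExtend f) x := by
  have ht : Tendsto (projIcc (0 : ℝ) 1 zero_le_one) (𝓝 x) (𝓝 x) := by
    have := (continuous_projIcc (h := zero_le_one (α := ℝ))).tendsto (x : ℝ)
    rwa [projIcc_val] at this
  refine h.imp (fun h => ?_) fun h => ?_
  · filter_upwards [ht.eventually h] with y hy
    rw [realExtend_coe]
    exact hy
  · filter_upwards [ht.eventually h] with y hy
    rw [realExtend_coe]
    exact hy

/-- Two equal values would force a local extremum strictly between them, as in Rolle's theorem. So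
the function is injective on the interval, and a continuous injective function there is strictly
monotone. -/
theorem strictMonoOn_or_strictAntiOn_of_localExtrema (hF : Continuous (realExtend f)) {u v : ℝ}
    (hu : 0 ≤ u) (huv : u ≤ v) (hv : v ≤ 1)
    (h : ∀ e ∈ ((↑) '' localExtrema f : Set ℝ), e ∉ Ioo u v) :
    StrictMonoOn (realExtend f) (Icc u v) ∨ StrictAntiOn (realExtend f) (Icc u v) := by
  refine hF.continuousOn.strictMonoOn_of_injOn_Icc' huv ?_
  have key : ∀ s ∈ Icc u v, ∀ t ∈ Icc u v, s < t → realExtend f s ≠ realExtend f t := by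
    intro s hs t ht hst heq
    obtain ⟨c, hc, hc'⟩ := exists_isLocalExtr_Ioo hst hF.continuousOn heq
    refine h c (hc'.mem_image_localExtrema ⟨?_, ?_⟩) ⟨?_, ?_⟩
    · linarith [hs.1, hc.1]
    · linarith [ht.2, hc.2]
    · linarith [hs.1, hc.1]
    · linarith [ht.2, hc.2]
  intro s hs t ht heq
  rcases lt_trichotomy s t with hst | hst | hst
  · exact absurd heq (key s hs t ht hst)
  · exact hst
  · exact absurd heq.symm (key t ht s hs hst)

theorem FiniteToOne.not_constant (hfin : FiniteToOne f) {a b c : unitInterval} (hab : a < b)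
    (h : ∀ y ∈ Icc a b, f y = c) : False :=
  (Icc_infinite hab) ((hfin c).subset fun y hy => h y hy)

/-- A local extremum inside an interval of monotonicity makes the function constant on one side of
it, which finite fibres exclude. -/
theorem FiniteToOne.not_isLocalExtr (hfin : FiniteToOne f) {a z b : unitInterval} (haz : a < z)
    (hzb : z < b) (hm : MonotoneOn f (Icc a b) ∨ AntitoneOn f (Icc a b)) : ¬ IsLocalExtr f z := by
  intro hz
  have near : ∀ {p : unitInterval → Prop}, (∀ᶠ y in 𝓝 z, p y) →
      ∃ a' b', a ≤ a' ∧ b' ≤ b ∧ a' < z ∧ z < b' ∧ ∀ y ∈ Icc a' b', p y := by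
    intro p hp
    obtain ⟨l, r, ⟨hl, hr⟩, hlr⟩ := (mem_nhds_iff_exists_Ioo_subset' ⟨a, haz⟩ ⟨b, hzb⟩).1 hp
    obtain ⟨a', h1, h2⟩ := exists_between (max_lt hl haz)
    obtain ⟨b', h3, h4⟩ := exists_between (lt_min hr hzb)
    exact ⟨a', b', ((le_max_right _ _).trans_lt h1).le, (h4.trans_le (min_le_right _ _)).le, h2, h3,
      fun y hy => hlr ⟨((le_max_left _ _).trans_lt h1).trans_le hy.1,
        hy.2.trans_lt (h4.trans_le (min_le_left _ _))⟩⟩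
  have hzI : z ∈ Icc a b := ⟨haz.le, hzb.le⟩
  rcases hz with hz | hz <;> obtain ⟨a', b', h1, h2, h3, h4, h5⟩ := near hz <;>
    rcases hm with hm | hm
  · exact hfin.not_constant h3 fun y hy => le_antisymm
      (hm ⟨h1.trans hy.1, hy.2.trans hzb.le⟩ hzI hy.2) (h5 y ⟨hy.1, hy.2.trans h4.le⟩)
  · exact hfin.not_constant h4 fun y hy => le_antisymm
      (hm hzI ⟨haz.le.trans hy.1, hy.2.trans h2⟩ hy.1) (h5 y ⟨h3.le.trans hy.1, hy.2⟩)
  · exact hfin.not_constant h4 fun y hy => le_antisymm (h5 y ⟨h3.le.trans hy.1, hy.2⟩)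
      (hm hzI ⟨haz.le.trans hy.1, hy.2.trans h2⟩ hy.1)
  · exact hfin.not_constant h3 fun y hy => le_antisymm (h5 y ⟨hy.1, hy.2.trans h4.le⟩)
      (hm ⟨h1.trans hy.1, hy.2.trans hzb.le⟩ hzI hy.2)

/-- Only the finitely many division points remain as candidates. -/
theorem PiecewiseMonotone.finite_localExtrema (hmono : PiecewiseMonotone f)
    (hfin : FiniteToOne f) : (localExtrema f).Finite := by
  obtain ⟨m, t, ht, h0, h1, hm⟩ := hmono
  refine ((finite_Iic m).image t).subset fun z hz => ?_
  by_contra hcon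
  -- The least `i` with `z < t i` is positive, and `z` is strictly inside the piece just before it.
  have hex : ∃ i, z < t i := ⟨m, h1 ▸ lt_of_le_of_ne unitInterval.le_one' hz.2.1⟩
  have hle : Nat.find hex ≤ m := Nat.find_min' hex (h1 ▸ lt_of_le_of_ne unitInterval.le_one' hz.2.1)
  have hpos : Nat.find hex ≠ 0 := by
    intro h
    have := Nat.find_spec hex
    rw [h, h0] at this
    exact absurd this unitInterval.nonneg'.not_gt
  obtain ⟨i, hi⟩ := Nat.exists_eq_succ_of_ne_zero hpos
  have hti : t i ≤ z := not_lt.1 (Nat.find_min hex (by omega))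
  have hti' : t i ≠ z := fun h => hcon ⟨i, by simp; omega, h⟩
  have hlt := Nat.find_spec hex
  rw [hi] at hlt
  exact hfin.not_isLocalExtr (lt_of_le_of_ne hti hti') hlt (hm i (by omega)) hz.2.2

/-- Finiteness isolates `e` by a rational window without other extrema, on both halves of which the
function is strictly monotone. A minimum is treated as a maximum of the negative. -/
theorem isComputableNumber_of_mem_localExtrema (hF : EffectivelyContinuous (realExtend f))
    (hE : (localExtrema f).Finite) {e : unitInterval} (he : e ∈ localExtrema f) :
    IsComputableNumber (e : ℝ) := by
  set E : Set ℝ := (↑) '' localExtrema f with hEdef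
  have hEf : (E \ {(e : ℝ)}).Finite := (hE.image _).subset sdiff_subset
  have he0 : (0 : ℝ) < e := unitInterval.pos_iff_ne_zero.2 he.1
  have he1 : (e : ℝ) < 1 := unitInterval.lt_one_iff_ne_one.2 he.2.1
  have hnhds : (E \ {(e : ℝ)})ᶜ ∩ Ioo 0 1 ∈ 𝓝 (e : ℝ) :=
    inter_mem (hEf.isClosed.isOpen_compl.mem_nhds fun h => h.2 rfl) (Ioo_mem_nhds he0 he1)
  obtain ⟨l, r, ⟨hl, hr⟩, hlr⟩ := mem_nhds_iff_exists_Ioo_subset.1 hnhds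
  obtain ⟨u, hlu, hue⟩ := ratCode.exists_btwn hl
  obtain ⟨v, hev, hvr⟩ := ratCode.exists_btwn hr
  have hu0 := (hlr ⟨hlu, hue.trans hr⟩).2.1
  have hv1 := (hlr ⟨hl.trans hev, hvr⟩).2.2
  have h1 := strictMonoOn_or_strictAntiOn_of_localExtrema hF.continuous hu0.le hue.le he1.le
    fun x hx hx' => (hlr ⟨hlu.trans hx'.1, hx'.2.trans hr⟩).1 ⟨hx, hx'.2.ne⟩
  have h2 := strictMonoOn_or_strictAntiOn_of_localExtrema hF.continuous he0.le hev.le hv1.le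
    fun x hx hx' => (hlr ⟨hl.trans hx'.1, hx'.2.trans hvr⟩).1 ⟨hx, hx'.1.ne'⟩
  rcases isLocalExtr_realExtend he.2.2 with h | h
  · exact IsLocalMax.isComputableNumber hF.neg (IsLocalMin.neg h) hue hev
      (h1.symm.imp (fun h => h.neg) fun h => h.neg) (h2.symm.imp (fun h => h.neg) fun h => h.neg)
  · exact IsLocalMax.isComputableNumber hF h hue hev h1 h2

end Extrema

/-! ### Inverse branches on the pieces of monotonicity -/

/-- The Σ-relation `T (a, b, c, d)` between rational intervals describes an inverse branch of `F`
on `[lo, hi] ∩ [0, 1]`: it witnesses that points of this interval with values in `(a, b)` lie in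
`(c, d)`. -/
structure IsInverseBranch (F : ℝ → ℝ) (lo hi : ℝ) (T : ℕ × ℕ × ℕ × ℕ → Prop) : Prop where
  isSigma : IsSigma T
  sound : ∀ a b c d w, T (a, b, c, d) → w ∈ Icc (max lo 0) (min hi 1) → ratCode a < F w →
    F w < ratCode b → ratCode c < w ∧ w < ratCode d
  total : ∀ t : ℝ, ∃ u ∈ Icc (0 : ℝ) 1, ∀ c d, ratCode c < u → u < ratCode d →
    ∃ a b, T (a, b, c, d) ∧ ratCode a < t ∧ t < ratCode b

/-- For increasing `G`, a preimage of a value above `ratCode a` lies to the right of `ratCode c` if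
`ratCode c` is left of the piece or `G (ratCode c) < ratCode a`; upper bounds are dual.
Computability of the end points makes this `Σ⁰₁`. -/
theorem StrictMonoOn.exists_isInverseBranch {G : ℝ → ℝ} (hG : EffectivelyContinuous G) {lo hi : ℝ}
    (hlo : IsComputableNumber lo) (hhi : IsComputableNumber hi) (hlt : max lo 0 < min hi 1)
    (hmono : StrictMonoOn G (Icc (max lo 0) (min hi 1))) : ∃ T, IsInverseBranch G lo hi T := by
  have hlow : IsSigma fun t : ℕ × ℕ => ratCode t.2 < lo ∨ ratCode t.2 < 0 ∨
      ((ratCode t.2 < hi ∧ ratCode t.2 < 1) ∧ G (ratCode t.2) < ratCode t.1) := by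
    have h0 := isComputableNumber_ratCode 0
    have h1 := isComputableNumber_ratCode (ratCode.dyadic 1 0)
    rw [ratCode.ratCode_zero] at h0
    rw [ratCode.ratCode_dyadic, Nat.cast_one, pow_zero, one_mul] at h1
    exact (hlo.lt.comp (by fun_prop)).or ((h0.lt.comp (by fun_prop)).or
      (((hhi.lt.comp (by fun_prop)).and (h1.lt.comp (by fun_prop))).and
        (hG.isSigma_lt.comp (g := fun t : ℕ × ℕ => (t.2, t.1)) (by fun_prop))))
  have hhigh : IsSigma fun t : ℕ × ℕ => hi < ratCode t.2 ∨ 1 < ratCode t.2 ∨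
      ((lo < ratCode t.2 ∧ 0 < ratCode t.2) ∧ ratCode t.1 < G (ratCode t.2)) := by
    have h0 := isComputableNumber_ratCode 0
    have h1 := isComputableNumber_ratCode (ratCode.dyadic 1 0)
    rw [ratCode.ratCode_zero] at h0
    rw [ratCode.ratCode_dyadic, Nat.cast_one, pow_zero, one_mul] at h1
    exact (hhi.gt.comp (by fun_prop)).or ((h1.gt.comp (by fun_prop)).or
      (((hlo.gt.comp (by fun_prop)).and (h0.gt.comp (by fun_prop))).and
        (hG.isSigma_gt.comp (g := fun t : ℕ × ℕ => (t.2, t.1)) (by fun_prop))))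
  refine ⟨_, (hlow.comp (g := fun t : ℕ × ℕ × ℕ × ℕ => (t.1, t.2.2.1)) (by fun_prop)).and
    (hhigh.comp (g := fun t : ℕ × ℕ × ℕ × ℕ => (t.2.1, t.2.2.2)) (by fun_prop)), ?_, ?_⟩
  · rintro a b c d w ⟨h1, h2⟩ hw ha hb
    have hw1 := max_le_iff.1 hw.1
    have hw2 := le_min_iff.1 hw.2
    constructor
    · rcases h1 with h | h | ⟨⟨h3, h4⟩, h5⟩
      · exact h.trans_le hw1.1
      · exact h.trans_le hw1.2
      · by_contra hcon
        have := hmono.monotoneOn hw ⟨hw.1.trans (not_lt.1 hcon), le_min h3.le h4.le⟩ (not_lt.1 hcon)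
        exact absurd (h5.trans ha) this.not_gt
    · rcases h2 with h | h | ⟨⟨h3, h4⟩, h5⟩
      · exact hw2.1.trans_lt h
      · exact hw2.2.trans_lt h
      · by_contra hcon
        have := hmono.monotoneOn ⟨max_le h3.le h4.le, (not_lt.1 hcon).trans hw.2⟩ hw (not_lt.1 hcon)
        exact absurd (hb.trans h5) this.not_gt
  · intro t
    set l := max lo 0 with hl
    set r := min hi 1 with hr
    -- `u` is the preimage of `t`, or the nearer end of the piece if `t` is outside the range. The
    -- two implications are all that remains of `G u = t`, and they suffice for totality at every
    -- real `t`.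
    have hu : ∃ u ∈ Icc l r, (l < u → G u ≤ t) ∧ (u < r → t ≤ G u) := by
      rcases lt_or_ge t (G l) with h1 | h1
      · exact ⟨l, ⟨le_rfl, hlt.le⟩, fun h => absurd h (lt_irrefl _), fun _ => h1.le⟩
      rcases lt_or_ge (G r) t with h2 | h2
      · exact ⟨r, ⟨hlt.le, le_rfl⟩, fun _ => h2.le, fun h => absurd h (lt_irrefl _)⟩
      obtain ⟨u, hu, rfl⟩ := intermediate_value_Icc hlt.le hG.continuous.continuousOn ⟨h1, h2⟩
      exact ⟨u, hu, fun _ => le_rfl, fun _ => le_rfl⟩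
    obtain ⟨u, hu, hu1, hu2⟩ := hu
    refine ⟨u, ⟨(le_max_right _ _).trans hu.1, hu.2.trans (min_le_right _ _)⟩,
      fun c d hc hd => ?_⟩
    have ha : ∃ a, ratCode a < t ∧ (ratCode c < lo ∨ ratCode c < 0 ∨
        ((ratCode c < hi ∧ ratCode c < 1) ∧ G (ratCode c) < ratCode a)) := by
      rcases lt_or_ge (ratCode c) l with h | h
      · obtain ⟨a, -, ha⟩ := ratCode.exists_btwn (sub_one_lt t)
        exact ⟨a, ha, (lt_max_iff.1 h).imp_right .inl⟩
      · have h1 := hmono ⟨h, hc.le.trans hu.2⟩ hu hc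
        obtain ⟨a, ha, ha'⟩ := ratCode.exists_btwn (h1.trans_le (hu1 (h.trans_lt hc)))
        exact ⟨a, ha', .inr (.inr ⟨lt_min_iff.1 (hc.trans_le hu.2), ha⟩)⟩
    have hb : ∃ b, t < ratCode b ∧ (hi < ratCode d ∨ 1 < ratCode d ∨
        ((lo < ratCode d ∧ 0 < ratCode d) ∧ ratCode b < G (ratCode d))) := by
      rcases lt_or_ge r (ratCode d) with h | h
      · obtain ⟨b, hb, -⟩ := ratCode.exists_btwn (lt_add_one t)
        exact ⟨b, hb, (min_lt_iff.1 h).imp_right .inl⟩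
      · have h1 := hmono hu ⟨hu.1.trans hd.le, h⟩ hd
        obtain ⟨b, hb, hb'⟩ := ratCode.exists_btwn ((hu2 (hd.trans_le h)).trans_lt h1)
        exact ⟨b, hb, .inr (.inr ⟨max_lt_iff.1 (hu.1.trans_lt hd), hb'⟩)⟩
    obtain ⟨a, ha, ha'⟩ := ha
    obtain ⟨b, hb, hb'⟩ := hb
    exact ⟨a, b, ⟨ha', hb'⟩, ha, hb⟩

theorem ratCode.neg_neg (m : ℕ) : ratCode.neg (ratCode.neg m) = m := by
  simp [ratCode.neg]

theorem exists_isInverseBranch {F : ℝ → ℝ} (hF : EffectivelyContinuous F) {lo hi : ℝ}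
    (hlo : IsComputableNumber lo) (hhi : IsComputableNumber hi) (hlt : max lo 0 < min hi 1)
    (h : StrictMonoOn F (Icc (max lo 0) (min hi 1)) ∨ StrictAntiOn F (Icc (max lo 0) (min hi 1))) :
    ∃ T, IsInverseBranch F lo hi T := by
  rcases h with h | h
  · exact h.exists_isInverseBranch hF hlo hhi hlt
  obtain ⟨T, hT, hs, ht⟩ := StrictMonoOn.exists_isInverseBranch hF.neg hlo hhi hlt h.neg
  refine ⟨fun t => T (ratCode.neg t.2.1, ratCode.neg t.1, t.2.2.1, t.2.2.2),
    hT.comp (g := fun t : ℕ × ℕ × ℕ × ℕ =>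
      (ratCode.neg t.2.1, ratCode.neg t.1, t.2.2.1, t.2.2.2)) (by fun_prop), ?_, fun t => ?_⟩
  · intro a b c d w hT hw ha hb
    refine hs _ _ c d w hT hw ?_ ?_ <;> rw [ratCode.ratCode_neg] <;> linarith
  · obtain ⟨u, hu, hu'⟩ := ht (-t)
    refine ⟨u, hu, fun c d hc hd => ?_⟩
    obtain ⟨a, b, hT, ha, hb⟩ := hu' c d hc hd
    refine ⟨ratCode.neg b, ratCode.neg a, ?_, ?_, ?_⟩
    · simpa only [ratCode.neg_neg] using hT
    · rw [ratCode.ratCode_neg]; linarith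
    · rw [ratCode.ratCode_neg]; linarith

theorem Set.Finite.exists_enumeration {β : Type*} {P : Set β} (hP : P.Finite) (hne : P.Nonempty) :
    ∃ (M : ℕ) (g : ℕ → β), (∀ i, g i ∈ P) ∧ ∀ p ∈ P, ∃ i < M, g i = p := by
  have := hP.to_subtype
  let e := Finite.equivFin P
  obtain ⟨p₀, hp₀⟩ := hne
  -- Indices beyond the cardinality get an arbitrary element of `P`, so that every index has the
  -- properties of a member.
  refine ⟨Nat.card P, fun i => if h : i < Nat.card P then (e.symm ⟨i, h⟩ : β) else p₀,
    fun i => ?_, fun p hp => ⟨e ⟨p, hp⟩, (e ⟨p, hp⟩).2, ?_⟩⟩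
  · dsimp only
    split_ifs
    · exact Subtype.coe_prop _
    · exact hp₀
  · simp only [Fin.is_lt, dif_pos, Fin.eta]
    exact congrArg Subtype.val (e.symm_apply_apply ⟨p, hp⟩)

/-- The pieces lie between neighbouring local extrema. Each carries an inverse branch, and a point
that is not an extremum is never an end point of a piece, so its position is decidable. -/
theorem exists_pieces {f : unitInterval → unitInterval} (hF : EffectivelyContinuous (realExtend f))
    (hE : (localExtrema f).Finite) :
    ∃ (M : ℕ) (lo hi : ℕ → ℝ) (T : ℕ → ℕ × ℕ × ℕ × ℕ → Prop),
      (∀ i, IsComputableNumber (lo i)) ∧ (∀ i, IsComputableNumber (hi i)) ∧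
      (∀ i, IsInverseBranch (realExtend f) (lo i) (hi i) (T i)) ∧
      ∀ u ∈ Icc (0 : ℝ) 1, u ∉ ((↑) '' localExtrema f : Set ℝ) →
        (∃ i < M, lo i < u ∧ u < hi i) ∧ ∀ i, u ≠ lo i ∧ u ≠ hi i := by
  set E : Set ℝ := (↑) '' localExtrema f with hEdef
  have hEfin : E.Finite := hE.image _
  have hE0 : ∀ e ∈ E, 0 < e ∧ e < 1 := by
    rintro _ ⟨e, he, rfl⟩
    exact ⟨unitInterval.pos_iff_ne_zero.2 he.1, unitInterval.lt_one_iff_ne_one.2 he.2.1⟩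
  have hEc : ∀ e ∈ E, IsComputableNumber e := by
    rintro _ ⟨e, he, rfl⟩
    exact isComputableNumber_of_mem_localExtrema hF hE he
  have hneg : IsComputableNumber (-1) := by
    have := isComputableNumber_ratCode (ratCode.neg (ratCode.dyadic 1 0))
    simpa using this
  have htwo : IsComputableNumber 2 := by
    have := isComputableNumber_ratCode (ratCode.dyadic 2 0)
    simpa using this
  -- The outermost end points are `-1` and `2` instead of `0` and `1`, so that `0` and `1` are
  -- strictly inside their pieces and need no special treatment.
  let P : Set (ℝ × ℝ) := {t | t.1 ∈ insert (-1) E ∧ t.2 ∈ insert 2 E ∧ t.1 < t.2 ∧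
    ∀ e ∈ E, e ∉ Ioo t.1 t.2}
  have hPfin : P.Finite := ((hEfin.insert (-1)).prod (hEfin.insert 2)).subset
    fun t ht => ⟨ht.1, ht.2.1⟩
  have hcover : ∀ u ∈ Icc (0 : ℝ) 1, u ∉ E → ∃ t ∈ P, t.1 < u ∧ u < t.2 := by
    intro u hu huE
    obtain ⟨a, ⟨haE, hau⟩, ha⟩ := exists_max_image {x | x ∈ insert (-1) E ∧ x < u} id
      ((hEfin.insert (-1)).subset fun x hx => hx.1)
      ⟨-1, mem_insert _ _, by linarith [hu.1]⟩
    obtain ⟨b, ⟨hbE, hub⟩, hb⟩ := exists_min_image {x | x ∈ insert 2 E ∧ u < x} id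
      ((hEfin.insert 2).subset fun x hx => hx.1)
      ⟨2, mem_insert _ _, by linarith [hu.2]⟩
    refine ⟨(a, b), ⟨haE, hbE, hau.trans hub, fun e he hab => ?_⟩, hau, hub⟩
    rcases lt_trichotomy e u with h | h | h
    · exact absurd (ha e ⟨mem_insert_of_mem _ he, h⟩) hab.1.not_ge
    · exact huE (h ▸ he)
    · exact absurd (hb e ⟨mem_insert_of_mem _ he, h⟩) hab.2.not_ge
  have hlo : ∀ t ∈ P, IsComputableNumber t.1 ∧ t.1 < 1 := by
    rintro t ⟨h | h, -⟩
    · rw [h]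
      exact ⟨hneg, by norm_num⟩
    · exact ⟨hEc _ h, (hE0 _ h).2⟩
  have hhi : ∀ t ∈ P, IsComputableNumber t.2 ∧ 0 < t.2 := by
    rintro t ⟨-, h | h, -⟩
    · rw [h]
      exact ⟨htwo, by norm_num⟩
    · exact ⟨hEc _ h, (hE0 _ h).1⟩
  have hbranch : ∀ t ∈ P, ∃ T, IsInverseBranch (realExtend f) t.1 t.2 T := by
    intro t ht
    have hlt : max t.1 0 < min t.2 1 :=
      max_lt (lt_min ht.2.2.1 (hlo t ht).2) (lt_min (hhi t ht).2 one_pos)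
    refine exists_isInverseBranch hF (hlo t ht).1 (hhi t ht).1 hlt
      (strictMonoOn_or_strictAntiOn_of_localExtrema hF.continuous (le_max_right _ _) hlt.le
        (min_le_right _ _) fun e he he' => ht.2.2.2 e he ⟨(le_max_left _ _).trans_lt he'.1,
          he'.2.trans_le (min_le_left _ _)⟩)
  have h0 : (0 : ℝ) ∉ E := fun h => lt_irrefl _ (hE0 0 h).1
  obtain ⟨t₀, ht₀, -⟩ := hcover 0 ⟨le_rfl, zero_le_one⟩ h0
  obtain ⟨M, g, hg, hgP⟩ := hPfin.exists_enumeration ⟨t₀, ht₀⟩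
  choose T hT using fun i => hbranch (g i) (hg i)
  refine ⟨M, fun i => (g i).1, fun i => (g i).2, T, fun i => (hlo _ (hg i)).1,
    fun i => (hhi _ (hg i)).1, hT, fun u hu huE => ⟨?_, fun i => ⟨?_, ?_⟩⟩⟩
  · obtain ⟨t, ht, h1, h2⟩ := hcover u hu huE
    obtain ⟨i, hi, rfl⟩ := hgP t ht
    exact ⟨i, hi, h1, h2⟩
  · rintro rfl
    rcases (hg i).1 with h | h
    · dsimp only at hu
      rw [h] at hu
      linarith [hu.1]
    · exact huE h
  · rintro rfl
    rcases (hg i).2.1 with h | h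
    · dsimp only at hu
      rw [h] at hu
      linarith [hu.2]
    · exact huE h

/-! ### Sequences in a countable `Π⁰₁` set -/

namespace IsRealPi01

variable {A : Set ℝ}

theorem exists_ratCode_notMem (hA : IsRealPi01 A) (hc : A.Countable) {l r : ℝ} (h : l < r) :
    ∃ q, ratCode q ∉ A ∧ l < ratCode q ∧ ratCode q < r := by
  have hd : DenseRange ratCode := realSpace.dense
  obtain ⟨y, hy, hyA⟩ := (hc.dense_compl ℝ).exists_mem_open isOpen_Ioo (nonempty_Ioo.2 h)
  obtain ⟨q, hq⟩ := hd.exists_mem_open (hA.isClosed.isOpen_compl.inter isOpen_Ioo) ⟨y, hy, hyA⟩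
  exact ⟨q, hq.1, hq.2.1, hq.2.2⟩

/-- Sequences in a countable `Π⁰₁` set of reals are determined by their position relative to the
rational numbers enumerated into the complement. -/
theorem exists_ttEquivalent (hA : IsRealPi01 A) (hc : A.Countable) {x : ℕ → unitInterval}
    (hx : ∀ n, (x n : ℝ) ∈ A) :
    ∃ y : ℝ × (ℕ → Bool), TTEquivalent hilbertCube realTimesCantor x y := by
  obtain ⟨R, hR, hRA⟩ := hA.isSigma_notMem
  have hRq : ∀ {α : Type} [Primcodable α] {g g' : α → ℕ}, Computable g → Computable g' →
      Computable fun a => R (g a) (g' a) := fun hg hg' =>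
    hR.comp (f := fun t => R t.1 t.2) (hg.pair hg')
  -- The index codes a coordinate `n`, a rational `q` and a witness for `q` being outside `A`.
  -- Including the witness makes it decidable whether the bit is meaningful; all other bits are
  -- `false`.
  let s : ℕ → Bool := fun N => decide (R N.unpair.2.unpair.1 N.unpair.2.unpair.2 = true ∧
    (x N.unpair.1 : ℝ) < ratCode N.unpair.2.unpair.1)
  refine ⟨(0, s), ?_, ?_⟩
  · have h1 : Approximable hilbertCube realSpace x fun _ : Unit => (0 : ℝ) := by
      refine Approximable.real (fun t _ => t.2.1 = 0)
        (SigmaOpen.of_isSigma (IsSigma.eq (by fun_prop) (by fun_prop))) ?_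
        fun _ _ _ => ⟨0, rfl⟩
      rintro _ c k h
      simp only at h
      rw [h, ratCode.ratCode_zero, sub_zero, abs_zero]
      positivity
    have h2 : Approximable hilbertCube boolSpace x s := by
      -- Any answer is permitted once the coordinate is seen to leave `A`. Otherwise the coordinate
      -- is in `A` and a certified rational is not, so the two differ and a strict comparison is
      -- eventually confirmed.
      refine Approximable.bool (fun (t : ℕ × Bool) x' => (x' t.1.unpair.1 : ℝ) ∉ A ∨
        (t.2 = true ∧ R t.1.unpair.2.unpair.1 t.1.unpair.2.unpair.2 = true ∧
          (x' t.1.unpair.1 : ℝ) < ratCode t.1.unpair.2.unpair.1) ∨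
        (t.2 = false ∧ (R t.1.unpair.2.unpair.1 t.1.unpair.2.unpair.2 = false ∨
          ratCode t.1.unpair.2.unpair.1 < (x' t.1.unpair.1 : ℝ)))) ?_ ?_ ?_
      · exact (hA.sigmaOpen_notMem (hilbertCube_coord.comp
          (g := fun t : ℕ × Bool => t.1.unpair.1) (by fun_prop))).or
          (((SigmaOpen.of_isSigma (IsSigma.eq (by fun_prop) (by fun_prop))).and
          ((SigmaOpen.of_isSigma (IsSigma.eq (hRq (by fun_prop) (by fun_prop)) (by fun_prop))).and
          (hilbertCube_coord.lt.comp
            (g := fun t : ℕ × Bool => (t.1.unpair.1, t.1.unpair.2.unpair.1)) (by fun_prop)))).or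
          ((SigmaOpen.of_isSigma (IsSigma.eq (by fun_prop) (by fun_prop))).and
          ((SigmaOpen.of_isSigma (IsSigma.eq (hRq (by fun_prop) (by fun_prop)) (by fun_prop))).or
          (hilbertCube_coord.gt.comp
            (g := fun t : ℕ × Bool => (t.1.unpair.1, t.1.unpair.2.unpair.1)) (by fun_prop)))))
      · rintro N b (h | ⟨rfl, h⟩ | ⟨rfl, h | h⟩)
        · exact absurd (hx _) h
        · exact decide_eq_true h
        · refine decide_eq_false fun h' => ?_
          simp only at h
          rw [h'.1] at h
          exact Bool.noConfusion h
        · exact decide_eq_false fun h' => lt_asymm h h'.2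
      · intro x' N
        by_cases hxA : (x' N.unpair.1 : ℝ) ∈ A
        · cases hb : R N.unpair.2.unpair.1 N.unpair.2.unpair.2
          · exact ⟨false, .inr (.inr ⟨rfl, .inl hb⟩)⟩
          · have hq := (hRA _).2 ⟨_, hb⟩
            rcases lt_trichotomy (x' N.unpair.1 : ℝ) (ratCode N.unpair.2.unpair.1) with h | h | h
            · exact ⟨true, .inr (.inl ⟨rfl, hb, h⟩)⟩
            · exact absurd (h ▸ hxA) hq
            · exact ⟨false, .inr (.inr ⟨rfl, .inr h⟩)⟩
        · exact ⟨true, .inl hxA⟩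
    exact (h1.prod h2.omegaPower).ttReducible
  -- `low` and `high` say that the code places the rational below or above the coordinate. Negative
  -- rationals are always low and rationals above `1` always high, whatever the bits are.
  · let low : ℕ × ℕ → ℝ × (ℕ → Bool) → Prop := fun t y => ratCode t.2 < ratCode 0 ∨
      ∃ m, R t.2 m = true ∧ y.2 (Nat.pair t.1 (Nat.pair t.2 m)) = false
    let high : ℕ × ℕ → ℝ × (ℕ → Bool) → Prop := fun t y =>
      ratCode (ratCode.dyadic 1 0) < ratCode t.2 ∨
        ∃ m, R t.2 m = true ∧ y.2 (Nat.pair t.1 (Nat.pair t.2 m)) = true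
    have bit : ∀ b : Bool, SigmaOpen realTimesCantor fun (t : ℕ × ℕ) y =>
        ∃ m, R t.2 m = true ∧ y.2 (Nat.pair t.1 (Nat.pair t.2 m)) = b := fun b =>
      SigmaOpen.ex (P := fun (t : ℕ × ℕ) m (y : ℝ × (ℕ → Bool)) =>
        R t.2 m = true ∧ y.2 (Nat.pair t.1 (Nat.pair t.2 m)) = b)
        ((SigmaOpen.of_isSigma (IsSigma.eq (hRq (by fun_prop) (by fun_prop)) (by fun_prop))).and
          (realTimesCantor_bit.comp (g := fun t : (ℕ × ℕ) × ℕ =>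
            (Nat.pair t.1.1 (Nat.pair t.1.2 t.2), b)) (by fun_prop)))
    have hlow : SigmaOpen realTimesCantor low :=
      (SigmaOpen.of_isSigma (ratCode.isSigma_lt (by fun_prop) (by fun_prop))).or (bit false)
    have hhigh : SigmaOpen realTimesCantor high :=
      (SigmaOpen.of_isSigma (ratCode.isSigma_lt (by fun_prop) (by fun_prop))).or (bit true)
    have key : Approximable realTimesCantor unitIntervalSpace (0, s) x := by
      refine Approximable.unitInterval (fun (t : ℕ × ℕ × ℕ) y => ∃ q q',
        (ratCode q < ratCode t.2.1 ∧ ratCode t.2.1 < ratCode q' ∧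
          ratCode q' < ratCode (ratCode.add q (ratCode.dyadic 1 t.2.2))) ∧
        low (t.1, q) y ∧ high (t.1, q') y) ?_ ?_ ?_
      · refine SigmaOpen.ex₂ (P := fun (t : ℕ × ℕ × ℕ) q q' (y : ℝ × (ℕ → Bool)) =>
          (ratCode q < ratCode t.2.1 ∧ ratCode t.2.1 < ratCode q' ∧
          ratCode q' < ratCode (ratCode.add q (ratCode.dyadic 1 t.2.2))) ∧
          low (t.1, q) y ∧ high (t.1, q') y) ?_
        exact (SigmaOpen.of_isSigma ((ratCode.isSigma_lt (by fun_prop) (by fun_prop)).and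
          ((ratCode.isSigma_lt (by fun_prop) (by fun_prop)).and
          (ratCode.isSigma_lt (by fun_prop) (by fun_prop))))).and
          ((hlow.comp (g := fun t : (ℕ × ℕ × ℕ) × ℕ × ℕ => (t.1.1, t.2.1)) (by fun_prop)).and
          (hhigh.comp (g := fun t : (ℕ × ℕ × ℕ) × ℕ × ℕ => (t.1.1, t.2.2)) (by fun_prop)))
      · rintro n c k ⟨q, q', ⟨h1, h2, h3⟩, hq, hq'⟩
        simp only [ratCode.ratCode_add, ratCode.ratCode_dyadic, Nat.cast_one, one_mul] at h1 h2 h3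
        have hqx : ratCode q ≤ x n := by
          rcases hq with h | ⟨m, hm, h⟩
          · simp only [ratCode.ratCode_zero] at h
            exact h.le.trans (x n).2.1
          · simp only [s, Nat.unpair_pair, decide_eq_false_iff_not, not_and, not_lt] at h
            exact h hm
        have hqx' : (x n : ℝ) ≤ ratCode q' := by
          rcases hq' with h | ⟨m, hm, h⟩
          · simp only [ratCode.ratCode_dyadic, Nat.cast_one, pow_zero, one_mul] at h
            exact (x n).2.2.trans h.le
          · simp only [s, Nat.unpair_pair, decide_eq_true_eq] at h
            exact h.2.le
        rw [abs_le]
        constructor <;> linarith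
      · intro y n k
        -- If no low rational were followed by a high one within `2 ^ (-k)`, lowness would propagate
        -- upwards: by density of the complement there is a certified rational between half a step
        -- and a full step further, and not being high it must be low. Starting below `0`, one would
        -- pass `1`, where everything is high.
        by_contra hcon
        have hclose : ∀ q q', ratCode q < ratCode q' → ratCode q' < ratCode q + (1 / 2) ^ k →
            low (n, q) y → ¬ high (n, q') y := by
          intro q q' h1 h2 hq hq'
          obtain ⟨c, hc1, hc2⟩ := ratCode.exists_btwn h1
          exact hcon ⟨c, q, q', ⟨hc1, hc2, by simpa using h2⟩, hq, hq'⟩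
        have hδ : (0 : ℝ) < (1 / 2) ^ k := by positivity
        have hstep : ∀ q, low (n, q) y →
            ∃ q', low (n, q') y ∧ ratCode q + (1 / 2) ^ k / 2 < ratCode q' := by
          intro q hq
          obtain ⟨q', hq'A, h1, h2⟩ := hA.exists_ratCode_notMem hc
            (show ratCode q + (1 / 2) ^ k / 2 < ratCode q + (1 / 2) ^ k by linarith)
          refine ⟨q', ?_, h1⟩
          obtain ⟨m, hm⟩ := (hRA q').1 hq'A
          have hnot := hclose q q' (by linarith) h2 hq
          cases hb : y.2 (Nat.pair n (Nat.pair q' m))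
          · exact .inr ⟨m, hm, hb⟩
          · exact absurd (.inr ⟨m, hm, hb⟩) hnot
        obtain ⟨q₀, hq₁, hq₀⟩ := ratCode.exists_btwn (show (-1 : ℝ) < 0 by norm_num)
        have hall : ∀ N : ℕ, ∃ q, low (n, q) y ∧ -1 + N * ((1 / 2) ^ k / 2) < ratCode q := by
          intro N
          induction N with
          | zero => exact ⟨q₀, .inl (by rwa [ratCode.ratCode_zero]), by simpa using hq₁⟩
          | succ N ih =>
            obtain ⟨q, hq, hN⟩ := ih
            obtain ⟨q', hq', h⟩ := hstep q hq
            refine ⟨q', hq', ?_⟩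
            push_cast
            linarith
        obtain ⟨N, hN⟩ := exists_nat_gt (2 / ((1 / 2 : ℝ) ^ k / 2))
        rw [div_lt_iff₀ (half_pos hδ)] at hN
        obtain ⟨q, hq, hqN⟩ := hall N
        obtain ⟨q', h1, h2⟩ := ratCode.exists_btwn
          (show ratCode q < ratCode q + (1 / 2) ^ k by linarith)
        refine hclose q q' h1 h2 hq (.inl ?_)
        simp only [ratCode.ratCode_dyadic, Nat.cast_one, pow_zero, one_mul]
        linarith
    exact key.omegaPower.ttReducible

end IsRealPi01

/-! ### Itineraries along the pieces of monotonicity -/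

theorem ComputablePolishSpace.ComputableReal.lt_const {X α : Type*} [Primcodable α]
    {S : ComputablePolishSpace X} {h : α → X → ℝ} (hh : ComputableReal S h) {e : ℝ}
    (he : IsComputableNumber e) : SigmaOpen S fun a x => h a x < e := by
  refine (SigmaOpen.ex (P := fun a c x => h a x < ratCode c ∧ ratCode c < e)
    (hh.lt.and (SigmaOpen.of_isSigma (he.lt.comp (by fun_prop))))).of_eq fun a x => ?_
  exact ⟨fun ⟨c, h1, h2⟩ => h1.trans h2, fun h => ratCode.exists_btwn h⟩

theorem ComputablePolishSpace.ComputableReal.const_lt {X α : Type*} [Primcodable α]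
    {S : ComputablePolishSpace X} {h : α → X → ℝ} (hh : ComputableReal S h) {e : ℝ}
    (he : IsComputableNumber e) : SigmaOpen S fun a x => e < h a x := by
  refine (SigmaOpen.ex (P := fun a c x => e < ratCode c ∧ ratCode c < h a x)
    ((SigmaOpen.of_isSigma (he.gt.comp (by fun_prop))).and hh.gt)).of_eq fun a x => ?_
  exact ⟨fun ⟨c, h1, h2⟩ => h1.trans h2, fun h => ratCode.exists_btwn h⟩

theorem ComputablePolishSpace.ComputableReal.ne {X α : Type*} [Primcodable α]
    {S : ComputablePolishSpace X} {g h : α → X → ℝ} (hg : ComputableReal S g)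
    (hh : ComputableReal S h) : SigmaOpen S fun a x => g a x ≠ h a x := by
  refine ((SigmaOpen.ex (P := fun a c x => g a x < ratCode c ∧ ratCode c < h a x)
    (hg.lt.and hh.gt)).or (SigmaOpen.ex (P := fun a c x => h a x < ratCode c ∧ ratCode c < g a x)
    (hh.lt.and hg.gt))).of_eq fun a x => ?_
  rw [ne_iff_lt_or_gt]
  exact or_congr ⟨fun ⟨c, h1, h2⟩ => h1.trans h2, fun h => ratCode.exists_btwn h⟩
    ⟨fun ⟨c, h1, h2⟩ => h1.trans h2, fun h => ratCode.exists_btwn h⟩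

theorem exists_listCode (α : ℕ → ℕ) (l : ℕ) :
    ∃ e, ∀ j ≤ l, (Denumerable.ofNat (List ℕ) e).getD j 0 = α j := by
  refine ⟨Encodable.encode ((List.range (l + 1)).map α), fun j hj => ?_⟩
  rw [Denumerable.ofNat_encode]
  simp [List.getD_eq_getElem?_getD, List.getElem?_map, List.getElem?_range (Nat.lt_succ_of_le hj)]

section Itinerary

variable {f : unitInterval → unitInterval} {M : ℕ} {lo hi : ℕ → ℝ}
  {T : ℕ → ℕ × ℕ × ℕ × ℕ → Prop}

/-- A chain of rational intervals which follows the inverse branches selected by the bits `s`. -/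
def IsBranchChain (M : ℕ) (T : ℕ → ℕ × ℕ × ℕ × ℕ → Prop) (s : ℕ → Bool) (l : ℕ)
    (α β : ℕ → ℕ) : Prop :=
  ∀ j < l, ∃ i < M, s (Nat.pair j i) = true ∧ T i (α j, β j, α (j + 1), β (j + 1))

/-- Each selected piece contains the next coordinate, so the inverse branch carries the enclosure of
`x j` to one of `x (j + 1)`. -/
theorem IsBranchChain.sound (hT : ∀ i, IsInverseBranch (realExtend f) (lo i) (hi i) (T i))
    {x : ℕ → unitInterval} (hx : ∀ n, f (x (n + 1)) = x n) {s : ℕ → Bool}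
    (hs : ∀ j i, s (Nat.pair j i) = true → lo i < x (j + 1) ∧ x (j + 1) < hi i) {l : ℕ}
    {α β : ℕ → ℕ} (h : IsBranchChain M T s l α β)
    (h0 : ratCode (α 0) < x 0 ∧ x 0 < ratCode (β 0)) :
    ∀ j ≤ l, ratCode (α j) < x j ∧ x j < ratCode (β j) := by
  intro j
  induction j with
  | zero => exact fun _ => h0
  | succ j ih =>
    intro hj
    obtain ⟨h1, h2⟩ := ih (by omega)
    obtain ⟨i, -, hsi, hTi⟩ := h j (by omega)
    obtain ⟨h3, h4⟩ := hs j i hsi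
    have e : realExtend f (x (j + 1)) = x j := by rw [realExtend_coe, hx]
    exact (hT i).sound _ _ _ _ (x (j + 1)) hTi
      ⟨max_le h3.le (x (j + 1)).2.1, le_min h4.le (x (j + 1)).2.2⟩ (by rwa [e]) (by rwa [e])

/-- Apply the clamped inverse branches successively to `t`. Neither the real nor the bits need come
from a point of the inverse limit; it is enough that some piece is selected at each step. The chain
itself is built backwards from the desired final interval, by continuity of the branches. -/
theorem IsBranchChain.total (hT : ∀ i, IsInverseBranch (realExtend f) (lo i) (hi i) (T i))
    {s : ℕ → Bool} (t : ℝ) : ∀ l, (∀ j < l, ∃ i < M, s (Nat.pair j i) = true) →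
    ∃ u : ℝ, ∀ c d, ratCode c < u → u < ratCode d → ∃ α β : ℕ → ℕ,
      (ratCode (α 0) < t ∧ t < ratCode (β 0)) ∧ IsBranchChain M T s l α β ∧ α l = c ∧ β l = d := by
  intro l
  induction l with
  | zero =>
    exact fun _ => ⟨t, fun c d hc hd => ⟨fun _ => c, fun _ => d, ⟨hc, hd⟩,
      fun j hj => absurd hj (Nat.not_lt_zero j), rfl, rfl⟩⟩
  | succ l ih =>
    intro hs
    obtain ⟨u, hu⟩ := ih fun j hj => hs j (by omega)
    obtain ⟨i, hi, hsi⟩ := hs l (by omega)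
    obtain ⟨v, -, hv⟩ := (hT i).total u
    refine ⟨v, fun c d hc hd => ?_⟩
    obtain ⟨a, b, hab, ha, hb⟩ := hv c d hc hd
    obtain ⟨α, β, h0, hchain, rfl, rfl⟩ := hu a b ha hb
    refine ⟨Function.update α (l + 1) c, Function.update β (l + 1) d, by simpa using h0,
      fun j hj => ?_, by simp, by simp⟩
    have hjl : j ≠ l + 1 := by omega
    rcases Nat.lt_succ_iff_lt_or_eq.1 hj with h | rfl
    · have hjl' : j + 1 ≠ l + 1 := by omega
      simpa only [Function.update_of_ne hjl, Function.update_of_ne hjl'] using hchain j h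
    · refine ⟨i, hi, hsi, ?_⟩
      simpa only [Function.update_of_ne hjl, Function.update_self] using hab

/-- The bits which list the pieces containing the coordinates of `x` of positive index. -/
noncomputable def itinerary (M : ℕ) (lo hi : ℕ → ℝ) (x : ℕ → ℝ) (N : ℕ) : Bool :=
  open Classical in decide (N.unpair.2 < M ∧ lo N.unpair.2 < x (N.unpair.1 + 1) ∧
    x (N.unpair.1 + 1) < hi N.unpair.2)

theorem itinerary_pair {x : ℕ → ℝ} {j i : ℕ} :
    itinerary M lo hi x (Nat.pair j i) = true ↔ i < M ∧ lo i < x (j + 1) ∧ x (j + 1) < hi i := by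
  simp [itinerary]

/-- The oracle may name a point with coordinates at ends of pieces, where the bits are undecidable.
By `hne` such a point violates the bonding relation or has coordinate `n₀` outside the rational
interval, and either is noticed in finite time. -/
theorem approximable_itinerary (hF : EffectivelyContinuous (realExtend f))
    (hlo : ∀ i, IsComputableNumber (lo i)) (hhi : ∀ i, IsComputableNumber (hi i))
    {x : ℕ → unitInterval} (hx : x ∈ inverseLimit f) {n₀ a b : ℕ}
    (ha : ratCode a < x n₀) (hb : x n₀ < ratCode b)
    (hne : ∀ x' ∈ inverseLimit f, ratCode a ≤ x' n₀ → x' n₀ ≤ ratCode b →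
      ∀ j i, (x' (n₀ + (j + 1)) : ℝ) ≠ lo i ∧ (x' (n₀ + (j + 1)) : ℝ) ≠ hi i) :
    Approximable hilbertCube boolSpace x (itinerary M lo hi fun n => x (n₀ + n)) := by
  have hcoord : ComputableReal hilbertCube fun (j : ℕ) x' => (x' (n₀ + (j + 1)) : ℝ) :=
    hilbertCube_coord.comp (g := fun j => n₀ + (j + 1)) (by fun_prop)
  -- On points satisfying `out` either bit is accepted. The given `x` does not satisfy it, so
  -- soundness is unaffected.
  let out : (ℕ → unitInterval) → Prop := fun x' =>
    (∃ n, realExtend f (x' (n + 1)) ≠ x' n) ∨ (x' n₀ : ℝ) < ratCode a ∨ ratCode b < (x' n₀ : ℝ)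
  have hout : SigmaOpen hilbertCube fun (_ : ℕ × Bool) x' => out x' := by
    refine (SigmaOpen.ex (P := fun (_ : ℕ × Bool) n (x' : ℕ → unitInterval) => realExtend f (x' (n + 1)) ≠ x' n)
      ?_).or (SigmaOpen.or ?_ ?_)
    · exact ((hF.comp (hilbertCube_coord.comp (g := fun n => n + 1) (by fun_prop))).ne
        hilbertCube_coord).comp (by fun_prop)
    · exact (hilbertCube_coord.comp (g := fun _ => n₀) (by fun_prop)).lt_const
        (isComputableNumber_ratCode a)
    · exact (hilbertCube_coord.comp (g := fun _ => n₀) (by fun_prop)).const_lt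
        (isComputableNumber_ratCode b)
  have hxout : ¬ out x := by
    rintro (⟨n, hn⟩ | h | h)
    · rw [realExtend_coe, hx n] at hn
      exact hn rfl
    · exact lt_asymm h ha
    · exact lt_asymm h hb
  have hin := SigmaOpen.finite_cases (P := fun i (j : ℕ) (x' : ℕ → unitInterval) =>
    lo i < x' (n₀ + (j + 1)) ∧ x' (n₀ + (j + 1)) < hi i)
    (fun i => (hcoord.const_lt (hlo i)).and (hcoord.lt_const (hhi i))) M
  have hoff := SigmaOpen.finite_cases (P := fun i (j : ℕ) (x' : ℕ → unitInterval) =>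
    x' (n₀ + (j + 1)) < lo i ∨ hi i < x' (n₀ + (j + 1)))
    (fun i => (hcoord.lt_const (hlo i)).or (hcoord.const_lt (hhi i))) M
  refine Approximable.bool (fun (t : ℕ × Bool) x' => out x' ∨
    (t.2 = true ∧ t.1.unpair.2 < M ∧ lo t.1.unpair.2 < x' (n₀ + (t.1.unpair.1 + 1)) ∧
      x' (n₀ + (t.1.unpair.1 + 1)) < hi t.1.unpair.2) ∨
    (t.2 = false ∧ (M < t.1.unpair.2 + 1 ∨ t.1.unpair.2 < M ∧
      (x' (n₀ + (t.1.unpair.1 + 1)) < lo t.1.unpair.2 ∨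
        hi t.1.unpair.2 < x' (n₀ + (t.1.unpair.1 + 1)))))) ?_ ?_ ?_
  · exact hout.or (((SigmaOpen.of_isSigma (IsSigma.eq (by fun_prop) (by fun_prop))).and
      (hin.comp (g := fun t : ℕ × Bool => (t.1.unpair.2, t.1.unpair.1)) (by fun_prop))).or
      ((SigmaOpen.of_isSigma (IsSigma.eq (by fun_prop) (by fun_prop))).and
      ((SigmaOpen.of_isSigma (IsSigma.nat_lt (by fun_prop) (by fun_prop))).or
      (hoff.comp (g := fun t : ℕ × Bool => (t.1.unpair.2, t.1.unpair.1)) (by fun_prop)))))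
  · rintro N c (h | ⟨rfl, h⟩ | ⟨rfl, h⟩)
    · exact absurd h hxout
    · exact decide_eq_true h
    · refine decide_eq_false ?_
      rintro ⟨h1, h2, h3⟩
      rcases h with h | ⟨-, h | h⟩
      · simp only at h
        omega
      · exact lt_asymm h h2
      · exact lt_asymm h h3
  · intro x' N
    by_cases hx' : out x'
    · exact ⟨true, .inl hx'⟩
    rcases lt_or_ge N.unpair.2 M with hM | hM
    · simp only [out, not_or, not_exists, not_not, not_lt] at hx'
      have hK : x' ∈ inverseLimit f := fun n => Subtype.ext (by rw [← hx'.1 n, realExtend_coe])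
      obtain ⟨h1, h2⟩ := hne x' hK hx'.2.1 hx'.2.2 N.unpair.1 N.unpair.2
      rcases lt_or_gt_of_ne h1 with h1 | h1
      · exact ⟨false, .inr (.inr ⟨rfl, .inr ⟨hM, .inl h1⟩⟩)⟩
      rcases lt_or_gt_of_ne h2 with h2 | h2
      · exact ⟨true, .inr (.inl ⟨rfl, hM, h1, h2⟩)⟩
      · exact ⟨false, .inr (.inr ⟨rfl, .inr ⟨hM, .inr h2⟩⟩)⟩
    · exact ⟨false, .inr (.inr ⟨rfl, .inl (Nat.lt_succ_of_le hM)⟩)⟩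

theorem computableReal_iterate (hF : EffectivelyContinuous (realExtend f)) (m : ℕ) :
    ComputableReal realTimesCantor fun (_ : Unit) y => (realExtend f)^[m] y.1 := by
  induction m with
  | zero => exact realTimesCantor_fst
  | succ m ih =>
    simp only [Function.iterate_succ_apply']
    exact hF.comp ih

theorem realExtend_iterate {x : ℕ → unitInterval} (hx : x ∈ inverseLimit f) (n m : ℕ) :
    (realExtend f)^[m] (x (n + m)) = x n := by
  induction m with
  | zero => rfl
  | succ m ih =>
    rw [Function.iterate_succ_apply, realExtend_coe, ← add_assoc, hx (n + m), ih]

/-- Up to index `n₀` the coordinates are iterated images of the real component. Beyond it, an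
enclosure of this real is pushed through the inverse branches selected by the bits until it is short
enough. -/
theorem approximable_of_itinerary (hF : EffectivelyContinuous (realExtend f))
    (hT : ∀ i, IsInverseBranch (realExtend f) (lo i) (hi i) (T i))
    {x : ℕ → unitInterval} (hx : x ∈ inverseLimit f) {n₀ : ℕ}
    (hcover : ∀ j, ∃ i < M, lo i < x (n₀ + (j + 1)) ∧ x (n₀ + (j + 1)) < hi i) :
    Approximable realTimesCantor unitIntervalSpace
      ((x n₀ : ℝ), itinerary M lo hi fun n => x (n₀ + n)) x := by
  have hnear := SigmaOpen.finite_cases (P := fun n (t : ℕ × ℕ) (y : ℝ × (ℕ → Bool)) =>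
    |ratCode t.1 - (realExtend f)^[n₀ - n] y.1| < (1 / 2) ^ t.2)
    (fun n => (computableReal_iterate hF (n₀ - n)).near.comp
      (g := fun t : ℕ × ℕ => ((), t.1, t.2)) (by fun_prop)) (n₀ + 1)
  -- Bits that select no piece at some step cannot belong to `x`, by `hcover`. This is recognizable
  -- because only `M` bits are inspected, and then any output will do.
  let bad : ℕ → ℝ × (ℕ → Bool) → Prop := fun l y =>
    ∃ j, j < l ∧ ∀ i < M, y.2 (Nat.pair j i) = false
  have hbad : SigmaOpen realTimesCantor bad := by
    refine SigmaOpen.ex (P := fun l j (y : ℝ × (ℕ → Bool)) =>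
      j < l ∧ ∀ i < M, y.2 (Nat.pair j i) = false)
      ((SigmaOpen.of_isSigma (IsSigma.nat_lt (by fun_prop) (by fun_prop))).and
      (SigmaOpen.ball (P := fun (t : ℕ × ℕ) i (y : ℝ × (ℕ → Bool)) =>
        y.2 (Nat.pair t.2 i) = false) ?_ (g := fun _ => M) (by fun_prop)))
    exact realTimesCantor_bit.comp
      (g := fun t : (ℕ × ℕ) × ℕ => (Nat.pair t.1.2 t.2, false)) (by fun_prop)
  let L : ℕ → ℕ → ℕ := fun e j => (Denumerable.ofNat (List ℕ) e).getD j 0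
  have hchain : SigmaOpen realTimesCantor fun (t : ℕ × ℕ × ℕ) y =>
      IsBranchChain M T y.2 t.1 (L t.2.1) (L t.2.2) := by
    refine SigmaOpen.ball (P := fun (t : ℕ × ℕ × ℕ) j (y : ℝ × (ℕ → Bool)) => ∃ i < M,
      y.2 (Nat.pair j i) = true ∧ T i (L t.2.1 j, L t.2.2 j, L t.2.1 (j + 1), L t.2.2 (j + 1)))
      (SigmaOpen.ex_lt_const (P := fun i (t : (ℕ × ℕ × ℕ) × ℕ) (y : ℝ × (ℕ → Bool)) =>
        y.2 (Nat.pair t.2 i) = true ∧ T i (L t.1.2.1 t.2, L t.1.2.2 t.2, L t.1.2.1 (t.2 + 1),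
          L t.1.2.2 (t.2 + 1))) (fun i => ?_) M) (by fun_prop)
    refine (realTimesCantor_bit.comp (g := fun t : (ℕ × ℕ × ℕ) × ℕ => (Nat.pair t.2 i, true))
      (by fun_prop)).and (SigmaOpen.of_isSigma ((hT i).isSigma.comp
        (g := fun t : (ℕ × ℕ × ℕ) × ℕ => (L t.1.2.1 t.2, L t.1.2.2 t.2, L t.1.2.1 (t.2 + 1),
          L t.1.2.2 (t.2 + 1))) ?_))
    simp only [L]
    fun_prop
  let follow : ℕ × ℕ × ℕ → ℝ × (ℕ → Bool) → Prop := fun t y => ∃ e e',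
    ((ratCode (L e 0) < y.1 ∧ y.1 < ratCode (L e' 0)) ∧
      IsBranchChain M T y.2 t.1 (L e) (L e')) ∧
    ratCode (L e t.1) < ratCode t.2.1 ∧ ratCode t.2.1 < ratCode (L e' t.1) ∧
      ratCode (L e' t.1) < ratCode (ratCode.add (L e t.1) (ratCode.dyadic 1 t.2.2))
  have hfollow : SigmaOpen realTimesCantor follow := by
    refine SigmaOpen.ex₂ (P := fun (t : ℕ × ℕ × ℕ) e e' (y : ℝ × (ℕ → Bool)) =>
      ((ratCode (L e 0) < y.1 ∧ y.1 < ratCode (L e' 0)) ∧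
        IsBranchChain M T y.2 t.1 (L e) (L e')) ∧
      ratCode (L e t.1) < ratCode t.2.1 ∧ ratCode t.2.1 < ratCode (L e' t.1) ∧
        ratCode (L e' t.1) < ratCode (ratCode.add (L e t.1) (ratCode.dyadic 1 t.2.2)))
      (((realTimesCantor_fst.between.comp
        (g := fun t : (ℕ × ℕ × ℕ) × ℕ × ℕ => ((), L t.2.1 0, L t.2.2 0)) ?_).and
      (hchain.comp (g := fun t : (ℕ × ℕ × ℕ) × ℕ × ℕ => (t.1.1, t.2.1, t.2.2)) (by fun_prop))).and
      (SigmaOpen.of_isSigma ((ratCode.isSigma_lt ?_ (by fun_prop)).and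
        ((ratCode.isSigma_lt (by fun_prop) ?_).and (ratCode.isSigma_lt ?_ ?_)))))
    all_goals
      simp only [L]
      fun_prop
  refine Approximable.unitInterval (fun (t : ℕ × ℕ × ℕ) y =>
    (t.1 < n₀ + 1 ∧ |ratCode t.2.1 - (realExtend f)^[n₀ - t.1] y.1| < (1 / 2) ^ t.2.2) ∨
      (n₀ < t.1 ∧ (bad (t.1 - n₀) y ∨ follow (t.1 - n₀, t.2.1, t.2.2) y))) ?_ ?_ ?_
  · exact hnear.or ((SigmaOpen.of_isSigma (IsSigma.nat_lt (by fun_prop) (by fun_prop))).and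
      ((hbad.comp (by fun_prop)).or (hfollow.comp
        (g := fun t : ℕ × ℕ × ℕ => (t.1 - n₀, t.2.1, t.2.2)) (by fun_prop))))
  · rintro n c k (⟨hn, h⟩ | ⟨hn, ⟨j, -, hj⟩ | ⟨e, e', ⟨h0, hch⟩, h1, h2, h3⟩⟩)
    · have := realExtend_iterate hx n (n₀ - n)
      rw [show n + (n₀ - n) = n₀ by simp only at hn; omega] at this
      simp only [this] at h
      exact h.le
    · obtain ⟨i, hi', h⟩ := hcover j
      have h1 : itinerary M lo hi (fun n => (x (n₀ + n) : ℝ)) (Nat.pair j i) = false := hj i hi'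
      rw [itinerary_pair.2 ⟨hi', h⟩] at h1
      exact absurd h1 (by simp)
    · have hch' : IsBranchChain M T (itinerary M lo hi fun n => (x (n₀ + n) : ℝ)) (n - n₀)
        (L e) (L e') := hch
      have := hch'.sound (x := fun m => x (n₀ + m)) hT (fun m => hx (n₀ + m))
        (fun j i h => (itinerary_pair.1 h).2) h0 _ le_rfl
      simp only [ratCode.ratCode_add, ratCode.ratCode_dyadic, Nat.cast_one, one_mul,
        show n₀ + (n - n₀) = n by simp only at hn; omega] at this h1 h2 h3
      rw [abs_le]
      constructor <;> linarith [this.1, this.2]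
  · intro y n k
    rcases Nat.lt_or_ge n₀ n with hn | hn
    · by_cases hb : bad (n - n₀) y
      · exact ⟨0, .inr ⟨hn, .inl hb⟩⟩
      · have hbits : ∀ j < n - n₀, ∃ i < M, y.2 (Nat.pair j i) = true := by
          intro j hj
          by_contra hcon
          push Not at hcon
          exact hb ⟨j, hj, fun i hi => by simpa using hcon i hi⟩
        obtain ⟨u, hu⟩ := IsBranchChain.total hT y.1 (n - n₀) hbits
        have hδ : (0 : ℝ) < (1 / 2) ^ k := by positivity
        obtain ⟨c, hc, hc'⟩ := ratCode.exists_btwn (show u - (1 / 2) ^ k / 2 < u by linarith)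
        obtain ⟨d, hd, hd'⟩ := ratCode.exists_btwn (show u < u + (1 / 2) ^ k / 2 by linarith)
        obtain ⟨α, β, h0, hch, hα, hβ⟩ := hu c d hc' hd
        obtain ⟨e, he⟩ := exists_listCode α (n - n₀)
        obtain ⟨e', he'⟩ := exists_listCode β (n - n₀)
        obtain ⟨v, hv, hv'⟩ := ratCode.exists_btwn (hc'.trans hd)
        have he0 : L e (n - n₀) = c := (he _ le_rfl).trans hα
        have he0' : L e' (n - n₀) = d := (he' _ le_rfl).trans hβ
        refine ⟨v, .inr ⟨hn, .inr ⟨e, e', ⟨⟨?_, ?_⟩, fun j hj => ?_⟩, ?_, ?_, ?_⟩⟩⟩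
        · rw [show L e 0 = α 0 from he 0 (Nat.zero_le _)]
          exact h0.1
        · rw [show L e' 0 = β 0 from he' 0 (Nat.zero_le _)]
          exact h0.2
        · rw [show L e j = α j from he j hj.le, show L e' j = β j from he' j hj.le,
            show L e (j + 1) = α (j + 1) from he _ hj, show L e' (j + 1) = β (j + 1) from he' _ hj]
          exact hch j hj
        · simpa only [he0] using hv
        · simpa only [he0'] using hv'
        · simp only [he0, he0', ratCode.ratCode_add, ratCode.ratCode_dyadic, Nat.cast_one, one_mul]
          linarith
    · obtain ⟨c, hc⟩ := ratCode.exists_near ((realExtend f)^[n₀ - n] y.1) k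
      exact ⟨c, .inl ⟨Nat.lt_succ_of_le hn, hc⟩⟩

end Itinerary

/-! ### The closed orbits of the extrema and the main theorem -/

theorem continuous_of_realExtend {f : unitInterval → unitInterval}
    (h : Continuous (realExtend f)) : Continuous f := by
  refine continuous_induced_rng.2 ?_
  have : ((↑) : unitInterval → ℝ) ∘ f = fun x : unitInterval => realExtend f x := by
    funext x
    rw [realExtend_coe]
    rfl
  rw [this]
  exact h.comp continuous_subtype_val

theorem apply_mem_closure_forwardOrbit {f : unitInterval → unitInterval} (hf : Continuous f)
    {e x : unitInterval} (hx : x ∈ closure (forwardOrbit f e)) :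
    f x ∈ closure (forwardOrbit f e) := by
  refine map_mem_closure hf hx ?_
  rintro _ ⟨n, rfl⟩
  exact ⟨n + 1, Function.iterate_succ_apply' f n e⟩

theorem EffectivelyAsymptoticallyPeriodic.countable_closure {f : unitInterval → unitInterval}
    {e : unitInterval} (h : EffectivelyAsymptoticallyPeriodic f e) :
    (closure (forwardOrbit f e)).Countable := by
  obtain ⟨-, y, hy, hcl⟩ := h
  rw [hcl]
  exact (countable_range _).union hy.countable

theorem theorem5 (f : unitInterval → unitInterval)
    (hcomp : unitIntervalSpace.IsComputableMap unitIntervalSpace f)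
    (hmono : PiecewiseMonotone f) (hfin : FiniteToOne f)
    (hex : ∀ z ∈ localExtrema f, EffectivelyAsymptoticallyPeriodic f z) :
    ∀ x ∈ inverseLimit f, ∃ y : ℝ × (ℕ → Bool),
      ComputablePolishSpace.TTEquivalent hilbertCube realTimesCantor x y := by
  intro x hx
  have hF := hcomp.effectivelyContinuous
  have hE := hmono.finite_localExtrema hfin
  have hfc := continuous_of_realExtend hF.continuous
  obtain ⟨M, lo, hi, T, hlo, hhi, hT, hcover⟩ := exists_pieces hF hE
  -- `A` contains the extrema and is mapped into itself by `f`. It is a finite union of `Π⁰₁` sets,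
  -- each countable as the union of an orbit and a finite set.
  let A : Set unitInterval := ⋃ e ∈ localExtrema f, closure (forwardOrbit f e)
  have hA : IsRealPi01 ((↑) '' A : Set ℝ) := by
    rw [image_iUnion₂]
    exact IsRealPi01.biUnion hE fun e he => (hex e he).1.isRealPi01
  have hAc : ((↑) '' A : Set ℝ).Countable :=
    (hE.countable.biUnion fun e he => (hex e he).countable_closure).image _
  have hAf : ∀ z ∈ A, f z ∈ A := by
    intro z hz
    obtain ⟨e, he, hze⟩ := mem_iUnion₂.1 hz
    exact mem_iUnion₂.2 ⟨e, he, apply_mem_closure_forwardOrbit hfc hze⟩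
  have hEA : ∀ e ∈ localExtrema f, e ∈ A := fun e he =>
    mem_iUnion₂.2 ⟨e, he, subset_closure ⟨0, rfl⟩⟩
  have hback : ∀ x' ∈ inverseLimit f, ∀ n m, x' (n + m) ∈ A → x' n ∈ A := by
    intro x' hx' n m
    induction m with
    | zero => exact id
    | succ m ih =>
      intro h
      refine ih ?_
      rw [← hx' (n + m)]
      exact hAf _ h
  by_cases hxA : ∀ n, x n ∈ A
  · exact hA.exists_ttEquivalent hAc fun n => mem_image_of_mem _ (hxA n)
  push Not at hxA
  obtain ⟨n₀, hn₀⟩ := hxA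
  have hn₀' : (x n₀ : ℝ) ∈ ((↑) '' A : Set ℝ)ᶜ := by
    rintro ⟨z, hz, hzx⟩
    exact hn₀ (Subtype.ext hzx ▸ hz)
  -- Shrinking to rational end points strictly between `l` and `r` makes the closed interval miss
  -- `A`, as is needed because leaving the closed interval is the observable event.
  obtain ⟨l, r, ⟨hl, hr⟩, hlr⟩ := mem_nhds_iff_exists_Ioo_subset.1
    (hA.isClosed.isOpen_compl.mem_nhds hn₀')
  obtain ⟨a, hla, hax⟩ := ratCode.exists_btwn hl
  obtain ⟨b, hxb, hbr⟩ := ratCode.exists_btwn hr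
  -- A later coordinate that is an extremum would lie in `A`, and then so would the coordinate `n₀`,
  -- one of its iterated images.
  have hoff : ∀ x' ∈ inverseLimit f, ratCode a ≤ x' n₀ → x' n₀ ≤ ratCode b → ∀ j,
      (x' (n₀ + (j + 1)) : ℝ) ∉ ((↑) '' localExtrema f : Set ℝ) := by
    rintro x' hx' ha hb j ⟨e, he, hex'⟩
    have h1 : x' (n₀ + (j + 1)) ∈ A := Subtype.ext hex' ▸ hEA e he
    exact hlr ⟨hla.trans_le ha, hb.trans_lt hbr⟩ (mem_image_of_mem _ (hback x' hx' _ _ h1))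
  have hbit := approximable_itinerary (M := M) hF hlo hhi hx hax hxb fun x' hx' ha hb j i =>
    (hcover _ (x' (n₀ + (j + 1))).2 (hoff x' hx' ha hb j)).2 i
  have hreal : Approximable hilbertCube realSpace x fun _ : Unit => (x n₀ : ℝ) := by
    refine Approximable.real (fun t x' => |ratCode t.2.1 - (x' n₀ : ℝ)| < (1 / 2) ^ t.2.2)
      ?_ (fun _ _ _ h => le_of_lt h) fun x' _ k => ratCode.exists_near _ k
    exact hilbertCube_coord.near.comp (g := fun t : Unit × ℕ × ℕ => (n₀, t.2.1, t.2.2))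
      (by fun_prop)
  refine ⟨(x n₀, itinerary M lo hi fun n => x (n₀ + n)),
    (hreal.prod hbit.omegaPower).ttReducible, ?_⟩
  exact (approximable_of_itinerary hF hT hx fun j =>
    (hcover _ (x (n₀ + (j + 1))).2 (hoff x hx hax.le hxb.le j)).1).omegaPower.ttReducible
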